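/- Let $\mathbb{D}=\{z\in\mathbb{C}:|z|<1\}$ and $\mathbb{S}^1=\partial\mathbb{D}$. For a finite positive Borel measure $\tilde\nu$ on $\mathbb{D}$ and a real-valued $h\in L^\infty(\mathbb{S}^1)$, consider the Dirichlet problem $$\Delta u=4e^{2u}+2\pi\tilde\nu \ \text{ in } \mathbb{D},\qquad u=h\ \text{ on } \mathbb{S}^1. \tag{$*$}$$ A solution of $(*)$ is a real-valued function $u$ on $\mathbb{D}$ such that: (a) $u$ and $e^{2u}$ belong to $L^1_{\mathrm{loc}}(\mathbb{D})$, and for every $\phi\in C_c^\infty(\mathbb{D})$, $$\int_{\mathbb{D}}u\,\Delta\phi\,|dz|^2=\int_{\mathbb{D}}4e^{2u}\phi\,|dz|^2+2\pi\int_{\mathbb{D}}\phi\,d\tilde\nu;$$ (b) for all $r<1$ sufficiently close to $1$, $u$ is integrable on the circle $|z|=r$, and the measures $u\,d\theta|_{\{|z|=r\}}$ converge weakly to $h\,d\theta$ as $r\to1^-$, that is, for every continuous $g:\mathbb{S}^1\to\mathbb{R}$, $$\lim_{r\to1^-}\int_0^{2\pi}g(e^{i\theta})\,u(re^{i\theta})\,d\theta=\int_0^{2\pi}g(e^{i\theta})\,h(e^{i\theta})\,d\theta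 .$$ **Theorem.** For every finite positive measure $\tilde\nu$ on $\mathbb{D}$ and every $h\in L^\infty(\mathbb{S}^1)$, problem $(*)$ has a solution, and any two solutions agree almost everywhere on $\mathbb{D}$. Moreover, if $u_1,u_2$ are solutions of $(*)$ with data $(\tilde\nu_1,h_1)$ and $(\tilde\nu_2,h_2)$ respectively (the $\tilde\nu_i$ finite positive measures, $h_i\in L^\infty(\mathbb{S}^1)$), and $h_1\le h_2$ almost everywhere on $\mathbb{S}^1$ and $\tilde\nu_1\ge\tilde\nu_2$, then $u_1\le u_2$ almost everywhere on $\mathbb{D}$. -/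

import Mathlib

open MeasureTheory Set Filter Topology
open scoped ContDiff

/-- `h` is an element of `L^∞(𝕊¹)`, with respect to arc length `dθ`. -/
def MemLinftyCircle (h : Circle → ℝ) : Prop :=
  MemLp (fun θ : ℝ => h (Circle.exp θ)) ⊤ (volume.restrict (Ioc 0 (2 * Real.pi)))

/-- `φ ∈ C_c^∞(𝔻)`: a smooth real function on the plane whose support is a compact subset of
the open unit disk. -/
def IsDiskTestFunction (φ : ℂ → ℝ) : Prop :=
  ContDiff ℝ ∞ φ ∧ HasCompactSupport φ ∧ tsupport φ ⊆ Metric.ball 0 1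

/-- `u` is a weak solution of `Δu = 4 e^{2u} + 2π ν` in the open unit disk: `u` and `e^{2u}` are
in `L^1_loc(𝔻)`, and the equation holds in the sense of distributions. Only the values of `u` in
the open unit disk are used. -/
structure IsWeakGaussSolution (ν : Measure (Metric.ball (0 : ℂ) 1)) (u : ℂ → ℝ) : Prop where
  locallyIntegrable : LocallyIntegrableOn u (Metric.ball 0 1) volume
  locallyIntegrable_exp :
    LocallyIntegrableOn (fun z => Real.exp (2 * u z)) (Metric.ball 0 1) volume
  weak_eq : ∀ φ : ℂ → ℝ, IsDiskTestFunction φ →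
    ∫ z in Metric.ball (0 : ℂ) 1, u z * Laplacian.laplacian φ z =
      (∫ z in Metric.ball (0 : ℂ) 1, 4 * Real.exp (2 * u z) * φ z)
        + 2 * Real.pi * ∫ z : Metric.ball (0 : ℂ) 1, φ z ∂ν

/-- `u = h` on `𝕊¹` in the weak sense: as `r → 1` from below, `u` is integrable on the circle
`|z| = r`, and the measures `u dθ` on these circles, carried to `𝕊¹` by `z ↦ z / r`, converge
weakly (against continuous functions) to `h dθ`. -/
structure HasWeakBoundaryValues (u : ℂ → ℝ) (h : Circle → ℝ) : Prop where
  circleIntegrable : ∀ᶠ r in 𝓝[<] (1 : ℝ), CircleIntegrable u 0 r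
  tendsto : ∀ g : C(Circle, ℝ),
    Tendsto (fun r : ℝ => ∫ θ in (0 : ℝ)..(2 * Real.pi), g (Circle.exp θ) * u (circleMap 0 r θ))
      (𝓝[<] 1)
      (𝓝 (∫ θ in (0 : ℝ)..(2 * Real.pi), g (Circle.exp θ) * h (Circle.exp θ)))

/-- `u` solves the Dirichlet problem `Δu = 4 e^{2u} + 2π ν` in `𝔻`, `u = h` on `𝕊¹`. -/
structure IsGaussDirichletSolution (ν : Measure (Metric.ball (0 : ℂ) 1)) (h : Circle → ℝ)
    (u : ℂ → ℝ) : Prop where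
  weakSolution : IsWeakGaussSolution ν u
  boundary : HasWeakBoundaryValues u h

/-! Comparison. The difference of two solutions satisfies Δ(u₁ - u₂) ≥ 4e^{2u₁} - 4e^{2u₂} weakly,
and the right side is nonnegative where u₁ > u₂, so a maximum principle should apply. There are two
obstacles: the functions are only locally integrable, and the boundary values are attained only
weakly. The first is met by Kato's inequality (`IsWeakSubsolution.convex_comp`): tested against a
cutoff of 1 - |z|², it gives `IsWeakSubsolution.ae_nonpos` for functions whose positive part tends
to 0 uniformly at the circle.

The second needs linearity, since taking positive parts does not commute with weak limits. Averaging
a weakly subharmonic v over rotations with a continuous weight g ≥ 0 keeps it subharmonic, and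
Banach-Steinhaus together with compactness of the circle makes the boundary bound of the average
uniform. So every such average is nonpositive, and a suitable g then forces v ≤ 0
(`IsWeakSubsolution.ae_nonpos_of_boundaryValues`). Applied to u₂ - M this gives u₂ ≤ M; applied to
u₁ - u₂ - e^{2M}(1 - |z|²) it gives u₁ - u₂ ≤ e^{2M}(1 - |z|²). This is uniform control at the
boundary, and the nonlinear maximum principle finishes. Uniqueness is comparison in both directions.

Existence. Write u = P[h] - G_ν - v, with P[h] the Poisson integral, G_ν the Green potential of the
measure, and v the Green potential of the density 4e^{2u}. Both potentials are nonnegative, so u ≤ M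
whenever h ≤ M, and the exponential may be truncated above M to a bounded, monotone, Lipschitz f.
The equation for v is solved by the method of continuity in a factor s in front of f. By the maximum
principle the monotone term never spoils the estimates, so steps of one fixed length are all
contractions of L^∞ with ratio 1/4 (`SolvableAt.add`). Both Green potentials have circle means
tending to 0, so the boundary values are those of P[h]. -/

/-! ### Calculus of the Laplacian in the plane. -/

/-- The Laplacian in the plane as a sum of two iterated partial derivatives. -/
lemma laplacian_eq_fderiv_fderiv {f : ℂ → ℝ} {z : ℂ} (hf : ContDiffAt ℝ 2 f z) :
    Laplacian.laplacian f z = fderiv ℝ (fun w => fderiv ℝ f w 1) z 1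
      + fderiv ℝ (fun w => fderiv ℝ f w Complex.I) z Complex.I := by
  have hd : DifferentiableAt ℝ (fderiv ℝ f) z :=
    (hf.fderiv_right (m := 1) (by norm_num)).differentiableAt (by norm_num)
  have key : ∀ e : ℂ, fderiv ℝ (fun w => fderiv ℝ f w e) z e = fderiv ℝ (fderiv ℝ f) z e e := by
    intro e
    rw [fderiv_clm_apply hd (differentiableAt_const e)]
    simp
  rw [InnerProductSpace.laplacian_eq_iteratedFDeriv_complexPlane, key, key]
  simp [iteratedFDeriv_two_apply]

lemma contDiffAt_fderiv_apply {f : ℂ → ℝ} {z : ℂ} {m n : WithTop ℕ∞} (hf : ContDiffAt ℝ n f z)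
    (h : m + 1 ≤ n) (e : ℂ) : ContDiffAt ℝ m (fun w => fderiv ℝ f w e) z :=
  (hf.fderiv_right h).clm_apply contDiffAt_const

lemma tsupport_fderiv_apply_subset' (f : ℂ → ℝ) (e : ℂ) :
    tsupport (fun w => fderiv ℝ f w e) ⊆ tsupport f :=
  tsupport_fderiv_apply_subset ℝ e

lemma tsupport_laplacian_subset (f : ℂ → ℝ) : tsupport (Laplacian.laplacian f) ⊆ tsupport f := by
  refine closure_minimal (fun z hz => ?_) (isClosed_tsupport f)
  by_contra hz'
  have h0 : f =ᶠ[𝓝 z] fun _ => 0 := notMem_tsupport_iff_eventuallyEq.1 hz'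
  have := InnerProductSpace.laplacian_congr_nhds h0
  apply hz
  rw [this.eq_of_nhds]
  simp

lemma continuous_laplacian {f : ℂ → ℝ} (hf : ContDiff ℝ 2 f) :
    Continuous (Laplacian.laplacian f) := by
  have : Laplacian.laplacian f = fun z => fderiv ℝ (fun w => fderiv ℝ f w 1) z 1
      + fderiv ℝ (fun w => fderiv ℝ f w Complex.I) z Complex.I :=
    funext fun z => laplacian_eq_fderiv_fderiv hf.contDiffAt
  rw [this]
  have key : ∀ e : ℂ, Continuous fun z => fderiv ℝ (fun w => fderiv ℝ f w e) z e := by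
    intro e
    have h1 : ContDiff ℝ 1 fun w => fderiv ℝ f w e :=
      contDiff_iff_contDiffAt.2 fun z => contDiffAt_fderiv_apply hf.contDiffAt (by norm_num) e
    exact (h1.continuous_fderiv (by norm_num)).clm_apply continuous_const
  exact (key 1).add (key Complex.I)

/-- A product is continuous as soon as one factor is continuous and the other one is continuous
at every point of its topological support. -/
lemma continuous_mul_of_tsupport {f g : ℂ → ℝ} (hg : Continuous g)
    (hf : ∀ z ∈ tsupport g, ContinuousAt f z) : Continuous fun z => f z * g z := by
  refine continuous_iff_continuousAt.2 fun z => ?_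
  by_cases hz : z ∈ tsupport g
  · exact (hf z hz).mul hg.continuousAt
  · have h0 : g =ᶠ[𝓝 z] fun _ => 0 := notMem_tsupport_iff_eventuallyEq.1 hz
    have : (fun z => f z * g z) =ᶠ[𝓝 z] fun _ => 0 := h0.mono fun w hw => by simp [hw]
    exact continuousAt_const.congr this.symm

lemma integrable_mul_of_tsupport {f g : ℂ → ℝ} (hg : Continuous g) (hc : HasCompactSupport g)
    (hf : ∀ z ∈ tsupport g, ContinuousAt f z) : Integrable fun z => f z * g z :=
  (continuous_mul_of_tsupport hg hf).integrable_of_hasCompactSupport hc.mul_left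

/-- Two integrations by parts in the direction `e`. Regularity of `f` is needed only on the support
of `φ`, since every product that occurs vanishes near the remaining points. -/
lemma integral_mul_fderiv_fderiv {f φ : ℂ → ℝ} (e : ℂ) (hφ : ContDiff ℝ 2 φ)
    (hc : HasCompactSupport φ) (hf : ∀ z ∈ tsupport φ, ContDiffAt ℝ 2 f z) :
    ∫ z, f z * fderiv ℝ (fun w => fderiv ℝ φ w e) z e =
      ∫ z, fderiv ℝ (fun w => fderiv ℝ f w e) z e * φ z := by
  have h1 : ContDiff ℝ 1 fun w => fderiv ℝ φ w e :=
      contDiff_iff_contDiffAt.2 fun z => contDiffAt_fderiv_apply hφ.contDiffAt (by norm_num) e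
  have h2 : Continuous fun z => fderiv ℝ (fun w => fderiv ℝ φ w e) z e :=
    (h1.continuous_fderiv (by norm_num)).clm_apply continuous_const
  have s1 := tsupport_fderiv_apply_subset' φ e
  have s2 := (tsupport_fderiv_apply_subset' (fun w => fderiv ℝ φ w e) e).trans s1
  have c1 : HasCompactSupport fun w => fderiv ℝ φ w e := hc.mono' (subset_closure.trans s1)
  have c2 : HasCompactSupport fun z => fderiv ℝ (fun w => fderiv ℝ φ w e) z e :=
    hc.mono' (subset_closure.trans s2)
  have f1 : ∀ z ∈ tsupport φ, ContDiffAt ℝ 1 (fun w => fderiv ℝ f w e) z := fun z hz =>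
    contDiffAt_fderiv_apply (hf z hz) (by norm_num) e
  have f2 : ∀ z ∈ tsupport φ, ContinuousAt (fun z => fderiv ℝ (fun w => fderiv ℝ f w e) z e) z :=
    fun z hz => (contDiffAt_fderiv_apply (m := 0) (f1 z hz) (by norm_num) e).continuousAt
  rw [integral_mul_fderiv_eq_neg_fderiv_mul_of_integrable,
    integral_mul_fderiv_eq_neg_fderiv_mul_of_integrable, neg_neg]
  · exact integrable_mul_of_tsupport hφ.continuous hc f2
  · exact integrable_mul_of_tsupport h1.continuous c1 fun z hz => (f1 z (s1 hz)).continuousAt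
  · exact integrable_mul_of_tsupport hφ.continuous hc fun z hz => (f1 z hz).continuousAt
  · exact fun z hz => (f1 z hz).differentiableAt (by norm_num)
  · exact fun z _ => (hφ.differentiable (by norm_num)) z
  · exact integrable_mul_of_tsupport h1.continuous c1 fun z hz => (f1 z (s1 hz)).continuousAt
  · exact integrable_mul_of_tsupport h2 c2 fun z hz => (hf z (s2 hz)).continuousAt
  · exact integrable_mul_of_tsupport h1.continuous c1 fun z hz => (hf z (s1 hz)).continuousAt
  · exact fun z hz => (hf z (s1 hz)).differentiableAt (by norm_num)
  · exact fun z _ => (h1.differentiable (by norm_num)) z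

/-- Green's second identity for a compactly supported test function. -/
lemma integral_mul_laplacian {f φ : ℂ → ℝ} (hφ : ContDiff ℝ 2 φ)
    (hc : HasCompactSupport φ) (hf : ∀ z ∈ tsupport φ, ContDiffAt ℝ 2 f z) :
    ∫ z, f z * Laplacian.laplacian φ z = ∫ z, Laplacian.laplacian f z * φ z := by
  have key : ∀ e : ℂ, ContDiff ℝ 1 fun w => fderiv ℝ φ w e := fun e =>
      contDiff_iff_contDiffAt.2 fun z => contDiffAt_fderiv_apply hφ.contDiffAt (by norm_num) e
  have i1 : ∀ e : ℂ, Integrable fun z => f z * fderiv ℝ (fun w => fderiv ℝ φ w e) z e := by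
    intro e
    have s1 := tsupport_fderiv_apply_subset' φ e
    have s2 := (tsupport_fderiv_apply_subset' (fun w => fderiv ℝ φ w e) e).trans s1
    exact integrable_mul_of_tsupport
      (((key e).continuous_fderiv (by norm_num)).clm_apply continuous_const)
      (hc.mono' (subset_closure.trans s2)) fun z hz => (hf z (s2 hz)).continuousAt
  have i2 : ∀ e : ℂ, Integrable fun z => fderiv ℝ (fun w => fderiv ℝ f w e) z e * φ z := by
    intro e
    refine integrable_mul_of_tsupport hφ.continuous hc fun z hz => ?_
    exact (contDiffAt_fderiv_apply (m := 0) (contDiffAt_fderiv_apply (m := 1) (hf z hz)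
      (by norm_num) e) (by norm_num) e).continuousAt
  have e1 : ∀ z, f z * Laplacian.laplacian φ z =
      f z * fderiv ℝ (fun w => fderiv ℝ φ w 1) z 1
        + f z * fderiv ℝ (fun w => fderiv ℝ φ w Complex.I) z Complex.I := fun z => by
    rw [laplacian_eq_fderiv_fderiv hφ.contDiffAt, mul_add]
  have e2 : ∀ z, Laplacian.laplacian f z * φ z =
      fderiv ℝ (fun w => fderiv ℝ f w 1) z 1 * φ z
        + fderiv ℝ (fun w => fderiv ℝ f w Complex.I) z Complex.I * φ z := fun z => by
    by_cases hz : z ∈ tsupport φ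
    · rw [laplacian_eq_fderiv_fderiv (hf z hz), add_mul]
    · simp [image_eq_zero_of_notMem_tsupport hz]
  simp_rw [e1, e2]
  rw [integral_add (i1 1) (i1 _), integral_add (i2 1) (i2 _),
    integral_mul_fderiv_fderiv _ hφ hc hf, integral_mul_fderiv_fderiv _ hφ hc hf]

/-- Chain rule for the Laplacian in the plane. -/
lemma laplacian_comp_real {j : ℝ → ℝ} {f : ℂ → ℝ} {z : ℂ} (hf : ContDiffAt ℝ 2 f z)
    (hj : ContDiffAt ℝ 2 j (f z)) :
    Laplacian.laplacian (fun w => j (f w)) z =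
      deriv (deriv j) (f z) * ((fderiv ℝ f z 1) ^ 2 + (fderiv ℝ f z Complex.I) ^ 2)
        + deriv j (f z) * Laplacian.laplacian f z := by
  have hdj : DifferentiableAt ℝ (deriv j) (f z) := by
    have := (hj.fderiv_right (m := 1) (by norm_num)).clm_apply (contDiffAt_const (c := (1 : ℝ)))
    exact (this.differentiableAt (by norm_num))
  have hev : ∀ᶠ w in 𝓝 z, DifferentiableAt ℝ f w :=
    (hf.eventually (by simp)).mono fun w hw => hw.differentiableAt (by norm_num)
  have hevj : ∀ᶠ w in 𝓝 z, DifferentiableAt ℝ j (f w) :=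
    (hf.continuousAt.eventually (hj.eventually (by simp))).mono
      fun w hw => hw.differentiableAt (by norm_num)
  have hfz := hf.differentiableAt (by norm_num)
  have key : ∀ e : ℂ, fderiv ℝ (fun w => fderiv ℝ (fun w => j (f w)) w e) z e =
      deriv (deriv j) (f z) * (fderiv ℝ f z e) ^ 2
        + deriv j (f z) * fderiv ℝ (fun w => fderiv ℝ f w e) z e := by
    intro e
    have h1 : (fun w => fderiv ℝ (fun w => j (f w)) w e) =ᶠ[𝓝 z]
        fun w => deriv j (f w) * fderiv ℝ f w e := by
      filter_upwards [hev, hevj] with w h1 h2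
      have := (h2.hasDerivAt.comp_hasFDerivAt w h1.hasFDerivAt).fderiv
      rw [show (fun w => j (f w)) = j ∘ f from rfl, this]
      simp
    rw [h1.fderiv_eq]
    have hd2 : DifferentiableAt ℝ (fun w => fderiv ℝ f w e) z :=
      (contDiffAt_fderiv_apply (m := 1) hf (by norm_num) e).differentiableAt (by norm_num)
    have hd1 : HasFDerivAt (fun w => deriv j (f w)) (deriv (deriv j) (f z) • fderiv ℝ f z) z :=
      hdj.hasDerivAt.comp_hasFDerivAt z hfz.hasFDerivAt
    rw [(hd1.fun_mul hd2.hasFDerivAt).fderiv]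
    simp
    ring
  rw [laplacian_eq_fderiv_fderiv (f := fun w => j (f w)) (hj.comp z hf), key, key,
    laplacian_eq_fderiv_fderiv hf]
  ring

/-- The Laplacian commutes with linear isometries. -/
lemma laplacian_comp_linearIsometryEquiv {f : ℂ → ℝ} (hf : ContDiff ℝ 2 f) (L : ℂ ≃ₗᵢ[ℝ] ℂ)
    (z : ℂ) : Laplacian.laplacian (fun w => f (L w)) z = Laplacian.laplacian f (L z) := by
  have h1 := congrFun (InnerProductSpace.laplacian_eq_iteratedFDeriv_orthonormalBasis
    (fun w => f (L w)) Complex.orthonormalBasisOneI) z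
  have h2 := congrFun (InnerProductSpace.laplacian_eq_iteratedFDeriv_orthonormalBasis f
    (Complex.orthonormalBasisOneI.map L)) (L z)
  rw [h1, h2]
  have h3 := (L.toContinuousLinearEquiv : ℂ →L[ℝ] ℂ).iteratedFDeriv_comp_right hf z (i := 2) le_rfl
  refine Finset.sum_congr rfl fun i _ => ?_
  have h4 : (fun w => f (L w)) = f ∘ (L.toContinuousLinearEquiv : ℂ →L[ℝ] ℂ) := rfl
  rw [h4, h3]
  simp only [ContinuousMultilinearMap.compContinuousLinearMap_apply]
  congr 1
  ext k
  fin_cases k <;> simp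

lemma laplacian_comp_sub_const (f : ℂ → ℝ) (a z : ℂ) :
    Laplacian.laplacian (fun w => f (w - a)) z = Laplacian.laplacian f (z - a) := by
  simp only [InnerProductSpace.laplacian_eq_iteratedFDeriv_complexPlane, iteratedFDeriv_comp_sub]

lemma laplacian_comp_const_sub {f : ℂ → ℝ} (hf : ContDiff ℝ 2 f) (a z : ℂ) :
    Laplacian.laplacian (fun w => f (a - w)) z = Laplacian.laplacian f (a - z) := by
  have h1 : (fun w => f (a - w)) = fun w => (fun y => f (LinearIsometryEquiv.neg ℝ (E := ℂ) y)) (w - a) := by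
    ext w; simp
  rw [h1, laplacian_comp_sub_const (fun y => f (LinearIsometryEquiv.neg ℝ (E := ℂ) y)),
    laplacian_comp_linearIsometryEquiv hf]
  simp

lemma laplacian_norm_sq (z : ℂ) : Laplacian.laplacian (fun w : ℂ => ‖w‖ ^ 2) z = 4 := by
  rw [laplacian_eq_fderiv_fderiv (contDiff_norm_sq ℝ).contDiffAt]
  have key : ∀ e : ℂ, fderiv ℝ (fun w : ℂ => fderiv ℝ (fun w : ℂ => ‖w‖ ^ 2) w e) z e
      = 2 * ‖e‖ ^ 2 := by
    intro e
    have h : (fun w : ℂ => fderiv ℝ (fun w : ℂ => ‖w‖ ^ 2) w e) =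
        fun w => (2 • innerSL ℝ e) w := by
      ext w
      rw [fderiv_norm_sq_apply]
      simp [real_inner_comm]
    rw [h, ContinuousLinearMap.fderiv]
    simp
  rw [key, key]
  norm_num

lemma two_le_infty : (2 : WithTop ℕ∞) ≤ ∞ :=
  WithTop.coe_le_coe.2 (le_top : (2 : ℕ∞) ≤ ⊤)

/-! ### Mollification and convergence in L¹. -/

/-- Composition with a continuous family of measure preserving maps is continuous in `L¹`. -/
lemma tendsto_integral_abs_comp_sub {X : Type*} [TopologicalSpace X] {V : ℂ → ℝ}
    (hV : Integrable V) {τ : X → C(ℂ, ℂ)} (hτ : Continuous τ)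
    (hmp : ∀ x, MeasurePreserving (τ x) volume volume) (x₀ : X) :
    Tendsto (fun x => ∫ z, |V (τ x z) - V (τ x₀ z)|) (𝓝 x₀) (𝓝 0) := by
  have key := Filter.Tendsto.compMeasurePreservingLp (p := 1)
    (tendsto_const_nhds (x := hV.toL1 V)) (hτ.tendsto x₀) hmp (hmp x₀) (by simp)
  have h2 := tendsto_iff_norm_sub_tendsto_zero.1 key
  refine h2.congr fun x => ?_
  rw [L1.norm_eq_integral_norm]
  refine integral_congr_ae ?_
  have e1 := Lp.coeFn_compMeasurePreserving (hV.toL1 V) (hmp x)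
  have e2 := Lp.coeFn_compMeasurePreserving (hV.toL1 V) (hmp x₀)
  have e3 := hV.coeFn_toL1
  have e4 := (hmp x).quasiMeasurePreserving.ae_eq_comp e3
  have e5 := (hmp x₀).quasiMeasurePreserving.ae_eq_comp e3
  filter_upwards [e1, e2, e4, e5, Lp.coeFn_sub
    (Lp.compMeasurePreserving (τ x) (hmp x) (hV.toL1 V))
    (Lp.compMeasurePreserving (τ x₀) (hmp x₀) (hV.toL1 V))] with z h1 h2 h4 h5 h6
  rw [h6, Pi.sub_apply, h1, h2, h4, h5]
  simp [Real.norm_eq_abs]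

lemma tendsto_integral_abs_translate_sub {V : ℂ → ℝ} (hV : Integrable V) :
    Tendsto (fun t : ℂ => ∫ z, |V (z - t) - V z|) (𝓝 0) (𝓝 0) := by
  let g : C(ℂ × ℂ, ℂ) := ⟨fun p => p.2 - p.1, by fun_prop⟩
  have := tendsto_integral_abs_comp_sub hV g.curry.continuous
    (fun t => measurePreserving_sub_right volume t) 0
  simpa [g] using this

/-- A sequence of bump functions concentrating at the origin. -/
noncomputable def shrinkingBump (n : ℕ) : ContDiffBump (0 : ℂ) where
  rIn := 1 / (2 * ((n : ℝ) + 1))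
  rOut := 1 / ((n : ℝ) + 1)
  rIn_pos := by positivity
  rIn_lt_rOut := by
    apply one_div_lt_one_div_of_lt
    · positivity
    · have : (0 : ℝ) ≤ n := n.cast_nonneg
      linarith

lemma tendsto_shrinkingBump_rOut : Tendsto (fun n => (shrinkingBump n).rOut) atTop (𝓝 0) :=
  tendsto_one_div_add_atTop_nhds_zero_nat

/-- The mollification of `V` at scale `1 / (n + 1)`. -/
noncomputable def mollify (n : ℕ) (V : ℂ → ℝ) : ℂ → ℝ :=
  convolution ((shrinkingBump n).normed volume) V (ContinuousLinearMap.lsmul ℝ ℝ) volume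

lemma mollify_apply (n : ℕ) (V : ℂ → ℝ) (z : ℂ) :
    mollify n V z = ∫ y, (shrinkingBump n).normed volume (z - y) * V y := by
  simp [mollify, convolution_eq_swap]

lemma contDiff_mollify (n : ℕ) {V : ℂ → ℝ} (hV : Integrable V) : ContDiff ℝ ∞ (mollify n V) :=
  HasCompactSupport.contDiff_convolution_left (n := ⊤) _
    (ContDiffBump.hasCompactSupport_normed _) (ContDiffBump.contDiff_normed _)
    hV.locallyIntegrable

lemma integrable_mollify (n : ℕ) {V : ℂ → ℝ} (hV : Integrable V) : Integrable (mollify n V) :=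
  Integrable.integrable_convolution _ (ContDiffBump.integrable_normed _) hV

lemma ae_tendsto_mollify {V : ℂ → ℝ} (hV : Integrable V) :
    ∀ᵐ z, Tendsto (fun n => mollify n V z) atTop (𝓝 (V z)) := by
  -- Lebesgue differentiation requires the outer radii to be at most a fixed multiple of the inner
  -- ones; here the ratio is exactly 2.
  refine ContDiffBump.ae_convolution_tendsto_right_of_locallyIntegrable (K := 2)
    tendsto_shrinkingBump_rOut (Eventually.of_forall fun n => ?_) hV.locallyIntegrable
  simp only [shrinkingBump]
  apply le_of_eq
  field_simp

/-- A mollification is an average of translates by vectors shorter than the bump radius, so by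
Fubini its L¹ distance to `V` is at most the largest L¹ distance among these translates. -/
lemma integral_abs_mollify_sub_le (n : ℕ) {V : ℂ → ℝ} (hV : Integrable V) {δ : ℝ}
    (hδ : ∀ t : ℂ, ‖t‖ < (shrinkingBump n).rOut → ∫ z, |V (z - t) - V z| ≤ δ) :
    ∫ z, |mollify n V z - V z| ≤ δ := by
  set η := (shrinkingBump n).normed volume with hη
  have hη0 : ∀ t, 0 ≤ η t := fun t => ContDiffBump.nonneg_normed _ t
  have hη1 : ∫ t, η t = 1 := ContDiffBump.integral_normed _
  have hηi : Integrable η := ContDiffBump.integrable_normed _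
  have hηb : Continuous η := ContDiffBump.continuous_normed _
  -- joint integrability
  have hA : Integrable (fun p : ℂ × ℂ => η p.2 * V (p.1 - p.2)) (volume.prod volume) := by
    simpa using Integrable.convolution_integrand (ContinuousLinearMap.lsmul ℝ ℝ) hηi hV
  have hB : Integrable (fun p : ℂ × ℂ => η p.2 * V p.1) (volume.prod volume) := by
    simpa [mul_comm] using Integrable.mul_prod hV hηi
  have hC : Integrable (fun p : ℂ × ℂ => η p.2 * (V (p.1 - p.2) - V p.1))
      (volume.prod volume) := by
    refine (hA.sub hB).congr (ae_of_all _ fun p => ?_)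
    simp only [Pi.sub_apply]
    ring
  have h1 : ∀ᵐ z, |mollify n V z - V z| ≤ ∫ t, |η t * (V (z - t) - V z)| := by
    filter_upwards [hA.prod_right_ae, hB.prod_right_ae] with z hz1 hz2
    have : mollify n V z - V z = ∫ t, η t * (V (z - t) - V z) := by
      simp only [mul_sub]
      rw [integral_sub hz1 hz2, integral_mul_const, hη1, one_mul]
      simp [mollify, convolution, hη]
    rw [this]
    exact abs_integral_le_integral_abs
  calc ∫ z, |mollify n V z - V z| ≤ ∫ z, ∫ t, |η t * (V (z - t) - V z)| :=
        integral_mono_ae ((integrable_mollify n hV).sub hV).abs hC.abs.integral_prod_left h1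
    _ = ∫ t, ∫ z, |η t * (V (z - t) - V z)| := integral_integral_swap hC.abs
    _ ≤ ∫ t, η t * δ := by
        refine integral_mono hC.abs.integral_prod_right (hηi.mul_const δ) fun t => ?_
        simp only [abs_mul, integral_const_mul, abs_of_nonneg (hη0 t)]
        by_cases ht : ‖t‖ < (shrinkingBump n).rOut
        · exact mul_le_mul_of_nonneg_left (hδ t ht) (hη0 t)
        · have : η t = 0 := by
            have hs : t ∉ Function.support η := by
              rw [hη, ContDiffBump.support_normed_eq]
              simpa using ht
            simpa using hs
          simp [this]
    _ = δ := by rw [integral_mul_const, hη1, one_mul]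

lemma tendsto_integral_abs_mollify_sub {V : ℂ → ℝ} (hV : Integrable V) :
    Tendsto (fun n => ∫ z, |mollify n V z - V z|) atTop (𝓝 0) := by
  rw [Metric.tendsto_atTop]
  intro ε hε
  obtain ⟨d, hd, h⟩ := Metric.tendsto_nhds_nhds.1 (tendsto_integral_abs_translate_sub hV) (ε / 2)
    (by positivity)
  have h2 : ∀ᶠ n in atTop, (shrinkingBump n).rOut < d :=
    tendsto_shrinkingBump_rOut.eventually_lt_const hd
  obtain ⟨N, hN⟩ := eventually_atTop.1 h2
  refine ⟨N, fun n hn => ?_⟩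
  have h3 : ∫ z, |mollify n V z - V z| ≤ ε / 2 :=
    integral_abs_mollify_sub_le n hV fun t ht => by
      have := h (x := t) (by simpa using ht.trans (hN n hn))
      rw [Real.dist_eq, sub_zero] at this
      exact (le_abs_self _).trans this.le
  rw [Real.dist_eq, sub_zero, abs_of_nonneg (integral_nonneg fun _ => abs_nonneg _)]
  linarith

lemma fderiv_convolution_apply {η : ℂ → ℝ} (hη : ContDiff ℝ ∞ η) (hc : HasCompactSupport η)
    {V : ℂ → ℝ} (hV : Integrable V) (e z : ℂ) :
    fderiv ℝ (fun w => ∫ y, η (w - y) * V y) z e =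
      ∫ y, fderiv ℝ η (z - y) e * V y := by
  have h1 : (fun w => ∫ y, η (w - y) * V y) =
      convolution η V (ContinuousLinearMap.lsmul ℝ ℝ) volume := by
    ext w; simp [convolution_eq_swap]
  rw [h1, (hc.hasFDerivAt_convolution_left (ContinuousLinearMap.lsmul ℝ ℝ)
    (hη.of_le (by simp)) hV.locallyIntegrable z).fderiv]
  rw [convolution_eq_swap, ContinuousLinearMap.integral_apply]
  · simp
  · have := (hc.fderiv ℝ).convolutionExists_left
      (ContinuousLinearMap.precompL ℂ (ContinuousLinearMap.lsmul ℝ ℝ))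
      (hη.continuous_fderiv (by simp)) hV.locallyIntegrable z
    exact this.integrable_swap

/-- Both derivatives fall on the bump. The result is a pairing of `V` with the Laplacian of y ↦ η(z
- y), a test function to which a weak inequality for `V` can be applied. -/
lemma laplacian_mollify (n : ℕ) {V : ℂ → ℝ} (hV : Integrable V) (z : ℂ) :
    Laplacian.laplacian (mollify n V) z =
      ∫ y, V y * Laplacian.laplacian (fun w => (shrinkingBump n).normed volume (z - w)) y := by
  set η := (shrinkingBump n).normed volume with hη
  have hηs : ContDiff ℝ ∞ η := ContDiffBump.contDiff_normed _
  have hηc : HasCompactSupport η := ContDiffBump.hasCompactSupport_normed _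
  have h2 : ∀ e : ℂ, ContDiff ℝ ∞ fun w => fderiv ℝ η w e := fun e =>
    (hηs.fderiv_right (m := ∞) (by norm_cast)).clm_apply contDiff_const
  have hc2 : ∀ e : ℂ, HasCompactSupport fun w => fderiv ℝ η w e := fun e =>
    hηc.mono' (subset_closure.trans (tsupport_fderiv_apply_subset' η e))
  have hc3 : ∀ e : ℂ, HasCompactSupport fun w => fderiv ℝ (fun w => fderiv ℝ η w e) w e :=
    fun e => (hc2 e).mono' (subset_closure.trans (tsupport_fderiv_apply_subset' _ e))
  have hm : mollify n V = fun w => ∫ y, η (w - y) * V y := funext fun w => mollify_apply n V w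
  have key : ∀ e, fderiv ℝ (fun w => fderiv ℝ (mollify n V) w e) z e =
      ∫ y, fderiv ℝ (fun w => fderiv ℝ η w e) (z - y) e * V y := by
    intro e
    rw [hm]
    simp_rw [fderiv_convolution_apply hηs hηc hV]
    exact fderiv_convolution_apply (h2 e) (hc2 e) hV e z
  have hi : ∀ e, Integrable fun y => fderiv ℝ (fun w => fderiv ℝ η w e) (z - y) e * V y := by
    intro e
    have := (hc3 e).convolutionExists_left (ContinuousLinearMap.lsmul ℝ ℝ)
      (((h2 e).continuous_fderiv (by simp)).clm_apply continuous_const)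
      hV.locallyIntegrable z
    simpa using this.integrable_swap
  rw [laplacian_eq_fderiv_fderiv ((contDiff_mollify n hV).of_le two_le_infty).contDiffAt, key, key,
    ← integral_add (hi _) (hi _)]
  refine integral_congr_ae (Eventually.of_forall fun y => ?_)
  have hη2 : ContDiff ℝ 2 η := hηs.of_le two_le_infty
  simp only []
  rw [laplacian_comp_const_sub hη2, laplacian_eq_fderiv_fderiv hη2.contDiffAt]
  ring

/-! ### Weak subsolutions and Kato's inequality. -/

/-- `v` satisfies `Δv ≥ f` in the unit disk in the sense of distributions. -/
def IsWeakSubsolution (v f : ℂ → ℝ) : Prop :=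
  ∀ φ : ℂ → ℝ, IsDiskTestFunction φ → (∀ z, 0 ≤ φ z) →
    ∫ z in Metric.ball (0 : ℂ) 1, f z * φ z ≤
      ∫ z in Metric.ball (0 : ℂ) 1, v z * Laplacian.laplacian φ z

lemma exists_tsupport_subset_ball {φ : ℂ → ℝ} (hφ : IsDiskTestFunction φ) :
    ∃ r : ℝ, 0 < r ∧ r < 1 ∧ tsupport φ ⊆ Metric.ball 0 r := by
  have hK : IsCompact (tsupport φ) := hφ.2.1
  rcases (tsupport φ).eq_empty_or_nonempty with h | h
  · exact ⟨1 / 2, by norm_num, by norm_num, by simp [h]⟩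
  · obtain ⟨x, hx, hmax⟩ := hK.exists_isMaxOn h continuous_norm.continuousOn
    have hx1 : ‖x‖ < 1 := mem_ball_zero_iff.1 (hφ.2.2 hx)
    refine ⟨(‖x‖ + 1) / 2, by positivity, by linarith, fun z hz => mem_ball_zero_iff.2 ?_⟩
    have : ‖z‖ ≤ ‖x‖ := hmax hz
    linarith

lemma integrable_indicator_closedBall {v : ℂ → ℝ}
    (hv : LocallyIntegrableOn v (Metric.ball 0 1) volume) {R : ℝ} (hR : R < 1) :
    Integrable ((Metric.closedBall 0 R).indicator v) := by
  rw [integrable_indicator_iff Metric.isClosed_closedBall.measurableSet]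
  exact hv.integrableOn_compact_subset (Metric.closedBall_subset_ball hR)
    (isCompact_closedBall 0 R)

/-- Integrals against functions supported in a smaller ball only see the truncated function. -/
lemma setIntegral_ball_mul_eq {v g : ℂ → ℝ} {R : ℝ} (hR : R < 1)
    (hg : ∀ z, z ∉ Metric.closedBall (0 : ℂ) R → g z = 0) :
    ∫ z in Metric.ball (0 : ℂ) 1, v z * g z =
      ∫ z, (Metric.closedBall 0 R).indicator v z * g z := by
  have h1 : ∀ z, (Metric.closedBall (0 : ℂ) R).indicator v z * g z = v z * g z := by
    intro z
    by_cases hz : z ∈ Metric.closedBall (0 : ℂ) R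
    · rw [indicator_of_mem hz]
    · simp [hg z hz]
  simp_rw [h1]
  refine setIntegral_eq_integral_of_forall_compl_eq_zero fun z hz => ?_
  rw [hg z fun h => hz (Metric.closedBall_subset_ball hR h), mul_zero]

lemma laplacian_eq_zero_of_notMem {φ : ℂ → ℝ} {z : ℂ} (hz : z ∉ tsupport φ) :
    Laplacian.laplacian φ z = 0 :=
  image_eq_zero_of_notMem_tsupport fun h => hz (tsupport_laplacian_subset φ h)

lemma exists_abs_le_of_hasCompactSupport {φ : ℂ → ℝ} (hφ : Continuous φ)
    (hc : HasCompactSupport φ) : ∃ C, 0 ≤ C ∧ ∀ z, |φ z| ≤ C := by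
  obtain ⟨C, hC⟩ := hφ.bounded_above_of_compact_support hc
  exact ⟨C, (norm_nonneg _).trans (hC 0), fun z => by simpa using hC z⟩

/-- **Kato's inequality** for a smooth convex function `j` with `0 ≤ j' ≤ 1`. -/
lemma IsWeakSubsolution.convex_comp {v f : ℂ → ℝ} (h : IsWeakSubsolution v f)
    (hv : LocallyIntegrableOn v (Metric.ball 0 1) volume)
    (hf : LocallyIntegrableOn f (Metric.ball 0 1) volume)
    {j : ℝ → ℝ} (hj : ContDiff ℝ 2 j) (hj0 : j 0 = 0) (hj1 : ∀ t, 0 ≤ deriv j t)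
    (hj1' : ∀ t, deriv j t ≤ 1) (hj2 : ∀ t, 0 ≤ deriv (deriv j) t) :
    IsWeakSubsolution (fun z => j (v z)) (fun z => deriv j (v z) * f z) := by
  intro φ hφ hφ0
  obtain ⟨r, hr0, hr1, hr⟩ := exists_tsupport_subset_ball hφ
  -- The margin between `r` and `R` leaves room for mollification: near the support of `φ`, small
  -- bumps see only the truncations to the ball of radius `R`, which are globally integrable.
  obtain ⟨R, hrR, hR1⟩ := exists_between hr1
  have hφ2 : ContDiff ℝ 2 φ := hφ.1.of_le two_le_infty
  have hlip : ∀ s t, |j s - j t| ≤ |s - t| := by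
    intro s t
    have := Convex.norm_image_sub_le_of_norm_deriv_le (f := j) (C := 1) (s := univ) (x := t) (y := s)
      (fun x _ => (hj.differentiable (by norm_num)) x)
      (fun x _ => by rw [Real.norm_eq_abs, abs_of_nonneg (hj1 x)]; exact hj1' x) convex_univ
      (mem_univ _) (mem_univ _)
    simpa using this
  have hjd : Continuous (deriv j) := hj.continuous_deriv (by norm_num)
  set V := (Metric.closedBall (0 : ℂ) R).indicator v with hVdef
  set F := (Metric.closedBall (0 : ℂ) R).indicator f with hFdef
  have hV : Integrable V := integrable_indicator_closedBall hv hR1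
  have hF : Integrable F := integrable_indicator_closedBall hf hR1
  have hsupp : ∀ z, z ∉ Metric.closedBall (0 : ℂ) R → z ∉ tsupport φ := fun z hz hz' =>
    hz (Metric.ball_subset_closedBall (Metric.ball_subset_ball hrR.le (hr hz')))
  have hφ00 : ∀ z, z ∉ Metric.closedBall (0 : ℂ) R → φ z = 0 := fun z hz =>
    image_eq_zero_of_notMem_tsupport (hsupp z hz)
  have hΔ0 : ∀ z, z ∉ Metric.closedBall (0 : ℂ) R → Laplacian.laplacian φ z = 0 := fun z hz =>
    laplacian_eq_zero_of_notMem (hsupp z hz)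
  obtain ⟨Cφ, hCφ0, hCφ⟩ := exists_abs_le_of_hasCompactSupport hφ.1.continuous hφ.2.1
  have hΔc := continuous_laplacian hφ2
  have hΔs : HasCompactSupport (Laplacian.laplacian φ) :=
    hφ.2.1.mono' (subset_closure.trans (tsupport_laplacian_subset φ))
  obtain ⟨CΔ, hCΔ0, hCΔ⟩ := exists_abs_le_of_hasCompactSupport hΔc hΔs
  -- reduction to the truncated functions
  have e1 : ∫ z in Metric.ball (0 : ℂ) 1, j (v z) * Laplacian.laplacian φ z =
      ∫ z, j (V z) * Laplacian.laplacian φ z := by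
    rw [setIntegral_ball_mul_eq hR1 hΔ0]
    refine integral_congr_ae (ae_of_all _ fun z => ?_)
    by_cases hz : z ∈ Metric.closedBall (0 : ℂ) R
    · simp only [hVdef, indicator_of_mem hz]
    · simp only [hΔ0 z hz, mul_zero]
  have e2 : ∫ z in Metric.ball (0 : ℂ) 1, (deriv j (v z) * f z) * φ z =
      ∫ z, deriv j (V z) * F z * φ z := by
    rw [setIntegral_ball_mul_eq hR1 hφ00]
    refine integral_congr_ae (ae_of_all _ fun z => ?_)
    by_cases hz : z ∈ Metric.closedBall (0 : ℂ) R
    · simp only [hVdef, hFdef, indicator_of_mem hz]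
    · simp only [hφ00 z hz, mul_zero]
  rw [e1, e2]
  -- the mollified inequality
  have key : ∀ᶠ n in atTop, ∫ z, deriv j (mollify n V z) * mollify n F z * φ z ≤
      ∫ z, j (mollify n V z) * Laplacian.laplacian φ z := by
    filter_upwards [tendsto_shrinkingBump_rOut.eventually_lt_const (sub_pos.2 hrR)] with n hn
    have hVs : ContDiff ℝ 2 (mollify n V) := (contDiff_mollify n hV).of_le two_le_infty
    have hFc : Continuous (mollify n F) := (contDiff_mollify n hF).continuous
    have hjs : ContDiff ℝ 2 fun z => j (mollify n V z) := hj.comp hVs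
    rw [integral_mul_laplacian hφ2 hφ.2.1 fun z _ => hjs.contDiffAt]
    refine integral_mono ?_ ?_ fun z => ?_
    · exact integrable_mul_of_tsupport hφ.1.continuous hφ.2.1 fun z _ =>
        ((hjd.comp hVs.continuous).mul hFc).continuousAt
    · exact integrable_mul_of_tsupport hφ.1.continuous hφ.2.1 fun z _ =>
        (continuous_laplacian hjs).continuousAt
    · by_cases hz : z ∈ tsupport φ
      swap
      · simp [image_eq_zero_of_notMem_tsupport hz]
      refine mul_le_mul_of_nonneg_right ?_ (hφ0 z)
      -- The weak inequality tested against the bump centred at `z`: since |z| < r and the bump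
      -- radius is below R - r, its support stays in the ball of radius `R`.
      have hFle : mollify n F z ≤ Laplacian.laplacian (mollify n V) z := by
        set η := (shrinkingBump n).normed volume with hη
        have hηsub : tsupport (fun w => η (z - w)) ⊆ Metric.closedBall 0 R := by
          refine closure_minimal (fun w hw => ?_) Metric.isClosed_closedBall
          have h1 : z - w ∈ Function.support η := hw
          rw [hη, ContDiffBump.support_normed_eq, mem_ball_zero_iff] at h1
          have h2 := mem_ball_zero_iff.1 (hr hz)
          rw [mem_closedBall_zero_iff]
          have : ‖w‖ ≤ ‖z‖ + ‖z - w‖ := by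
            have := norm_sub_le z (z - w)
            simpa using this
          linarith
        have htest : IsDiskTestFunction (fun w => η (z - w)) := by
          refine ⟨(ContDiffBump.contDiff_normed _).comp (contDiff_const.sub contDiff_id), ?_, ?_⟩
          · exact HasCompactSupport.of_support_subset_isCompact (isCompact_closedBall 0 R)
              (subset_closure.trans hηsub)
          · exact hηsub.trans (Metric.closedBall_subset_ball hR1)
        have h3 := h _ htest fun w => ContDiffBump.nonneg_normed _ _
        rw [setIntegral_ball_mul_eq hR1 fun w hw =>
            image_eq_zero_of_notMem_tsupport fun h' => hw (hηsub h'),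
          setIntegral_ball_mul_eq hR1 fun w hw =>
            laplacian_eq_zero_of_notMem fun h' => hw (hηsub h')] at h3
        rw [laplacian_mollify n hV, mollify_apply]
        refine le_trans (le_of_eq ?_) h3
        exact integral_congr_ae (ae_of_all _ fun w => mul_comm _ _)
      -- Chain rule: Δ(j∘V) = j''(V)|∇V|² + j'(V)ΔV. Convexity allows the gradient term to be
      -- dropped, and j' ≥ 0 preserves the inequality for ΔV.
      rw [laplacian_comp_real hVs.contDiffAt hj.contDiffAt]
      have := mul_le_mul_of_nonneg_left hFle (hj1 (mollify n V z))
      have h4 : 0 ≤ deriv (deriv j) (mollify n V z) * (fderiv ℝ (mollify n V) z 1 ^ 2 +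
          fderiv ℝ (mollify n V) z Complex.I ^ 2) := mul_nonneg (hj2 _) (by positivity)
      linarith
  -- passage to the limit
  have hjV : ∀ {W : ℂ → ℝ}, Integrable W → Integrable fun z => j (W z) := by
    intro W hW
    refine hW.mono (hj.continuous.comp_aestronglyMeasurable hW.aestronglyMeasurable)
      (ae_of_all _ fun z => ?_)
    have := hlip (W z) 0
    simpa [hj0] using this
  -- Here `j` is 1-Lipschitz, so L¹ convergence of the mollifications is enough.
  have l1 : Tendsto (fun n => ∫ z, j (mollify n V z) * Laplacian.laplacian φ z) atTop
      (𝓝 (∫ z, j (V z) * Laplacian.laplacian φ z)) := by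
    rw [tendsto_iff_norm_sub_tendsto_zero]
    refine squeeze_zero (fun _ => norm_nonneg _) (fun n => ?_)
      (by simpa using (tendsto_integral_abs_mollify_sub hV).mul_const CΔ)
    have i1 : ∀ {W : ℂ → ℝ}, Integrable W →
        Integrable fun z => j (W z) * Laplacian.laplacian φ z := fun hW =>
      (hjV hW).mul_bdd (c := CΔ) hΔc.aestronglyMeasurable (ae_of_all _ fun z => hCΔ z)
    rw [← integral_sub (i1 (integrable_mollify n hV)) (i1 hV), ← integral_mul_const]
    refine norm_integral_le_of_norm_le (((integrable_mollify n hV).sub hV).abs.mul_const CΔ)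
      (ae_of_all _ fun z => ?_)
    rw [← sub_mul, norm_mul]
    exact mul_le_mul (hlip _ _) (hCΔ z) (abs_nonneg _) (abs_nonneg _)
  -- Two limits: replacing the mollified `F` by `F` costs an L¹ error, because |j'| ≤ 1; then j' of
  -- the mollified `V` converges almost everywhere and |F|·Cφ dominates.
  have l2 : Tendsto (fun n => ∫ z, deriv j (mollify n V z) * mollify n F z * φ z) atTop
      (𝓝 (∫ z, deriv j (V z) * F z * φ z)) := by
    have hb : ∀ t, |deriv j t| ≤ 1 := fun t => by rw [abs_of_nonneg (hj1 t)]; exact hj1' t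
    have i1 : ∀ {W G : ℂ → ℝ}, Integrable W → Integrable G →
        Integrable fun z => deriv j (W z) * G z * φ z := fun {W G} hW hG =>
      (hG.bdd_mul (c := 1) (hjd.comp_aestronglyMeasurable hW.aestronglyMeasurable)
        (ae_of_all _ fun z => hb _)).mul_bdd (c := Cφ) hφ.1.continuous.aestronglyMeasurable
        (ae_of_all _ fun z => hCφ z)
    have d1 : Tendsto (fun n => ∫ z, deriv j (mollify n V z) * F z * φ z) atTop
        (𝓝 (∫ z, deriv j (V z) * F z * φ z)) := by
      refine tendsto_integral_of_dominated_convergence (fun z => |F z| * Cφ)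
        (fun n => (i1 (integrable_mollify n hV) hF).aestronglyMeasurable)
        (hF.abs.mul_const Cφ) (fun n => ae_of_all _ fun z => ?_) ?_
      · rw [norm_mul, norm_mul]
        refine mul_le_mul ?_ (hCφ z) (abs_nonneg _) (abs_nonneg _)
        exact mul_le_of_le_one_left (abs_nonneg _) (hb _)
      · filter_upwards [ae_tendsto_mollify hV] with z hz
        exact (((hjd.tendsto _).comp hz).mul_const _).mul_const _
    have d2 : Tendsto (fun n => (∫ z, deriv j (mollify n V z) * mollify n F z * φ z) -
        ∫ z, deriv j (mollify n V z) * F z * φ z) atTop (𝓝 0) := by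
      refine squeeze_zero_norm (fun n => ?_)
        (by simpa using (tendsto_integral_abs_mollify_sub hF).mul_const Cφ)
      rw [← integral_sub (i1 (integrable_mollify n hV) (integrable_mollify n hF))
        (i1 (integrable_mollify n hV) hF), ← integral_mul_const]
      refine norm_integral_le_of_norm_le (((integrable_mollify n hF).sub hF).abs.mul_const Cφ)
        (ae_of_all _ fun z => ?_)
      rw [← sub_mul, ← mul_sub, norm_mul, norm_mul]
      refine mul_le_mul ?_ (hCφ z) (abs_nonneg _) (abs_nonneg _)
      exact mul_le_of_le_one_left (abs_nonneg _) (hb _)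
    simpa using d2.add d1
  exact le_of_tendsto_of_tendsto l2 l1 key

lemma integrableOn_ball_mul {v g : ℂ → ℝ} (hv : LocallyIntegrableOn v (Metric.ball 0 1) volume)
    (hg : Continuous g) (hc : HasCompactSupport g) (hs : tsupport g ⊆ Metric.ball 0 1) :
    IntegrableOn (fun z => v z * g z) (Metric.ball 0 1) := by
  obtain ⟨C, -, hC⟩ := exists_abs_le_of_hasCompactSupport hg hc
  have h1 : IntegrableOn (fun z => v z * g z) (tsupport g) :=
    (hv.integrableOn_compact_subset hs hc).mul_bdd (c := C) hg.aestronglyMeasurable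
      (ae_of_all _ fun z => hC z)
  refine (h1.integrable_of_forall_notMem_eq_zero fun z hz => ?_).integrableOn
  rw [image_eq_zero_of_notMem_tsupport hz, mul_zero]

lemma IsDiskTestFunction.contDiff_two {φ : ℂ → ℝ} (hφ : IsDiskTestFunction φ) : ContDiff ℝ 2 φ :=
  hφ.1.of_le two_le_infty

lemma IsDiskTestFunction.hasCompactSupport_laplacian {φ : ℂ → ℝ} (hφ : IsDiskTestFunction φ) :
    HasCompactSupport (Laplacian.laplacian φ) :=
  hφ.2.1.mono' (subset_closure.trans (tsupport_laplacian_subset φ))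

lemma IsDiskTestFunction.integrableOn_mul {φ : ℂ → ℝ} (hφ : IsDiskTestFunction φ) {v : ℂ → ℝ}
    (hv : LocallyIntegrableOn v (Metric.ball 0 1) volume) :
    IntegrableOn (fun z => v z * φ z) (Metric.ball 0 1) :=
  integrableOn_ball_mul hv hφ.1.continuous hφ.2.1 hφ.2.2

lemma IsDiskTestFunction.integrableOn_mul_laplacian {φ : ℂ → ℝ} (hφ : IsDiskTestFunction φ)
    {v : ℂ → ℝ} (hv : LocallyIntegrableOn v (Metric.ball 0 1) volume) :
    IntegrableOn (fun z => v z * Laplacian.laplacian φ z) (Metric.ball 0 1) :=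
  integrableOn_ball_mul hv (continuous_laplacian hφ.contDiff_two) hφ.hasCompactSupport_laplacian
    ((tsupport_laplacian_subset φ).trans hφ.2.2)

/-- Integration by parts in the disk, for a function which is `C²` in the disk. -/
lemma IsDiskTestFunction.setIntegral_mul_laplacian {φ : ℂ → ℝ} (hφ : IsDiskTestFunction φ)
    {p : ℂ → ℝ} (hp : ∀ z ∈ Metric.ball (0 : ℂ) 1, ContDiffAt ℝ 2 p z) :
    ∫ z in Metric.ball (0 : ℂ) 1, p z * Laplacian.laplacian φ z =
      ∫ z in Metric.ball (0 : ℂ) 1, Laplacian.laplacian p z * φ z := by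
  rw [setIntegral_eq_integral_of_forall_compl_eq_zero, setIntegral_eq_integral_of_forall_compl_eq_zero]
  · exact integral_mul_laplacian hφ.contDiff_two hφ.2.1 fun z hz => hp z (hφ.2.2 hz)
  · exact fun z hz => by rw [image_eq_zero_of_notMem_tsupport fun h => hz (hφ.2.2 h), mul_zero]
  · exact fun z hz => by rw [laplacian_eq_zero_of_notMem fun h => hz (hφ.2.2 h), mul_zero]

lemma IsWeakSubsolution.sub_contDiff {v f p : ℂ → ℝ} (h : IsWeakSubsolution v f)
    (hv : LocallyIntegrableOn v (Metric.ball 0 1) volume)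
    (hf : LocallyIntegrableOn f (Metric.ball 0 1) volume) (hp : ContDiff ℝ 2 p) :
    IsWeakSubsolution (fun z => v z - p z) (fun z => f z - Laplacian.laplacian p z) := by
  intro φ hφ hφ0
  have hpl : LocallyIntegrableOn p (Metric.ball 0 1) volume :=
    hp.continuous.locallyIntegrable.locallyIntegrableOn _
  have hΔl : LocallyIntegrableOn (Laplacian.laplacian p) (Metric.ball 0 1) volume :=
    (continuous_laplacian hp).locallyIntegrable.locallyIntegrableOn _
  simp only [sub_mul]
  rw [integral_sub (hφ.integrableOn_mul hf) (hφ.integrableOn_mul hΔl),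
    integral_sub (hφ.integrableOn_mul_laplacian hv) (hφ.integrableOn_mul_laplacian hpl),
    hφ.setIntegral_mul_laplacian fun z _ => hp.contDiffAt]
  exact sub_le_sub_right (h φ hφ hφ0) _

/-! ### The weak maximum principle. -/

/-- A smooth convex function, zero on the negative axis and positive on the positive one, with
slope between `0` and `1`. -/
noncomputable def convexRamp (t : ℝ) : ℝ := ∫ s in (0 : ℝ)..t, Real.smoothTransition s

lemma deriv_convexRamp : deriv convexRamp = Real.smoothTransition := by
  ext t
  exact intervalIntegral.deriv_integral_right
    (Real.smoothTransition.continuous.intervalIntegrable _ _)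
    (Real.smoothTransition.continuous.stronglyMeasurableAtFilter _ _)
    Real.smoothTransition.continuousAt

lemma contDiff_convexRamp : ContDiff ℝ 2 convexRamp := by
  have h : ContDiff ℝ (1 + 1) convexRamp := by
    rw [contDiff_succ_iff_deriv]
    refine ⟨fun t => ?_, by simp, ?_⟩
    · exact (intervalIntegral.integral_hasDerivAt_right
        (Real.smoothTransition.continuous.intervalIntegrable _ _)
        (Real.smoothTransition.continuous.stronglyMeasurableAtFilter _ _)
        Real.smoothTransition.continuousAt).differentiableAt
    · rw [deriv_convexRamp]
      exact Real.smoothTransition.contDiff (n := 1)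
  simpa [one_add_one_eq_two] using h

lemma convexRamp_zero : convexRamp 0 = 0 := by simp [convexRamp]

lemma convexRamp_of_nonpos {t : ℝ} (ht : t ≤ 0) : convexRamp t = 0 := by
  rw [convexRamp, intervalIntegral.integral_symm, intervalIntegral.integral_congr (g := fun _ => 0)]
  · simp
  · intro s hs
    rw [uIcc_of_le ht] at hs
    exact Real.smoothTransition.zero_of_nonpos hs.2

lemma convexRamp_nonneg (t : ℝ) : 0 ≤ convexRamp t := by
  rcases le_total t 0 with h | h
  · rw [convexRamp_of_nonpos h]
  · exact intervalIntegral.integral_nonneg h fun s _ => Real.smoothTransition.nonneg s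

lemma convexRamp_pos {t : ℝ} (ht : 0 < t) : 0 < convexRamp t :=
  intervalIntegral.intervalIntegral_pos_of_pos_on
    (Real.smoothTransition.continuous.intervalIntegrable _ _)
    (fun _ hx => Real.smoothTransition.pos_of_pos hx.1) ht

lemma abs_convexRamp_le (t : ℝ) : |convexRamp t| ≤ |t| := by
  have := intervalIntegral.norm_integral_le_of_norm_le_const (a := 0) (b := t) (C := 1)
    (f := Real.smoothTransition) fun s _ => by
      rw [Real.norm_eq_abs, abs_of_nonneg (Real.smoothTransition.nonneg s)]
      exact Real.smoothTransition.le_one s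
  simpa [convexRamp] using this

/-- A smooth compactly supported function in the disk which is `1 - |z|²` on a given smaller disk. -/
lemma exists_test_eq_one_sub_norm_sq {ρ : ℝ} (hρ : ρ < 1) :
    ∃ φ : ℂ → ℝ, IsDiskTestFunction φ ∧ (∀ z, 0 ≤ φ z) ∧
      ∀ z, ‖z‖ ≤ ρ → Laplacian.laplacian φ z = -4 := by
  obtain ⟨a, ha, ha1⟩ := exists_between (max_lt hρ one_pos)
  obtain ⟨b, hab, hb1⟩ := exists_between ha1
  have ha0 : 0 < a := (le_max_right _ _).trans_lt ha
  let χ : ContDiffBump (0 : ℂ) := ⟨a, b, ha0, hab⟩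
  have hχ : ∀ z, χ z ≠ 0 → ‖z‖ < b := fun z hz => by
    have : z ∈ Function.support χ := hz
    rwa [χ.support_eq, mem_ball_zero_iff] at this
  have hts : tsupport (fun z => χ z * (1 - ‖z‖ ^ 2)) ⊆ tsupport χ := tsupport_mul_subset_left
  refine ⟨fun z => χ z * (1 - ‖z‖ ^ 2), ⟨?_, ?_, ?_⟩, fun z => ?_, fun z hz => ?_⟩
  · exact χ.contDiff.mul (contDiff_const.sub (contDiff_norm_sq ℝ))
  · exact χ.hasCompactSupport.mul_right
  · refine hts.trans ?_
    rw [χ.tsupport_eq]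
    exact Metric.closedBall_subset_ball hb1
  · by_cases h : χ z = 0
    · simp [h]
    · refine mul_nonneg χ.nonneg ?_
      have := hχ z h
      nlinarith [norm_nonneg z]
  · have hza : ‖z‖ < a := hz.trans_lt ((le_max_left _ _).trans_lt ha)
    have h1 : (fun z => χ z * (1 - ‖z‖ ^ 2)) =ᶠ[𝓝 z] fun z => 1 - ‖z‖ ^ 2 := by
      filter_upwards [Metric.isOpen_ball.mem_nhds (mem_ball_zero_iff.2 hza)] with w hw
      rw [χ.one_of_mem_closedBall (Metric.ball_subset_closedBall hw), one_mul]
    rw [(InnerProductSpace.laplacian_congr_nhds h1).eq_of_nhds]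
    have h2 := ContDiffAt.laplacian_sub (f₁ := fun _ : ℂ => (1 : ℝ)) (f₂ := fun z : ℂ => ‖z‖ ^ 2)
      (x := z) contDiffAt_const (contDiff_norm_sq ℝ).contDiffAt
    have h3 : (fun z : ℂ => 1 - ‖z‖ ^ 2) = (fun _ : ℂ => (1 : ℝ)) - fun z : ℂ => ‖z‖ ^ 2 := rfl
    rw [h3, h2, laplacian_norm_sq]
    simp

/-- Kato's inequality for a convex ramp j(v - ε), tested against a cutoff of 1 - |z|². The side with
`f` is nonnegative because j' vanishes where v ≤ ε. The other side is -4∫ j(v - ε), because j(v - ε)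
vanishes beyond radius `ρ` and Δφ = -4 inside. Hence j(v - ε) = 0 almost everywhere. -/
lemma IsWeakSubsolution.ae_le_of_boundary {v f : ℂ → ℝ} (h : IsWeakSubsolution v f)
    (hv : LocallyIntegrableOn v (Metric.ball 0 1) volume)
    (hf : LocallyIntegrableOn f (Metric.ball 0 1) volume) {ε ρ : ℝ} (hρ : ρ < 1)
    (hpos : ∀ᵐ z ∂volume.restrict (Metric.ball (0 : ℂ) 1), ε < v z → 0 ≤ f z)
    (hb : ∀ᵐ z ∂volume.restrict (Metric.ball (0 : ℂ) 1), ρ < ‖z‖ → v z ≤ ε) :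
    ∀ᵐ z ∂volume.restrict (Metric.ball (0 : ℂ) 1), v z ≤ ε := by
  obtain ⟨φ, hφ, hφ0, hφ4⟩ := exists_test_eq_one_sub_norm_sq hρ
  have hvε : LocallyIntegrableOn (fun z => v z - ε) (Metric.ball 0 1) volume :=
    hv.sub ((continuous_const (y := ε)).locallyIntegrable.locallyIntegrableOn _)
  have h1 := h.sub_contDiff hv hf (p := fun _ => ε) contDiff_const
  simp only [InnerProductSpace.laplacian_const, Pi.zero_apply, sub_zero] at h1
  have h2 := h1.convex_comp hvε hf contDiff_convexRamp convexRamp_zero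
    (fun t => by rw [deriv_convexRamp]; exact Real.smoothTransition.nonneg t)
    (fun t => by rw [deriv_convexRamp]; exact Real.smoothTransition.le_one t)
    (fun t => by rw [deriv_convexRamp]; exact Real.smoothTransition.monotone.deriv_nonneg) φ hφ hφ0
  have hjl : LocallyIntegrableOn (fun z => convexRamp (v z - ε)) (Metric.ball 0 1) volume := by
    intro x hx
    obtain ⟨s, hs, his⟩ := hvε x hx
    exact ⟨s, hs, Integrable.mono his (contDiff_convexRamp.continuous.comp_aestronglyMeasurable his.aestronglyMeasurable)
      (ae_of_all _ fun z => abs_convexRamp_le _)⟩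
  have hi := hφ.integrableOn_mul_laplacian hjl
  have h3 : 0 ≤ ∫ z in Metric.ball (0 : ℂ) 1,
      (deriv convexRamp (v z - ε) * f z) * φ z := by
    refine integral_nonneg_of_ae ?_
    filter_upwards [hpos] with z hz
    rw [deriv_convexRamp]
    refine mul_nonneg ?_ (hφ0 z)
    rcases le_or_gt (v z - ε) 0 with h' | h'
    · simp [Real.smoothTransition.zero_of_nonpos h']
    · exact mul_nonneg (Real.smoothTransition.nonneg _) (hz (by linarith))
  have h4 : (fun z => convexRamp (v z - ε) * Laplacian.laplacian φ z)
      =ᵐ[volume.restrict (Metric.ball (0 : ℂ) 1)] fun z => -(4 * convexRamp (v z - ε)) := by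
    filter_upwards [hb] with z hz
    rcases le_or_gt ‖z‖ ρ with h' | h'
    · rw [hφ4 z h']; ring
    · rw [convexRamp_of_nonpos (by linarith [hz h'])]; simp
  have h5 : ∫ z in Metric.ball (0 : ℂ) 1, 4 * convexRamp (v z - ε) = 0 := by
    refine le_antisymm ?_ (integral_nonneg fun z => by positivity [convexRamp_nonneg (v z - ε)])
    have := h3.trans h2
    rw [integral_congr_ae h4, integral_neg] at this
    linarith
  have h6 : IntegrableOn (fun z => 4 * convexRamp (v z - ε)) (Metric.ball (0 : ℂ) 1) := by
    have := (hi.congr h4).neg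
    simp only [Pi.neg_def, neg_neg] at this
    exact this
  have h7 := (integral_eq_zero_iff_of_nonneg
    (fun z => by simpa using convexRamp_nonneg (v z - ε)) h6).1 h5
  filter_upwards [h7] with z hz
  by_contra! hlt
  have := convexRamp_pos (sub_pos.2 hlt)
  simp at hz
  linarith

/-- A weak maximum principle: a weak solution of `Δv ≥ f`, with `f ≥ 0` where `v > 0`, is nonpositive
if it is nonpositive at the boundary. -/
lemma IsWeakSubsolution.ae_nonpos {v f : ℂ → ℝ} (h : IsWeakSubsolution v f)
    (hv : LocallyIntegrableOn v (Metric.ball 0 1) volume)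
    (hf : LocallyIntegrableOn f (Metric.ball 0 1) volume)
    (hpos : ∀ᵐ z ∂volume.restrict (Metric.ball (0 : ℂ) 1), 0 < v z → 0 ≤ f z)
    (hb : ∀ ε > 0, ∃ ρ < 1, ∀ᵐ z ∂volume.restrict (Metric.ball (0 : ℂ) 1), ρ < ‖z‖ → v z ≤ ε) :
    ∀ᵐ z ∂volume.restrict (Metric.ball (0 : ℂ) 1), v z ≤ 0 := by
  have key : ∀ n : ℕ, ∀ᵐ z ∂volume.restrict (Metric.ball (0 : ℂ) 1), v z ≤ 1 / ((n : ℝ) + 1) := by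
    intro n
    have hn : (0 : ℝ) < 1 / ((n : ℝ) + 1) := by positivity
    obtain ⟨ρ, hρ, hbρ⟩ := hb _ hn
    exact h.ae_le_of_boundary hv hf hρ (hpos.mono fun z hz h' => hz (hn.trans h')) hbρ
  filter_upwards [ae_all_iff.2 key] with z hz
  exact ge_of_tendsto' tendsto_one_div_add_atTop_nhds_zero_nat hz

/-! ### Angular averages and weak boundary values. -/

/-- The average of the rotations of `v`, with weight `g`. -/
noncomputable def angularAverage (g : C(Circle, ℝ)) (v : ℂ → ℝ) (z : ℂ) : ℝ :=
  ∫ t in (0 : ℝ)..(2 * Real.pi), g (Circle.exp t) * v (Circle.exp t * z)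

lemma measurePreserving_rotation (c : Circle) :
    MeasurePreserving (fun z : ℂ => (c : ℂ) * z) volume volume :=
  (rotation c).measurePreserving

/-- The map (t, z) ↦ (t, e^{it}z) preserves the product measure, so V(e^{it}z) is jointly
integrable. This justifies Fubini for angular averages. -/
lemma integrable_angular {V ψ : ℂ → ℝ} (hV : Integrable V) (g : C(Circle, ℝ))
    (hψ : AEStronglyMeasurable ψ) {C : ℝ} (hC : ∀ z, |ψ z| ≤ C) :
    Integrable (fun p : ℝ × ℂ => g (Circle.exp p.1) * V (Circle.exp p.1 * p.2) * ψ p.2)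
      ((volume.restrict (Ioc 0 (2 * Real.pi))).prod volume) := by
  have hmp : MeasurePreserving (fun p : ℝ × ℂ => (p.1, (Circle.exp p.1 : ℂ) * p.2))
      ((volume.restrict (Ioc 0 (2 * Real.pi))).prod volume)
      ((volume.restrict (Ioc 0 (2 * Real.pi))).prod volume) :=
    (MeasurePreserving.id _).skew_product (g := fun t z => (Circle.exp t : ℂ) * z)
      (by fun_prop) (ae_of_all _ fun t => (measurePreserving_rotation _).map_eq)
  have h1 : Integrable (fun p : ℝ × ℂ => V p.2)
      ((volume.restrict (Ioc 0 (2 * Real.pi))).prod volume) := hV.comp_snd _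
  have h2 : Integrable (fun p : ℝ × ℂ => V (Circle.exp p.1 * p.2))
      ((volume.restrict (Ioc 0 (2 * Real.pi))).prod volume) :=
    hmp.integrable_comp_of_integrable h1
  have h3 : Continuous fun p : ℝ × ℂ => g (Circle.exp p.1) := by fun_prop
  refine (h2.bdd_mul (c := ‖g‖) h3.aestronglyMeasurable
    (ae_of_all _ fun p => g.norm_coe_le_norm _)).mul_bdd (c := C) hψ.comp_snd
    (ae_of_all _ fun p => hC p.2)

lemma integrable_angularAverage {V : ℂ → ℝ} (hV : Integrable V) (g : C(Circle, ℝ)) :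
    Integrable (angularAverage g V) := by
  have := (integrable_angular hV g (ψ := fun _ => 1) aestronglyMeasurable_const (C := 1)
    (by simp)).integral_prod_right
  simp only [mul_one] at this
  refine this.congr (ae_of_all _ fun z => ?_)
  rw [angularAverage, intervalIntegral.integral_of_le Real.two_pi_pos.le]

lemma integral_angularAverage_mul {V ψ : ℂ → ℝ} (hV : Integrable V) (g : C(Circle, ℝ))
    (hψ : AEStronglyMeasurable ψ) {C : ℝ} (hC : ∀ z, |ψ z| ≤ C) :
    ∫ z, angularAverage g V z * ψ z =
      ∫ t in (0 : ℝ)..(2 * Real.pi), g (Circle.exp t) * ∫ z, V (Circle.exp t * z) * ψ z := by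
  have h := integral_integral_swap
    (f := fun (t : ℝ) (z : ℂ) => g (Circle.exp t) * V (Circle.exp t * z) * ψ z)
    (integrable_angular hV g hψ hC)
  rw [intervalIntegral.integral_of_le Real.two_pi_pos.le]
  simp_rw [← integral_const_mul, ← mul_assoc]
  rw [h]
  refine integral_congr_ae (ae_of_all _ fun z => ?_)
  simp only [angularAverage, intervalIntegral.integral_of_le Real.two_pi_pos.le, integral_mul_const]

lemma norm_circle_mul (c : Circle) (z : ℂ) : ‖(c : ℂ) * z‖ = ‖z‖ := by
  rw [norm_mul, Circle.norm_coe, one_mul]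

/-- Disks centred at 0 are rotation invariant, so truncation commutes with averaging and local
statements reduce to globally integrable functions. -/
lemma angularAverage_indicator (g : C(Circle, ℝ)) (v : ℂ → ℝ) (R : ℝ) :
    angularAverage g ((Metric.closedBall 0 R).indicator v) =
      (Metric.closedBall 0 R).indicator (angularAverage g v) := by
  ext z
  have hmem : ∀ c : Circle, (c : ℂ) * z ∈ Metric.closedBall (0 : ℂ) R ↔
      z ∈ Metric.closedBall (0 : ℂ) R := fun c => by
    rw [mem_closedBall_zero_iff, mem_closedBall_zero_iff, norm_circle_mul]
  by_cases hz : z ∈ Metric.closedBall (0 : ℂ) R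
  · rw [indicator_of_mem hz, angularAverage, angularAverage]
    simp_rw [indicator_of_mem ((hmem _).2 hz)]
  · rw [indicator_of_notMem hz, angularAverage]
    simp_rw [indicator_of_notMem (mt (hmem _).1 hz)]
    simp

lemma locallyIntegrableOn_ball {v : ℂ → ℝ}
    (h : ∀ R < 1, IntegrableOn v (Metric.closedBall (0 : ℂ) R)) :
    LocallyIntegrableOn v (Metric.ball (0 : ℂ) 1) volume := by
  intro x hx
  obtain ⟨R, hR, hR1⟩ := exists_between (mem_ball_zero_iff.1 hx)
  refine ⟨Metric.closedBall 0 R, mem_nhdsWithin_of_mem_nhds ?_, h R hR1⟩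
  exact Filter.mem_of_superset (Metric.isOpen_ball.mem_nhds (mem_ball_zero_iff.2 hR))
    Metric.ball_subset_closedBall

lemma locallyIntegrableOn_angularAverage {v : ℂ → ℝ}
    (hv : LocallyIntegrableOn v (Metric.ball 0 1) volume) (g : C(Circle, ℝ)) :
    LocallyIntegrableOn (angularAverage g v) (Metric.ball 0 1) volume := by
  refine locallyIntegrableOn_ball fun R hR => ?_
  have := integrable_angularAverage (integrable_indicator_closedBall hv hR) g
  rw [angularAverage_indicator] at this
  exact (integrable_indicator_iff Metric.isClosed_closedBall.measurableSet).1 this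

lemma IsDiskTestFunction.comp_rotation {φ : ℂ → ℝ} (hφ : IsDiskTestFunction φ) (c : Circle) :
    IsDiskTestFunction (fun z => φ (c * z)) := by
  have h1 : tsupport (fun z => φ (c * z)) = (fun z : ℂ => (c : ℂ) * z) ⁻¹' tsupport φ :=
    tsupport_comp_eq_preimage φ (rotation c).toHomeomorph
  refine ⟨hφ.1.comp (contDiff_const.mul contDiff_id),
    hφ.2.1.comp_homeomorph (rotation c).toHomeomorph, ?_⟩
  rw [h1]
  intro z hz
  have := mem_ball_zero_iff.1 (hφ.2.2 hz)
  rw [norm_circle_mul] at this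
  exact mem_ball_zero_iff.2 this

/-- The rotation is moved onto the test function, where it commutes with the Laplacian and preserves
positivity; a nonnegative weight then keeps the sign. -/
lemma IsWeakSubsolution.rotation_average {v : ℂ → ℝ} (h : IsWeakSubsolution v 0)
    (hv : LocallyIntegrableOn v (Metric.ball 0 1) volume) {g : C(Circle, ℝ)} (hg : ∀ c, 0 ≤ g c) :
    IsWeakSubsolution (angularAverage g v) 0 := by
  intro φ hφ hφ0
  simp only [Pi.zero_apply, zero_mul, integral_zero]
  obtain ⟨r, hr0, hr1, hr⟩ := exists_tsupport_subset_ball hφ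
  have hΔ0 : ∀ z, z ∉ Metric.closedBall (0 : ℂ) r → Laplacian.laplacian φ z = 0 := fun z hz =>
    laplacian_eq_zero_of_notMem fun h' => hz (Metric.ball_subset_closedBall (hr h'))
  have hc := continuous_laplacian hφ.contDiff_two
  obtain ⟨C, -, hC⟩ := exists_abs_le_of_hasCompactSupport hc hφ.hasCompactSupport_laplacian
  rw [setIntegral_ball_mul_eq hr1 hΔ0, ← angularAverage_indicator,
    integral_angularAverage_mul (integrable_indicator_closedBall hv hr1) g
      hc.aestronglyMeasurable hC]
  refine intervalIntegral.integral_nonneg Real.two_pi_pos.le fun t _ => mul_nonneg (hg _) ?_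
  set c := Circle.exp t
  have h1 := h _ (hφ.comp_rotation c⁻¹) fun z => hφ0 _
  have hΔ : ∀ z, Laplacian.laplacian (fun w => φ ((c⁻¹ : Circle) * w)) z =
      Laplacian.laplacian φ ((c⁻¹ : Circle) * z) := fun z =>
    laplacian_comp_linearIsometryEquiv hφ.contDiff_two (rotation c⁻¹) z
  simp_rw [hΔ] at h1
  rw [setIntegral_ball_mul_eq (g := fun z => Laplacian.laplacian φ ((c⁻¹ : Circle) * z)) hr1
    fun z hz => hΔ0 _ (by
      rwa [mem_closedBall_zero_iff, norm_circle_mul, ← mem_closedBall_zero_iff])] at h1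
  simp only [Pi.zero_apply, zero_mul, integral_zero] at h1
  refine h1.trans (le_of_eq ?_)
  have h2 := (measurePreserving_rotation c).integral_comp
    (rotation c).toHomeomorph.measurableEmbedding
    (fun z => (Metric.closedBall 0 r).indicator v z * Laplacian.laplacian φ ((c⁻¹ : Circle) * z))
  rw [← h2]
  refine integral_congr_ae (ae_of_all _ fun z => ?_)
  simp only
  rw [← mul_assoc, ← Circle.coe_mul, inv_mul_cancel, Circle.coe_one, one_mul]

/-- Integration against the values of `v` on the circle of radius `r`. -/
noncomputable def circleFunctional (v : ℂ → ℝ) (r : ℝ) (hv : CircleIntegrable v 0 r) :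
    C(Circle, ℝ) →L[ℝ] ℝ :=
  LinearMap.mkContinuous
    { toFun := fun k => ∫ t in (0 : ℝ)..(2 * Real.pi), k (Circle.exp t) * v (circleMap 0 r t)
      map_add' := fun k l => by
        have hi : ∀ k : C(Circle, ℝ), IntervalIntegrable
            (fun t => k (Circle.exp t) * v (circleMap 0 r t)) volume 0 (2 * Real.pi) := fun k =>
          IntervalIntegrable.continuousOn_mul (f := fun t => v (circleMap 0 r t)) hv
            (k.continuous.comp Circle.exp.continuous).continuousOn
        rw [← intervalIntegral.integral_add (hi k) (hi l)]
        simp [add_mul]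
      map_smul' := fun a k => by
        rw [RingHom.id_apply, smul_eq_mul, ← intervalIntegral.integral_const_mul]
        simp [mul_assoc] }
    (∫ t in (0 : ℝ)..(2 * Real.pi), |v (circleMap 0 r t)|)
    (fun k => by
      change ‖∫ t in (0 : ℝ)..(2 * Real.pi), k (Circle.exp t) * v (circleMap 0 r t)‖ ≤ _
      rw [mul_comm _ ‖k‖, ← intervalIntegral.integral_const_mul]
      refine intervalIntegral.norm_integral_le_of_norm_le Real.two_pi_pos.le
        (ae_of_all _ fun t _ => ?_) ((IntervalIntegrable.abs hv).const_mul _)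
      rw [norm_mul]
      exact mul_le_mul_of_nonneg_right (k.norm_coe_le_norm _) (norm_nonneg _))

/-- The translates of a continuous function on the circle, as a continuous family. -/
noncomputable def circleTranslate (g : C(Circle, ℝ)) : C(Circle, C(Circle, ℝ)) :=
  ContinuousMap.curry ⟨fun p : Circle × Circle => g (p.2 * p.1⁻¹), by fun_prop⟩

lemma circleTranslate_apply (g : C(Circle, ℝ)) (c d : Circle) :
    circleTranslate g c d = g (d * c⁻¹) := rfl

/-- A shift of the angle turns the value of the average at re^{iα} into a pairing of `v` on the
circle of radius r with a translate of `g`, the form to which weak convergence applies. -/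
lemma angularAverage_circleMap (g : C(Circle, ℝ)) (v : ℂ → ℝ) (r α : ℝ) :
    angularAverage g v (circleMap 0 r α) = ∫ t in (0 : ℝ)..(2 * Real.pi),
      circleTranslate g (Circle.exp α) (Circle.exp t) * v (circleMap 0 r t) := by
  have hper : Function.Periodic (fun t : ℝ => circleTranslate g (Circle.exp α) (Circle.exp t) *
      v (circleMap 0 r t)) (2 * Real.pi) := fun t => by
    simp only [Circle.periodic_exp t, periodic_circleMap 0 r t]
  have h1 := hper.intervalIntegral_add_eq 0 α
  rw [zero_add] at h1
  rw [h1, angularAverage]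
  have h2 := intervalIntegral.integral_comp_add_right (a := 0) (b := 2 * Real.pi) (fun t : ℝ =>
    circleTranslate g (Circle.exp α) (Circle.exp t) * v (circleMap 0 r t)) α
  rw [zero_add, add_comm (2 * Real.pi) α] at h2
  rw [← h2]
  refine intervalIntegral.integral_congr fun t _ => ?_
  have h3 : (Circle.exp t : ℂ) * circleMap 0 r α = circleMap 0 r (t + α) := by
    simp only [circleMap_zero, Circle.coe_exp, Complex.ofReal_add, add_mul, Complex.exp_add]
    ring
  simp only [circleTranslate_apply, Circle.exp_add, mul_inv_cancel_right, h3]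

/-- Weak convergence is uniform over the compact family of translates of `g`. If the bound failed at
points approaching the circle, a subsequence of their arguments would converge. By Banach-Steinhaus
the functionals are uniformly bounded, so the varying translate may be replaced by its limit, and
the values would tend to an integral of a nonnegative function against h ≤ 0. -/
lemma HasWeakBoundaryValues.angularAverage_le {v : ℂ → ℝ} {h : Circle → ℝ}
    (hb : HasWeakBoundaryValues v h)
    (hh : ∀ᵐ θ ∂(volume.restrict (Ioc 0 (2 * Real.pi))), h (Circle.exp θ) ≤ 0)
    {g : C(Circle, ℝ)} (hg : ∀ c, 0 ≤ g c) {ε : ℝ} (hε : 0 < ε) :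
    ∃ ρ < 1, ∀ z : ℂ, ρ < ‖z‖ → ‖z‖ < 1 → angularAverage g v z ≤ ε := by
  obtain ⟨r₀, hr₀, hint⟩ := (mem_nhdsLT_iff_exists_Ioo_subset).1 hb.circleIntegrable
  by_contra! hcon
  have hseq : ∀ n : ℕ, ∃ z : ℂ, max r₀ (1 - 1 / ((n : ℝ) + 1)) < ‖z‖ ∧ ‖z‖ < 1 ∧
      ε < angularAverage g v z := fun n => hcon _ (max_lt hr₀ (by
        have : 0 < 1 / ((n : ℝ) + 1) := by positivity
        linarith))
  choose z hz1 hz2 hz3 using hseq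
  have hci : ∀ n, CircleIntegrable v 0 ‖z n‖ := fun n =>
    hint ⟨(le_max_left _ _).trans_lt (hz1 n), hz2 n⟩
  have hr : Tendsto (fun n => ‖z n‖) atTop (𝓝[<] 1) := by
    refine tendsto_nhdsWithin_iff.2 ⟨?_, Eventually.of_forall hz2⟩
    refine tendsto_of_tendsto_of_tendsto_of_le_of_le
      (g := fun n : ℕ => 1 - 1 / ((n : ℝ) + 1)) ?_ tendsto_const_nhds
      (fun n => ((le_max_right _ _).trans_lt (hz1 n)).le) (fun n => (hz2 n).le)
    simpa using (tendsto_const_nhds (x := (1 : ℝ))).sub tendsto_one_div_add_atTop_nhds_zero_nat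
  let Λ : ℕ → C(Circle, ℝ) →L[ℝ] ℝ := fun n => circleFunctional v ‖z n‖ (hci n)
  have hΛ : ∀ k : C(Circle, ℝ), Tendsto (fun n => Λ n k) atTop
      (𝓝 (∫ θ in (0 : ℝ)..(2 * Real.pi), k (Circle.exp θ) * h (Circle.exp θ))) := fun k =>
    (hb.tendsto k).comp hr
  obtain ⟨K, hK⟩ := banach_steinhaus (g := Λ) fun k => by
    obtain ⟨C, hC⟩ := (hΛ k).norm.bddAbove_range
    exact ⟨C, fun n => hC ⟨n, rfl⟩⟩
  obtain ⟨c, s, hs, hsc⟩ := CompactSpace.tendsto_subseq fun n => Circle.exp (z n).arg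
  have hval : ∀ n, angularAverage g v (z n) = Λ n (circleTranslate g (Circle.exp (z n).arg)) := by
    intro n
    have : z n = circleMap 0 ‖z n‖ (z n).arg := by
      rw [circleMap_zero, Complex.norm_mul_exp_arg_mul_I]
    conv_lhs => rw [this]
    rw [angularAverage_circleMap]
    rfl
  have hlim1 : Tendsto (fun n => Λ (s n) (circleTranslate g (Circle.exp (z (s n)).arg)) -
      Λ (s n) (circleTranslate g c)) atTop (𝓝 0) := by
    have hd : Tendsto (fun n => K * ‖circleTranslate g (Circle.exp (z (s n)).arg) -
        circleTranslate g c‖) atTop (𝓝 0) := by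
      have := ((circleTranslate g).continuous.tendsto c).comp hsc
      simpa using (tendsto_iff_norm_sub_tendsto_zero.1 this).const_mul K
    refine squeeze_zero_norm (fun n => ?_) hd
    rw [← map_sub]
    exact ((Λ (s n)).le_opNorm _).trans (mul_le_mul_of_nonneg_right (hK _) (norm_nonneg _))
  have hlim2 := hlim1.add ((hΛ (circleTranslate g c)).comp hs.tendsto_atTop)
  simp only [Function.comp_def, sub_add_cancel, zero_add, ← hval] at hlim2
  have h1 : ε ≤ ∫ θ in (0 : ℝ)..(2 * Real.pi),
      circleTranslate g c (Circle.exp θ) * h (Circle.exp θ) :=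
    ge_of_tendsto' hlim2 fun n => (hz3 _).le
  have h2 : ∫ θ in (0 : ℝ)..(2 * Real.pi),
      circleTranslate g c (Circle.exp θ) * h (Circle.exp θ) ≤ 0 := by
    rw [intervalIntegral.integral_of_le Real.two_pi_pos.le]
    refine integral_nonpos_of_ae ?_
    filter_upwards [hh] with θ hθ
    exact mul_nonpos_of_nonneg_of_nonpos (hg _) hθ
  linarith

/-- A weakly subharmonic function with nonpositive weak boundary values is nonpositive. -/
lemma IsWeakSubsolution.ae_nonpos_of_boundaryValues {v : ℂ → ℝ} {h : Circle → ℝ}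
    (hsub : IsWeakSubsolution v 0) (hv : LocallyIntegrableOn v (Metric.ball 0 1) volume)
    (hb : HasWeakBoundaryValues v h)
    (hh : ∀ᵐ θ ∂(volume.restrict (Ioc 0 (2 * Real.pi))), h (Circle.exp θ) ≤ 0) :
    ∀ᵐ z ∂volume.restrict (Metric.ball (0 : ℂ) 1), v z ≤ 0 := by
  have hav : ∀ g : C(Circle, ℝ), (∀ c, 0 ≤ g c) →
      ∀ᵐ z ∂volume.restrict (Metric.ball (0 : ℂ) 1), angularAverage g v z ≤ 0 := by
    intro g hg
    refine (hsub.rotation_average hv hg).ae_nonpos (locallyIntegrableOn_angularAverage hv g)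
      ((continuous_const (y := (0 : ℝ))).locallyIntegrable.locallyIntegrableOn _)
      (ae_of_all _ fun _ _ => le_rfl) fun ε hε => ?_
    obtain ⟨ρ, hρ, H⟩ := hb.angularAverage_le hh hg hε
    refine ⟨ρ, hρ, ?_⟩
    filter_upwards [ae_restrict_mem Metric.isOpen_ball.measurableSet] with z hz hz'
    exact H z hz' (mem_ball_zero_iff.1 hz)
  have key : ∀ R < 1, ∀ᵐ z, (Metric.closedBall (0 : ℂ) R).indicator v z ≤ 0 := by
    intro R hR
    set V := (Metric.closedBall (0 : ℂ) R).indicator v with hVdef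
    have hV : Integrable V := integrable_indicator_closedBall hv hR
    -- The indicator of {V > 0}, taken for a measurable representative so that `ψ` is measurable;
    -- then Vψ is the positive part of V almost everywhere.
    let ψ : ℂ → ℝ := {z | 0 < hV.aestronglyMeasurable.mk V z}.indicator fun _ => 1
    have hψm : Measurable ψ := measurable_const.indicator
      (measurableSet_lt measurable_const hV.aestronglyMeasurable.stronglyMeasurable_mk.measurable)
    have hψ0 : ∀ z, 0 ≤ ψ z := fun z => indicator_nonneg (fun _ _ => zero_le_one) z
    have hψ1 : ∀ z, |ψ z| ≤ 1 := fun z => by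
      rw [abs_of_nonneg (hψ0 z)]
      exact indicator_le_self' (fun _ _ => zero_le_one) z
    have hVψ : (fun z => V z * ψ z) =ᵐ[volume] fun z => max (V z) 0 := by
      filter_upwards [hV.aestronglyMeasurable.ae_eq_mk] with z hz
      by_cases h0 : 0 < V z
      · have : ψ z = 1 := indicator_of_mem (by rw [mem_ofPred_eq, ← hz]; exact h0) _
        rw [this, mul_one, max_eq_left h0.le]
      · have : ψ z = 0 := indicator_of_notMem (by rw [mem_ofPred_eq, ← hz]; exact h0) _
        rw [this, mul_zero, max_eq_right (not_lt.1 h0)]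
    let τ : C(Circle × ℂ, ℂ) := ⟨fun p => (p.1 : ℂ) * p.2, by fun_prop⟩
    have hiV : ∀ c : Circle, Integrable fun z => V (c * z) := fun c =>
      (measurePreserving_rotation c).integrable_comp_of_integrable hV
    have hi : ∀ c : Circle, Integrable fun z => V (c * z) * ψ z := fun c =>
      (hiV c).mul_bdd (c := 1) hψm.aestronglyMeasurable (ae_of_all _ fun z => hψ1 z)
    have hKc : Continuous fun c : Circle => ∫ z, V (c * z) * ψ z := by
      refine continuous_iff_continuousAt.2 fun c₀ => ?_
      have h1 := tendsto_integral_abs_comp_sub hV τ.curry.continuous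
        measurePreserving_rotation c₀
      rw [ContinuousAt, tendsto_iff_norm_sub_tendsto_zero]
      refine squeeze_zero (fun _ => norm_nonneg _) (fun c => ?_) h1
      rw [← integral_sub (hi c) (hi c₀)]
      refine norm_integral_le_of_norm_le ((hiV c).sub (hiV c₀)).abs (ae_of_all _ fun z => ?_)
      rw [← sub_mul, norm_mul]
      exact mul_le_of_le_one_right (norm_nonneg _) (hψ1 z)
    -- With K(c) = ∫ V(cz)ψ(z) dz, the weight is the positive part of K. Then ∫ gK is the integral
    -- of K₊² over the circle, while Fubini identifies it with the pairing of the average with `ψ`,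
    -- which is nonpositive. So K₊ = 0, and K(1) is the integral of V₊.
    let g : C(Circle, ℝ) := ⟨fun c => max (∫ z, V (c * z) * ψ z) 0, hKc.max continuous_const⟩
    have hg0 : ∀ c, 0 ≤ g c := fun c => le_max_right _ _
    have h2 := integral_angularAverage_mul hV g hψm.aestronglyMeasurable hψ1
    have h3 : ∫ z, angularAverage g V z * ψ z ≤ 0 := by
      refine integral_nonpos_of_ae ?_
      rw [hVdef, angularAverage_indicator]
      filter_upwards [(ae_restrict_iff' Metric.isOpen_ball.measurableSet).1 (hav g hg0)] with z hz
      refine mul_nonpos_of_nonpos_of_nonneg ?_ (hψ0 z)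
      by_cases hzR : z ∈ Metric.closedBall (0 : ℂ) R
      · rw [indicator_of_mem hzR]
        exact hz (Metric.closedBall_subset_ball hR hzR)
      · rw [indicator_of_notMem hzR]
    have h4 : g 1 ≤ 0 := by
      by_contra! hlt
      have hgt : Continuous fun t : ℝ => g (Circle.exp t) * ∫ z, V (Circle.exp t * z) * ψ z :=
        (g.continuous.comp Circle.exp.continuous).mul (hKc.comp Circle.exp.continuous)
      have h5 : 0 < ∫ t in (0 : ℝ)..(2 * Real.pi),
          g (Circle.exp t) * ∫ z, V (Circle.exp t * z) * ψ z := by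
        refine intervalIntegral.integral_pos Real.two_pi_pos hgt.continuousOn (fun t _ => ?_)
          ⟨0, ⟨le_rfl, Real.two_pi_pos.le⟩, ?_⟩
        · rcases le_total (∫ z, V (Circle.exp t * z) * ψ z) 0 with h' | h'
          · have : g (Circle.exp t) = 0 := max_eq_right h'
            rw [this, zero_mul]
          · exact mul_nonneg (hg0 _) h'
        · rw [Circle.exp_zero]
          refine mul_pos hlt ?_
          by_contra! h'
          have : g 1 = 0 := max_eq_right h'
          linarith
      linarith
    have h6 : ∫ z, max (V z) 0 ≤ 0 := by
      rw [← integral_congr_ae hVψ]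
      have := (le_max_left _ _).trans h4
      simpa using this
    have h7 := (integral_eq_zero_iff_of_nonneg (fun z => le_max_right _ _) hV.pos_part).1
      (le_antisymm h6 (integral_nonneg fun z => le_max_right _ _))
    filter_upwards [h7] with z hz
    exact (le_max_left _ _).trans hz.le
  -- Countably many radii exhaust the open disk, so the exceptional null sets may be united.
  have hall := ae_all_iff.2 fun n : ℕ => key (1 - 1 / ((n : ℝ) + 1)) (by
    have : 0 < 1 / ((n : ℝ) + 1) := by positivity
    linarith)
  rw [ae_restrict_iff' Metric.isOpen_ball.measurableSet]
  filter_upwards [hall] with z hz hz1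
  obtain ⟨n, hn⟩ := exists_nat_one_div_lt (sub_pos.2 (mem_ball_zero_iff.1 hz1))
  have := hz n
  rwa [indicator_of_mem (mem_closedBall_zero_iff.2 (by linarith))] at this

/-! ### Operations on boundary values and the comparison principle. -/

lemma MemLinftyCircle.exists_ae_abs_le {h : Circle → ℝ} (hh : MemLinftyCircle h) :
    ∃ M : ℝ, 0 ≤ M ∧
      ∀ᵐ θ ∂(volume.restrict (Ioc 0 (2 * Real.pi))), |h (Circle.exp θ)| ≤ M := by
  refine ⟨(eLpNorm (fun θ : ℝ => h (Circle.exp θ)) ⊤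
    (volume.restrict (Ioc 0 (2 * Real.pi)))).toReal, ENNReal.toReal_nonneg, ?_⟩
  have h1 := ae_le_eLpNormEssSup (f := fun θ : ℝ => h (Circle.exp θ))
    (μ := volume.restrict (Ioc 0 (2 * Real.pi)))
  filter_upwards [h1] with θ hθ
  rw [← eLpNorm_exponent_top] at hθ
  have := ENNReal.toReal_mono hh.eLpNorm_ne_top hθ
  simpa using this

lemma MemLinftyCircle.intervalIntegrable {h : Circle → ℝ} (hh : MemLinftyCircle h) :
    IntervalIntegrable (fun θ : ℝ => h (Circle.exp θ)) volume 0 (2 * Real.pi) := by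
  rw [intervalIntegrable_iff_integrableOn_Ioc_of_le Real.two_pi_pos.le]
  exact hh.integrable le_top

lemma intervalIntegrable_circle_mul (g : C(Circle, ℝ)) {f : ℝ → ℝ}
    (hf : IntervalIntegrable f volume 0 (2 * Real.pi)) :
    IntervalIntegrable (fun θ => g (Circle.exp θ) * f θ) volume 0 (2 * Real.pi) :=
  IntervalIntegrable.continuousOn_mul hf (g.continuous.comp Circle.exp.continuous).continuousOn

lemma HasWeakBoundaryValues.sub {u v : ℂ → ℝ} {h k : Circle → ℝ} (hu : HasWeakBoundaryValues u h)
    (hv : HasWeakBoundaryValues v k)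
    (hh : IntervalIntegrable (fun θ : ℝ => h (Circle.exp θ)) volume 0 (2 * Real.pi))
    (hk : IntervalIntegrable (fun θ : ℝ => k (Circle.exp θ)) volume 0 (2 * Real.pi)) :
    HasWeakBoundaryValues (fun z => u z - v z) (fun c => h c - k c) := by
  refine ⟨?_, fun g => ?_⟩
  · filter_upwards [hu.circleIntegrable, hv.circleIntegrable] with r h1 h2
    exact h1.sub h2
  · simp only [mul_sub]
    rw [intervalIntegral.integral_sub (intervalIntegrable_circle_mul g hh)
      (intervalIntegrable_circle_mul g hk)]
    refine ((hu.tendsto g).sub (hv.tendsto g)).congr' ?_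
    filter_upwards [hu.circleIntegrable, hv.circleIntegrable] with r h1 h2
    rw [intervalIntegral.integral_sub (intervalIntegrable_circle_mul g h1)
      (intervalIntegrable_circle_mul g h2)]

lemma hasWeakBoundaryValues_radial {q : ℝ → ℝ} (hq : ContinuousAt q 1) :
    HasWeakBoundaryValues (fun z => q ‖z‖) (fun _ => q 1) := by
  have hn : ∀ r : ℝ, 0 < r → ∀ θ, q ‖circleMap 0 r θ‖ = q r := fun r hr θ => by
    rw [norm_circleMap_zero, abs_of_pos hr]
  have hev : ∀ᶠ r : ℝ in 𝓝[<] 1, 0 < r :=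
    mem_nhdsWithin_of_mem_nhds (lt_mem_nhds one_pos)
  refine ⟨hev.mono fun r hr => ?_, fun g => ?_⟩
  · rw [CircleIntegrable]
    simp_rw [hn r hr]
    exact intervalIntegrable_const
  · simp only [intervalIntegral.integral_mul_const]
    have h1 := ((hq.tendsto.mono_left nhdsWithin_le_nhds).const_mul
      (∫ θ in (0 : ℝ)..(2 * Real.pi), g (Circle.exp θ)) : Tendsto _ (𝓝[<] (1 : ℝ)) _)
    refine h1.congr' (hev.mono fun r hr => ?_)
    simp_rw [hn r hr, intervalIntegral.integral_mul_const]

lemma locallyIntegrableOn_const_mul {s : Set ℂ} {v : ℂ → ℝ}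
    (hv : LocallyIntegrableOn v s volume) (c : ℝ) :
    LocallyIntegrableOn (fun z => c * v z) s volume := fun x hx => by
  obtain ⟨t, ht, hi⟩ := hv x hx
  exact ⟨t, ht, Integrable.const_mul hi c⟩

/-- The larger measure contributes the larger integral of φ ≥ 0, so the measure terms have a
favourable sign and are discarded. Finiteness of `ν₁` makes `φ` integrable. -/
lemma IsWeakGaussSolution.isWeakSubsolution_sub {ν₁ ν₂ : Measure (Metric.ball (0 : ℂ) 1)}
    [IsFiniteMeasure ν₁] {u₁ u₂ : ℂ → ℝ} (h₁ : IsWeakGaussSolution ν₁ u₁)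
    (h₂ : IsWeakGaussSolution ν₂ u₂) (hν : ν₂ ≤ ν₁) :
    IsWeakSubsolution (fun z => u₁ z - u₂ z)
      (fun z => 4 * Real.exp (2 * u₁ z) - 4 * Real.exp (2 * u₂ z)) := by
  intro φ hφ hφ0
  have l₁ := hφ.integrableOn_mul (locallyIntegrableOn_const_mul h₁.locallyIntegrable_exp 4)
  have l₂ := hφ.integrableOn_mul (locallyIntegrableOn_const_mul h₂.locallyIntegrable_exp 4)
  simp only [sub_mul]
  rw [integral_sub l₁ l₂, integral_sub (hφ.integrableOn_mul_laplacian h₁.locallyIntegrable)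
    (hφ.integrableOn_mul_laplacian h₂.locallyIntegrable), h₁.weak_eq φ hφ, h₂.weak_eq φ hφ]
  obtain ⟨C, -, hC⟩ := exists_abs_le_of_hasCompactSupport hφ.1.continuous hφ.2.1
  have hi : Integrable (fun z : Metric.ball (0 : ℂ) 1 => φ z) ν₁ :=
    Integrable.of_bound (hφ.1.continuous.comp continuous_subtype_val).aestronglyMeasurable C
      (ae_of_all _ fun z => hC z)
  have := integral_mono_measure hν (ae_of_all _ fun z : Metric.ball (0 : ℂ) 1 => hφ0 z) hi
  have := mul_le_mul_of_nonneg_left this Real.two_pi_pos.le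
  linarith

lemma IsWeakGaussSolution.isWeakSubsolution {ν : Measure (Metric.ball (0 : ℂ) 1)} {u : ℂ → ℝ}
    (h : IsWeakGaussSolution ν u) : IsWeakSubsolution u 0 := by
  intro φ hφ hφ0
  rw [h.weak_eq φ hφ]
  simp only [Pi.zero_apply, zero_mul, integral_zero]
  have h1 : 0 ≤ ∫ z in Metric.ball (0 : ℂ) 1, 4 * Real.exp (2 * u z) * φ z :=
    integral_nonneg fun z => mul_nonneg (by positivity) (hφ0 z)
  have h2 : 0 ≤ ∫ z : Metric.ball (0 : ℂ) 1, φ z ∂ν := integral_nonneg fun z => hφ0 z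
  have := mul_nonneg Real.two_pi_pos.le h2
  linarith

lemma IsWeakSubsolution.mono {v f f' : ℂ → ℝ} (h : IsWeakSubsolution v f)
    (hf : LocallyIntegrableOn f (Metric.ball 0 1) volume)
    (hf' : LocallyIntegrableOn f' (Metric.ball 0 1) volume)
    (hle : ∀ᵐ z ∂volume.restrict (Metric.ball (0 : ℂ) 1), f' z ≤ f z) :
    IsWeakSubsolution v f' := fun φ hφ hφ0 =>
  (integral_mono_ae (hφ.integrableOn_mul hf') (hφ.integrableOn_mul hf)
    (hle.mono fun z hz => mul_le_mul_of_nonneg_right hz (hφ0 z))).trans (h φ hφ hφ0)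

lemma locallyIntegrableOn_of_continuous {p : ℂ → ℝ} (hp : Continuous p) :
    LocallyIntegrableOn p (Metric.ball 0 1) volume :=
  hp.locallyIntegrable.locallyIntegrableOn _

/-- The right side of the equation is nonnegative, so u - M is weakly subharmonic, with boundary
values h - M ≤ 0. -/
lemma IsGaussDirichletSolution.ae_le {ν : Measure (Metric.ball (0 : ℂ) 1)} {h : Circle → ℝ}
    {u : ℂ → ℝ} (hu : IsGaussDirichletSolution ν h u) (hh : MemLinftyCircle h) {M : ℝ}
    (hM : ∀ᵐ θ ∂(volume.restrict (Ioc 0 (2 * Real.pi))), h (Circle.exp θ) ≤ M) :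
    ∀ᵐ z ∂volume.restrict (Metric.ball (0 : ℂ) 1), u z ≤ M := by
  have h1 := hu.weakSolution.isWeakSubsolution.sub_contDiff hu.weakSolution.locallyIntegrable
    (locallyIntegrableOn_of_continuous continuous_const) (p := fun _ => M) contDiff_const
  simp only [InnerProductSpace.laplacian_const, Pi.zero_apply, sub_zero] at h1
  have h2 := hu.boundary.sub (hasWeakBoundaryValues_radial (q := fun _ => M) continuousAt_const)
    hh.intervalIntegrable intervalIntegrable_const
  have h3 := IsWeakSubsolution.ae_nonpos_of_boundaryValues h1
    (hu.weakSolution.locallyIntegrable.sub (locallyIntegrableOn_of_continuous continuous_const)) h2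
    (hM.mono fun θ hθ => by linarith)
  exact h3.mono fun z hz => by linarith

/-- The function `c (1 - |z|²)`, whose Laplacian is `-4c`. -/
lemma laplacian_const_mul_one_sub_norm_sq (c : ℝ) (z : ℂ) :
    Laplacian.laplacian (fun w => c * (1 - ‖w‖ ^ 2) : ℂ → ℝ) z = -(4 * c) := by
  have h2 := ContDiffAt.laplacian_sub (f₁ := fun _ : ℂ => c) (f₂ := c • fun z : ℂ => ‖z‖ ^ 2)
      (x := z) contDiffAt_const ((contDiff_norm_sq ℝ).const_smul c).contDiffAt
  have h3 : (fun z : ℂ => c * (1 - ‖z‖ ^ 2)) = (fun _ : ℂ => c) - c • fun z : ℂ => ‖z‖ ^ 2 := by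
    ext z; simp; ring
  rw [h3, h2, InnerProductSpace.laplacian_smul c (contDiff_norm_sq ℝ).contDiffAt,
    laplacian_norm_sq]
  simp
  ring

lemma contDiff_const_mul_one_sub_norm_sq (c : ℝ) :
    ContDiff ℝ 2 (fun w : ℂ => c * (1 - ‖w‖ ^ 2)) :=
  contDiff_const.mul (contDiff_const.sub (contDiff_norm_sq ℝ))

/-- The comparison principle. -/
theorem IsGaussDirichletSolution.ae_le_of_le {ν₁ ν₂ : Measure (Metric.ball (0 : ℂ) 1)}
    {h₁ h₂ : Circle → ℝ} {u₁ u₂ : ℂ → ℝ} [IsFiniteMeasure ν₁]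
    (hh₁ : MemLinftyCircle h₁) (hh₂ : MemLinftyCircle h₂)
    (hu₁ : IsGaussDirichletSolution ν₁ h₁ u₁) (hu₂ : IsGaussDirichletSolution ν₂ h₂ u₂)
    (hh : ∀ᵐ θ ∂(volume.restrict (Ioc 0 (2 * Real.pi))), h₁ (Circle.exp θ) ≤ h₂ (Circle.exp θ))
    (hν : ν₂ ≤ ν₁) : u₁ ≤ᵐ[volume.restrict (Metric.ball (0 : ℂ) 1)] u₂ := by
  obtain ⟨M, -, hM⟩ := hh₂.exists_ae_abs_le
  have hub := hu₂.ae_le hh₂ (hM.mono fun θ hθ => (le_abs_self _).trans hθ)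
  have hsub := hu₁.weakSolution.isWeakSubsolution_sub hu₂.weakSolution hν
  have hwl := hu₁.weakSolution.locallyIntegrable.sub hu₂.weakSolution.locallyIntegrable
  have hfl := (locallyIntegrableOn_const_mul hu₁.weakSolution.locallyIntegrable_exp 4).sub
    (locallyIntegrableOn_const_mul hu₂.weakSolution.locallyIntegrable_exp 4)
  set C := Real.exp (2 * M) with hC
  set p : ℂ → ℝ := fun w => C * (1 - ‖w‖ ^ 2) with hp
  have hpC : ContDiff ℝ 2 p := contDiff_const_mul_one_sub_norm_sq C
  -- Since u₂ ≤ M, the nonlinear term is at least -4e^{2M} = Δp, so subtracting `p` leaves a weakly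
  -- subharmonic function; `p` vanishes on the circle and does not alter the boundary values.
  have hbar : IsWeakSubsolution (fun z => u₁ z - u₂ z - p z) 0 := by
    refine (hsub.sub_contDiff hwl hfl hpC).mono (hfl.sub (locallyIntegrableOn_of_continuous
      (continuous_laplacian hpC))) (locallyIntegrableOn_of_continuous continuous_const) ?_
    filter_upwards [hub] with z hz
    rw [hp, laplacian_const_mul_one_sub_norm_sq]
    have h1 : Real.exp (2 * u₂ z) ≤ C := Real.exp_le_exp.2 (by linarith)
    have h2 := Real.exp_pos (2 * u₁ z)
    simp only [Pi.zero_apply]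
    linarith
  have hbd := (hu₁.boundary.sub hu₂.boundary hh₁.intervalIntegrable hh₂.intervalIntegrable).sub
    (hasWeakBoundaryValues_radial (q := fun r => C * (1 - r ^ 2)) (by fun_prop))
    (hh₁.intervalIntegrable.sub hh₂.intervalIntegrable) intervalIntegrable_const
  have hle := IsWeakSubsolution.ae_nonpos_of_boundaryValues hbar
    (hwl.sub (locallyIntegrableOn_of_continuous hpC.continuous)) hbd
    (hh.mono fun θ hθ => by simp; linarith)
  have hC0 : 0 < C := Real.exp_pos _
  -- The bound u₁ - u₂ ≤ p turns weak boundary values into uniform ones, so the maximum principle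
  -- applies to the nonlinear inequality itself.
  have hfin := hsub.ae_nonpos hwl hfl (ae_of_all _ fun z hz => by
      have : Real.exp (2 * u₂ z) ≤ Real.exp (2 * u₁ z) := Real.exp_le_exp.2 (by linarith)
      linarith) fun ε hε => by
    have hcont : Tendsto (fun r : ℝ => C * (1 - r ^ 2)) (𝓝[<] 1) (𝓝 0) := by
      have : ContinuousAt (fun r : ℝ => C * (1 - r ^ 2)) 1 := by fun_prop
      simpa using this.tendsto.mono_left nhdsWithin_le_nhds
    obtain ⟨ρ, hρ, hρε⟩ := (mem_nhdsLT_iff_exists_Ioo_subset).1 (hcont.eventually_lt_const hε)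
    refine ⟨ρ, hρ, ?_⟩
    filter_upwards [hle, ae_restrict_mem Metric.isOpen_ball.measurableSet] with z hz hz1 hzρ
    have h1 : C * (1 - ‖z‖ ^ 2) < ε := hρε ⟨hzρ, mem_ball_zero_iff.1 hz1⟩
    simp only [hp] at hz
    linarith
  filter_upwards [hfin] with z hz
  linarith

/-! ### Radial integrals and the logarithm as fundamental solution. -/

/-- In polar coordinates the area element supplies a factor y, which absorbs the singularities at 0
of log y and 1/y. -/
lemma integrableOn_closedBall_radial {f : ℝ → ℝ} (hf : Measurable f) {R C : ℝ}
    (hb : ∀ y, 0 < y → y ≤ R → |y * f y| ≤ C) :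
    IntegrableOn (fun z : ℂ => f ‖z‖) (Metric.closedBall 0 R) := by
  rw [← integrable_indicator_iff Metric.isClosed_closedBall.measurableSet]
  have h1 : (Metric.closedBall (0 : ℂ) R).indicator (fun z : ℂ => f ‖z‖) =
      fun z => (Iic R).indicator f ‖z‖ := by
    ext z
    by_cases hz : ‖z‖ ≤ R
    · rw [indicator_of_mem (mem_closedBall_zero_iff.2 hz), indicator_of_mem (mem_Iic.2 hz)]
    · rw [indicator_of_notMem (mt mem_closedBall_zero_iff.1 hz),
        indicator_of_notMem (mt mem_Iic.1 hz)]
  rw [h1, integrable_fun_norm_addHaar]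
  simp only [Complex.finrank_real_complex, Nat.add_one_sub_one, pow_one, smul_eq_mul]
  have h2 : IntegrableOn (fun y => y * f y) (Ioc 0 R) := by
    refine IntegrableOn.of_bound (by simp) (measurable_id.mul hf).aestronglyMeasurable C ?_
    filter_upwards [ae_restrict_mem measurableSet_Ioc] with y hy
    exact hb y hy.1 hy.2
  rw [← integrable_indicator_iff measurableSet_Ioc] at h2
  have h3 : IntegrableOn ((Ioc 0 R).indicator fun y => y * f y) (Ioi 0) := h2.integrableOn
  refine h3.congr_fun (fun y hy => ?_) measurableSet_Ioi
  by_cases hyR : y ≤ R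
  · simp only [indicator_of_mem (show y ∈ Ioc 0 R from ⟨hy, hyR⟩),
      indicator_of_mem (mem_Iic.2 hyR)]
  · simp only [indicator_of_notMem (fun h : y ∈ Ioc 0 R => hyR h.2),
      indicator_of_notMem (mt mem_Iic.1 hyR), mul_zero]

lemma locallyIntegrable_of_closedBall {f : ℂ → ℝ}
    (h : ∀ R, IntegrableOn f (Metric.closedBall (0 : ℂ) R)) : LocallyIntegrable f := fun x =>
  ⟨Metric.closedBall 0 (‖x‖ + 1), Filter.mem_of_superset
    (Metric.isOpen_ball.mem_nhds (mem_ball_zero_iff.2 (lt_add_one ‖x‖)))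
    Metric.ball_subset_closedBall, h _⟩

lemma locallyIntegrable_log_norm : LocallyIntegrable fun z : ℂ => Real.log ‖z‖ := by
  refine locallyIntegrable_of_closedBall fun R => ?_
  refine integrableOn_closedBall_radial (C := R ^ 2 + 1) Real.measurable_log fun y hy hyR => ?_
  rw [abs_le]
  have h1 := Real.one_sub_inv_le_log_of_pos hy
  have h2 := Real.log_le_sub_one_of_pos hy
  have h3 : y * (1 - y⁻¹) = y - 1 := by field_simp
  constructor <;> nlinarith

lemma integrableOn_inv_norm (R : ℝ) :
    IntegrableOn (fun z : ℂ => ‖z‖⁻¹) (Metric.closedBall 0 R) :=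
  integrableOn_closedBall_radial (f := fun y => y⁻¹) (C := 1) measurable_inv fun y hy _ => by
    rw [mul_inv_cancel₀ hy.ne']
    simp

/-- The density is the Laplacian of ½ log(|z|² + 1), and its mass is the constant 2π of the
fundamental solution. In polar coordinates the integrand has the primitive -1/(1 + y²). -/
lemma integral_bubble : ∫ z : ℂ, 2 / (1 + ‖z‖ ^ 2) ^ 2 = 2 * Real.pi ∧
    Integrable fun z : ℂ => 2 / (1 + ‖z‖ ^ 2) ^ 2 := by
  have hd : ∀ y : ℝ, HasDerivAt (fun y : ℝ => -(1 + y ^ 2)⁻¹) (y * (2 / (1 + y ^ 2) ^ 2)) y := by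
    intro y
    have h0 : (1 + y ^ 2 : ℝ) ≠ 0 := by positivity
    have h1 : HasDerivAt (fun y : ℝ => 1 + y ^ 2) (2 * y) y := by
      simpa using (hasDerivAt_pow 2 y).const_add 1
    exact ((h1.inv h0).neg).congr_deriv (by ring)
  have hpos : ∀ y ∈ Ioi (0 : ℝ), 0 ≤ y * (2 / (1 + y ^ 2) ^ 2) := fun y hy =>
    mul_nonneg (le_of_lt hy) (by positivity)
  have hlim : Tendsto (fun y : ℝ => -(1 + y ^ 2)⁻¹) atTop (𝓝 0) := by
    have h1 : Tendsto (fun y : ℝ => 1 + y ^ 2) atTop atTop :=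
      tendsto_atTop_add_const_left _ _ (tendsto_pow_atTop two_ne_zero)
    simpa using h1.inv_tendsto_atTop.neg
  have hint := integral_Ioi_of_hasDerivAt_of_nonneg (hd 0).continuousAt.continuousWithinAt
    (fun y _ => hd y) hpos hlim
  have hi := integrableOn_Ioi_deriv_of_nonneg' (fun y _ => hd y) hpos hlim
  constructor
  · have := integral_fun_norm_addHaar (volume : Measure ℂ) fun y : ℝ => 2 / (1 + y ^ 2) ^ 2
    rw [this]
    simp only [Complex.finrank_real_complex, Nat.add_one_sub_one, pow_one, smul_eq_mul]
    rw [hint]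
    simp [Measure.real, Complex.volume_ball]
  · rw [integrable_fun_norm_addHaar (volume : Measure ℂ) (f := fun y : ℝ => 2 / (1 + y ^ 2) ^ 2)]
    simpa using hi

/-- A smooth regularization of log |z|, which avoids cutting out a disk around the singularity. It
is a function of |z|², with Δ|z|² = 4 and |∇|z|²|² = 4|z|². -/
lemma laplacian_log_norm_sq_add {ε : ℝ} (hε : 0 < ε) (z : ℂ) :
    ContDiff ℝ 2 (fun w : ℂ => Real.log (‖w‖ ^ 2 + ε ^ 2) / 2) ∧
    Laplacian.laplacian (fun w : ℂ => Real.log (‖w‖ ^ 2 + ε ^ 2) / 2) z =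
      2 * ε ^ 2 / (‖z‖ ^ 2 + ε ^ 2) ^ 2 := by
  let j : ℝ → ℝ := fun t => Real.log (t + ε ^ 2) / 2
  have hj : ∀ t, 0 ≤ t → ContDiffAt ℝ 2 j t := fun t ht => by
    have : t + ε ^ 2 ≠ 0 := by positivity
    exact ((contDiffAt_id.add contDiffAt_const).log this).div_const 2
  have hn : ContDiff ℝ 2 fun w : ℂ => ‖w‖ ^ 2 := contDiff_norm_sq ℝ
  refine ⟨contDiff_iff_contDiffAt.2 fun w => (hj _ (by positivity)).comp w hn.contDiffAt, ?_⟩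
  have hd1 : ∀ t, -ε ^ 2 < t → deriv j t = 1 / 2 * (t + ε ^ 2)⁻¹ := fun t ht => by
    have h0 : t + ε ^ 2 ≠ 0 := by linarith
    have : HasDerivAt j (1 / (t + ε ^ 2) / 2) t :=
      (((hasDerivAt_id t).add_const (ε ^ 2)).log h0).div_const 2
    rw [this.deriv]
    field_simp
  have hε2 : 0 < ε ^ 2 := by positivity
  have hz0 : 0 ≤ ‖z‖ ^ 2 := by positivity
  have hd2 : deriv (deriv j) (‖z‖ ^ 2) = -(1 / 2) / (‖z‖ ^ 2 + ε ^ 2) ^ 2 := by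
    have h1 : deriv j =ᶠ[𝓝 (‖z‖ ^ 2)] fun t => 1 / 2 * (t + ε ^ 2)⁻¹ := by
      filter_upwards [lt_mem_nhds (show -ε ^ 2 < ‖z‖ ^ 2 by linarith)] with t ht
      exact hd1 t ht
    rw [h1.deriv_eq]
    have h0 : ‖z‖ ^ 2 + ε ^ 2 ≠ 0 := by positivity
    have h2 := ((((hasDerivAt_id (‖z‖ ^ 2)).add_const (ε ^ 2)).inv h0).const_mul (1 / 2 : ℝ))
    have h3 := h2.deriv
    simp only [id_eq] at h3
    rw [show (fun t : ℝ => 1 / 2 * (t + ε ^ 2)⁻¹) = fun y => 1 / 2 * ((fun x => x + ε ^ 2)⁻¹) y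
      from rfl, h3]
    ring
  have h := laplacian_comp_real (j := j) (f := fun w : ℂ => ‖w‖ ^ 2) (z := z) hn.contDiffAt
    (hj _ hz0)
  have hf : ∀ e : ℂ, fderiv ℝ (fun w : ℂ => ‖w‖ ^ 2) z e = 2 * inner ℝ z e := fun e => by
    rw [fderiv_norm_sq_apply]; simp; ring
  rw [show (fun w : ℂ => Real.log (‖w‖ ^ 2 + ε ^ 2) / 2) = fun w => j (‖w‖ ^ 2) from rfl, h, hd2,
    hd1 _ (by linarith), laplacian_norm_sq, hf, hf]
  have hin : (2 * inner ℝ z 1 : ℝ) ^ 2 + (2 * inner ℝ z Complex.I) ^ 2 = 4 * ‖z‖ ^ 2 := by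
    rw [Complex.sq_norm, Complex.normSq_apply]
    simp [Complex.inner]
    ring
  rw [hin]
  field_simp
  ring

/-- `log |z| / (2π)` is a fundamental solution of the Laplacian in the plane. -/
lemma integral_log_norm_mul_laplacian {φ : ℂ → ℝ} (hφ : ContDiff ℝ 2 φ)
    (hc : HasCompactSupport φ) :
    ∫ z, Real.log ‖z‖ * Laplacian.laplacian φ z = 2 * Real.pi * φ 0 := by
  let e : ℕ → ℝ := fun n => 1 / ((n : ℝ) + 1)
  have he0 : ∀ n, 0 < e n := fun n => by positivity
  have he1 : ∀ n, e n ≤ 1 := fun n => by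
    rw [div_le_one (by positivity)]
    have : (0 : ℝ) ≤ n := n.cast_nonneg
    linarith
  have he : Tendsto e atTop (𝓝 0) := tendsto_one_div_add_atTop_nhds_zero_nat
  have hΔc := continuous_laplacian hφ
  have hΔs : HasCompactSupport (Laplacian.laplacian φ) :=
    hc.mono' (subset_closure.trans (tsupport_laplacian_subset φ))
  obtain ⟨C, hC0, hC⟩ := exists_abs_le_of_hasCompactSupport hφ.continuous hc
  have l1 : Tendsto (fun n => ∫ z : ℂ, Real.log (‖z‖ ^ 2 + e n ^ 2) / 2 * Laplacian.laplacian φ z)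
      atTop (𝓝 (∫ z, Real.log ‖z‖ * Laplacian.laplacian φ z)) := by
    -- The majorant comes from log |z| ≤ ½ log(|z|² + ε²) ≤ ½|z|²; the second inequality uses log x
    -- ≤ x - 1 and ε ≤ 1.
    have hbi : Integrable fun z : ℂ => (|Real.log ‖z‖| + ‖z‖ ^ 2) * |Laplacian.laplacian φ z| := by
      have hl : LocallyIntegrable fun z : ℂ => |Real.log ‖z‖| + ‖z‖ ^ 2 :=
        LocallyIntegrable.add (fun x => by
          obtain ⟨s, hs, hi⟩ := locallyIntegrable_log_norm x
          exact ⟨s, hs, Integrable.abs hi⟩)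
          (by fun_prop : Continuous fun z : ℂ => ‖z‖ ^ 2).locallyIntegrable
      have := hl.integrable_smul_left_of_hasCompactSupport (g := fun z => |Laplacian.laplacian φ z|)
        hΔc.abs (hΔs.comp_left (g := fun t : ℝ => |t|) abs_zero)
      simpa [mul_comm] using this
    refine tendsto_integral_of_dominated_convergence _ (fun n => ?_) hbi (fun n => ?_) ?_
    · exact ((laplacian_log_norm_sq_add (he0 n) 0).1.continuous.mul hΔc).aestronglyMeasurable
    · filter_upwards [Measure.ae_ne volume (0 : ℂ)] with z hz
      rw [norm_mul]
      refine mul_le_mul_of_nonneg_right ?_ (abs_nonneg _)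
      have hz' : 0 < ‖z‖ := norm_pos_iff.2 hz
      have h1 : Real.log ‖z‖ ≤ Real.log (‖z‖ ^ 2 + e n ^ 2) / 2 := by
        have : Real.log (‖z‖ ^ 2) ≤ Real.log (‖z‖ ^ 2 + e n ^ 2) :=
          Real.log_le_log (by positivity) (by nlinarith [he0 n])
        rw [Real.log_pow] at this
        push_cast at this
        linarith
      have h2 : Real.log (‖z‖ ^ 2 + e n ^ 2) ≤ ‖z‖ ^ 2 := by
        have := Real.log_le_sub_one_of_pos (show 0 < ‖z‖ ^ 2 + e n ^ 2 by positivity)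
        nlinarith [he0 n, he1 n]
      rw [Real.norm_eq_abs, abs_le]
      have := neg_abs_le (Real.log ‖z‖)
      have := abs_nonneg (Real.log ‖z‖)
      constructor <;> nlinarith
    · filter_upwards [Measure.ae_ne volume (0 : ℂ)] with z hz
      have hz' : ‖z‖ ^ 2 + (0 : ℝ) ^ 2 ≠ 0 := by simpa using hz
      have h1 : Tendsto (fun n => Real.log (‖z‖ ^ 2 + e n ^ 2) / 2) atTop
          (𝓝 (Real.log (‖z‖ ^ 2 + 0 ^ 2) / 2)) :=
        ((tendsto_const_nhds.add (he.pow 2)).log hz').div_const 2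
      have h2 : Real.log (‖z‖ ^ 2 + 0 ^ 2) / 2 = Real.log ‖z‖ := by
        rw [zero_pow two_ne_zero, add_zero, Real.log_pow]
        push_cast
        ring
      rw [h2] at h1
      exact h1.mul_const _
  have l2 : Tendsto (fun n => ∫ z : ℂ, Real.log (‖z‖ ^ 2 + e n ^ 2) / 2 * Laplacian.laplacian φ z)
      atTop (𝓝 (2 * Real.pi * φ 0)) := by
    have h1 : ∀ n, ∫ z : ℂ, Real.log (‖z‖ ^ 2 + e n ^ 2) / 2 * Laplacian.laplacian φ z =
        ∫ x : ℂ, 2 / (1 + ‖x‖ ^ 2) ^ 2 * φ (e n • x) := by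
      intro n
      rw [integral_mul_laplacian (f := fun z : ℂ => Real.log (‖z‖ ^ 2 + e n ^ 2) / 2) hφ hc
        fun z _ => (laplacian_log_norm_sq_add (he0 n) 0).1.contDiffAt]
      simp_rw [fun z => (laplacian_log_norm_sq_add (he0 n) z).2]
      -- The substitution z = εx makes the density independent of ε and moves the parameter into the
      -- argument of `φ`.
      have h2 := Measure.integral_comp_smul (volume : Measure ℂ)
        (fun z => 2 * e n ^ 2 / (‖z‖ ^ 2 + e n ^ 2) ^ 2 * φ z) (e n)
      rw [Complex.finrank_real_complex, abs_of_pos (by have := he0 n; positivity), smul_eq_mul,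
        inv_mul_eq_div, eq_div_iff (by have := he0 n; positivity)] at h2
      rw [← h2, ← integral_mul_const]
      refine integral_congr_ae (ae_of_all _ fun x => ?_)
      have := (he0 n).ne'
      simp only [norm_smul, Real.norm_eq_abs, abs_of_pos (he0 n)]
      have h3 : (e n * ‖x‖) ^ 2 + e n ^ 2 = e n ^ 2 * (1 + ‖x‖ ^ 2) := by ring
      rw [h3]
      have h4 : (1 + ‖x‖ ^ 2) ≠ 0 := by positivity
      field_simp
    simp_rw [h1]
    have h2 : 2 * Real.pi * φ 0 = ∫ x : ℂ, 2 / (1 + ‖x‖ ^ 2) ^ 2 * φ 0 := by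
      rw [integral_mul_const, integral_bubble.1]
    rw [h2]
    refine tendsto_integral_of_dominated_convergence (fun x : ℂ => 2 / (1 + ‖x‖ ^ 2) ^ 2 * C)
      (fun n => ?_) (integral_bubble.2.mul_const C) (fun n => ae_of_all _ fun x => ?_)
      (ae_of_all _ fun x => ?_)
    · have : Continuous fun x : ℂ => φ (e n • x) := hφ.continuous.comp (by fun_prop)
      exact integral_bubble.2.aestronglyMeasurable.mul this.aestronglyMeasurable
    · rw [norm_mul, Real.norm_of_nonneg (by positivity)]
      exact mul_le_mul_of_nonneg_left (hC _) (by positivity)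
    · have : Tendsto (fun n => φ (e n • x)) atTop (𝓝 (φ 0)) := by
        have h3 : Tendsto (fun n => e n • x) atTop (𝓝 0) := by simpa using he.smul_const x
        exact (hφ.continuous.tendsto 0).comp h3
      exact this.const_mul _
  exact tendsto_nhds_unique l1 l2

/-! ### The Green kernel of the disk. -/

/-- The Green kernel of the unit disk. The maximum only matters for `z = w`. -/
noncomputable def greenKernel (z w : ℂ) : ℝ :=
  max (Real.log ‖1 - (starRingEnd ℂ) w * z‖ - Real.log ‖z - w‖) 0

lemma greenKernel_nonneg (z w : ℂ) : 0 ≤ greenKernel z w := le_max_right _ _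

lemma measurable_greenKernel : Measurable (Function.uncurry greenKernel) := by
  unfold greenKernel Function.uncurry
  have : Continuous (starRingEnd ℂ) := Complex.continuous_conj
  exact ((((continuous_const.sub ((this.comp continuous_snd).mul continuous_fst)).norm.measurable).log).sub
    ((continuous_fst.sub continuous_snd).norm.measurable.log)).max measurable_const

lemma greenKernel_symm (z w : ℂ) : greenKernel z w = greenKernel w z := by
  have h1 : ‖1 - (starRingEnd ℂ) w * z‖ = ‖1 - (starRingEnd ℂ) z * w‖ := by
    rw [← Complex.norm_conj]
    simp [mul_comm]
  rw [greenKernel, greenKernel, h1, norm_sub_rev z w]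

/-- This identity gives both positivity of the Green kernel in the disk and its decay as z
approaches the circle. -/
lemma norm_sq_one_sub_conj_mul (z w : ℂ) :
    ‖1 - (starRingEnd ℂ) w * z‖ ^ 2 = ‖z - w‖ ^ 2 + (1 - ‖z‖ ^ 2) * (1 - ‖w‖ ^ 2) := by
  simp only [Complex.sq_norm, Complex.normSq_apply]
  simp
  ring

lemma one_sub_conj_mul_ne_zero {z w : ℂ} (hz : ‖z‖ ≤ 1) (hw : ‖w‖ < 1) :
    1 - (starRingEnd ℂ) w * z ≠ 0 := by
  intro h
  have h1 : ‖(starRingEnd ℂ) w * z‖ = 1 := by rw [← sub_eq_zero.1 h, norm_one]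
  rw [norm_mul, Complex.norm_conj] at h1
  nlinarith [norm_nonneg z, norm_nonneg w]

lemma greenKernel_eq {z w : ℂ} (hz : ‖z‖ < 1) (hw : ‖w‖ < 1) (hzw : z ≠ w) :
    greenKernel z w = Real.log ‖1 - (starRingEnd ℂ) w * z‖ - Real.log ‖z - w‖ := by
  refine max_eq_left (sub_nonneg.2 (Real.log_le_log (norm_pos_iff.2 (sub_ne_zero.2 hzw)) ?_))
  refine le_of_sq_le_sq ?_ (norm_nonneg _)
  rw [norm_sq_one_sub_conj_mul]
  have h1 : 0 ≤ 1 - ‖z‖ ^ 2 := by nlinarith [norm_nonneg z]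
  have h2 : 0 ≤ 1 - ‖w‖ ^ 2 := by nlinarith [norm_nonneg w]
  nlinarith [mul_nonneg h1 h2]

/-- The identity for |1 - w̄z|² gives |1 - w̄z| ≤ |z - w| + √(1 - |z|²), and log x ≤ x - 1
concludes. The factor √(1 - |z|²) makes potentials of bounded densities vanish uniformly at the
circle. -/
lemma greenKernel_le {z w : ℂ} (hz : ‖z‖ < 1) (hw : ‖w‖ < 1) (hzw : z ≠ w) :
    greenKernel z w ≤ √(1 - ‖z‖ ^ 2) * ‖z - w‖⁻¹ := by
  have hd : 0 < ‖z - w‖ := norm_pos_iff.2 (sub_ne_zero.2 hzw)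
  have hn : 0 < ‖1 - (starRingEnd ℂ) w * z‖ := norm_pos_iff.2 (one_sub_conj_mul_ne_zero hz.le hw)
  have h1 : 0 ≤ 1 - ‖z‖ ^ 2 := by nlinarith [norm_nonneg z]
  have h2 : ‖1 - (starRingEnd ℂ) w * z‖ ≤ ‖z - w‖ + √(1 - ‖z‖ ^ 2) := by
    refine le_of_sq_le_sq ?_ (by positivity)
    rw [norm_sq_one_sub_conj_mul, add_sq, Real.sq_sqrt h1]
    have h3 : 0 ≤ 2 * ‖z - w‖ * √(1 - ‖z‖ ^ 2) := by positivity
    nlinarith [sq_nonneg ‖w‖]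
  rw [greenKernel_eq hz hw hzw, ← Real.log_div hn.ne' hd.ne']
  refine (Real.log_le_sub_one_of_pos (by positivity)).trans ?_
  rw [← div_eq_mul_inv, le_div_iff₀ hd, sub_mul, div_mul_cancel₀ _ hd.ne']
  linarith

/-- An upper bound for the integral of the Green kernel over the disk. -/
noncomputable def greenBound : ℝ := ∫ z in Metric.closedBall (0 : ℂ) 2, ‖z‖⁻¹

lemma greenBound_nonneg : 0 ≤ greenBound := integral_nonneg fun z => by positivity

lemma integrableOn_inv_norm_sub {z : ℂ} (hz : ‖z‖ < 1) :
    IntegrableOn (fun w => ‖z - w‖⁻¹) (Metric.ball 0 1) ∧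
    ∫ w in Metric.ball (0 : ℂ) 1, ‖z - w‖⁻¹ ≤ greenBound := by
  have hmp := Measure.measurePreserving_sub_left (volume : Measure ℂ) z
  have hi : Integrable ((Metric.closedBall (0 : ℂ) 2).indicator fun w => ‖w‖⁻¹) :=
    (integrable_indicator_iff Metric.isClosed_closedBall.measurableSet).2 (integrableOn_inv_norm 2)
  have hi2 : Integrable (fun w => (Metric.closedBall (0 : ℂ) 2).indicator (fun w => ‖w‖⁻¹) (z - w)) :=
    hmp.integrable_comp_of_integrable hi
  have heq : ∀ w ∈ Metric.ball (0 : ℂ) 1,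
      (Metric.closedBall (0 : ℂ) 2).indicator (fun w => ‖w‖⁻¹) (z - w) = ‖z - w‖⁻¹ := fun w hw => by
    refine indicator_of_mem (mem_closedBall_zero_iff.2 ?_) _
    have := mem_ball_zero_iff.1 hw
    exact (norm_sub_le z w).trans (by linarith)
  constructor
  · exact (hi2.integrableOn).congr_fun heq Metric.isOpen_ball.measurableSet
  · rw [← setIntegral_congr_fun Metric.isOpen_ball.measurableSet heq]
    refine (setIntegral_le_integral hi2 (ae_of_all _ fun w => ?_)).trans (le_of_eq ?_)
    · exact indicator_nonneg (fun w _ => by positivity) _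
    · rw [integral_sub_left_eq_self (fun w => (Metric.closedBall (0 : ℂ) 2).indicator
        (fun w => ‖w‖⁻¹) w) volume z, integral_indicator Metric.isClosed_closedBall.measurableSet]
      rfl

lemma integrableOn_greenKernel {z : ℂ} (hz : ‖z‖ < 1) :
    IntegrableOn (greenKernel z) (Metric.ball 0 1) ∧
    ∫ w in Metric.ball (0 : ℂ) 1, greenKernel z w ≤ √(1 - ‖z‖ ^ 2) * greenBound := by
  obtain ⟨h1, h2⟩ := integrableOn_inv_norm_sub hz
  have hle : ∀ᵐ w ∂volume.restrict (Metric.ball (0 : ℂ) 1),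
      greenKernel z w ≤ √(1 - ‖z‖ ^ 2) * ‖z - w‖⁻¹ := by
    filter_upwards [ae_restrict_mem Metric.isOpen_ball.measurableSet,
      Measure.ae_ne (volume.restrict (Metric.ball (0 : ℂ) 1)) z] with w hw hwz
    exact greenKernel_le hz (mem_ball_zero_iff.1 hw) hwz.symm
  have hm : AEStronglyMeasurable (greenKernel z) (volume.restrict (Metric.ball (0 : ℂ) 1)) :=
    (measurable_greenKernel.comp measurable_prodMk_left).aestronglyMeasurable
  have hi : IntegrableOn (greenKernel z) (Metric.ball 0 1) :=
    Integrable.mono' (h1.const_mul (√(1 - ‖z‖ ^ 2))) hm (hle.mono fun w hw => by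
      rwa [Real.norm_of_nonneg (greenKernel_nonneg _ _)])
  refine ⟨hi, (integral_mono_ae hi (h1.const_mul _) hle).trans ?_⟩
  rw [integral_const_mul]
  exact mul_le_mul_of_nonneg_left h2 (Real.sqrt_nonneg _)

/-- The Green kernel is the fundamental solution of the Laplacian in the disk. -/
lemma setIntegral_greenKernel_mul_laplacian {w : ℂ} (hw : ‖w‖ < 1) {φ : ℂ → ℝ}
    (hφ : IsDiskTestFunction φ) :
    ∫ z in Metric.ball (0 : ℂ) 1, greenKernel z w * Laplacian.laplacian φ z =
      -(2 * Real.pi * φ w) := by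
  have hharm : ∀ z ∈ Metric.ball (0 : ℂ) 1,
      InnerProductSpace.HarmonicAt (fun z => Real.log ‖1 - (starRingEnd ℂ) w * z‖) z := fun z hz =>
    AnalyticAt.harmonicAt_log_norm (f := fun z => 1 - (starRingEnd ℂ) w * z) (by fun_prop)
      (one_sub_conj_mul_ne_zero (mem_ball_zero_iff.1 hz).le hw)
  have h1 : ∫ z in Metric.ball (0 : ℂ) 1,
      Real.log ‖1 - (starRingEnd ℂ) w * z‖ * Laplacian.laplacian φ z = 0 := by
    rw [hφ.setIntegral_mul_laplacian fun z hz => (hharm z hz).1]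
    refine (setIntegral_congr_fun Metric.isOpen_ball.measurableSet
      (g := fun _ => (0 : ℝ)) fun z hz => ?_).trans (by simp)
    simp only []
    rw [(hharm z hz).2.self_of_nhds]
    simp
  have hlog : LocallyIntegrable fun z : ℂ => Real.log ‖z - w‖ := by
    intro x
    obtain ⟨s, hs, hi⟩ := locallyIntegrable_log_norm (x - w)
    have hmp := measurePreserving_sub_right (volume : Measure ℂ) w
    refine ⟨(fun z => z - w) ⁻¹' s, (continuous_sub_right w).continuousAt hs, ?_⟩
    exact (hmp.integrableOn_comp_preimage (Homeomorph.subRight w).measurableEmbedding).2 hi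
  have h2 : ∫ z in Metric.ball (0 : ℂ) 1, Real.log ‖z - w‖ * Laplacian.laplacian φ z =
      2 * Real.pi * φ w := by
    rw [setIntegral_eq_integral_of_forall_compl_eq_zero fun z hz => by
      rw [laplacian_eq_zero_of_notMem fun h => hz (hφ.2.2 h), mul_zero]]
    have hc : HasCompactSupport fun z => φ (z + w) :=
      hφ.2.1.comp_homeomorph (Homeomorph.addRight w)
    have h3 := integral_log_norm_mul_laplacian (φ := fun z => φ (z + w))
      (hφ.contDiff_two.comp (contDiff_id.add contDiff_const) : ContDiff ℝ 2 fun z => φ (z + w)) hc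
    rw [zero_add] at h3
    rw [← h3, ← integral_sub_right_eq_self
      (fun z => Real.log ‖z‖ * Laplacian.laplacian (fun z => φ (z + w)) z) w]
    refine integral_congr_ae (ae_of_all _ fun z => ?_)
    simp only []
    rw [← laplacian_comp_sub_const (fun z => φ (z + w))]
    simp
  have i1 : IntegrableOn (fun z => Real.log ‖1 - (starRingEnd ℂ) w * z‖ * Laplacian.laplacian φ z)
      (Metric.ball 0 1) :=
    hφ.integrableOn_mul_laplacian (ContinuousOn.locallyIntegrableOn
      (fun z hz => (hharm z hz).1.continuousAt.continuousWithinAt) Metric.isOpen_ball.measurableSet)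
  have i2 := hφ.integrableOn_mul_laplacian (hlog.locallyIntegrableOn (Metric.ball 0 1))
  have h4 : ∫ z in Metric.ball (0 : ℂ) 1, greenKernel z w * Laplacian.laplacian φ z =
      ∫ z in Metric.ball (0 : ℂ) 1, (Real.log ‖1 - (starRingEnd ℂ) w * z‖ *
        Laplacian.laplacian φ z - Real.log ‖z - w‖ * Laplacian.laplacian φ z) := by
    refine integral_congr_ae ?_
    filter_upwards [ae_restrict_mem Metric.isOpen_ball.measurableSet,
      Measure.ae_ne (volume.restrict (Metric.ball (0 : ℂ) 1)) w] with z hz hzw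
    rw [greenKernel_eq (mem_ball_zero_iff.1 hz) hw hzw, sub_mul]
  rw [h4, integral_sub i1 i2, h1, h2, zero_sub]

/-- By the mean value property the harmonic part log |1 - w̄z| has circle mean log 1 = 0. The mean
of log |z - w| is log r + log⁺(|w|/r) ≥ log r. -/
lemma greenKernel_circle {w : ℂ} (hw : ‖w‖ < 1) {r : ℝ} (hr0 : 0 < r) (hr1 : r < 1) :
    CircleIntegrable (fun z => greenKernel z w) 0 r ∧
    ∫ θ in (0 : ℝ)..(2 * Real.pi), greenKernel (circleMap 0 r θ) w ≤
      2 * Real.pi * -Real.log r := by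
  have hharm : InnerProductSpace.HarmonicOnNhd (fun z => Real.log ‖1 - (starRingEnd ℂ) w * z‖)
      (Metric.closedBall 0 |r|) := fun z hz => by
    rw [abs_of_pos hr0, mem_closedBall_zero_iff] at hz
    exact AnalyticAt.harmonicAt_log_norm (f := fun z => 1 - (starRingEnd ℂ) w * z) (by fun_prop)
      (one_sub_conj_mul_ne_zero (hz.trans hr1.le) hw)
  have a1 := InnerProductSpace.HarmonicOnNhd.circleAverage_eq hharm
  have a2 := circleAverage_log_norm_sub_const_eq_log_radius_add_posLog (a := w) (c := 0) hr0.ne'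
  have i1 : CircleIntegrable (fun z => Real.log ‖1 - (starRingEnd ℂ) w * z‖) 0 r :=
    ContinuousOn.circleIntegrable hr0.le fun z hz =>
      (hharm z (by
        rw [abs_of_pos hr0]
        exact Metric.sphere_subset_closedBall hz)).1.continuousAt.continuousWithinAt
  have i2 : CircleIntegrable (fun z => Real.log ‖z - w‖) 0 r :=
    circleIntegrable_log_norm_sub_const r
  have hae : ∀ᵐ θ : ℝ, greenKernel (circleMap 0 r θ) w =
      Real.log ‖1 - (starRingEnd ℂ) w * circleMap 0 r θ‖ - Real.log ‖circleMap 0 r θ - w‖ := by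
    have hcount : (circleMap 0 r ⁻¹' {w}).Countable :=
      (countable_singleton w).preimage_circleMap 0 hr0.ne'
    filter_upwards [hcount.ae_notMem volume] with θ hθ
    refine greenKernel_eq ?_ hw hθ
    rwa [norm_circleMap_zero, abs_of_pos hr0]
  have i3 := i1.sub i2
  have hi : CircleIntegrable (fun z => greenKernel z w) 0 r := by
    refine IntervalIntegrable.congr_ae i3 (ae_restrict_of_ae (hae.mono fun θ hθ => ?_))
    simp [hθ]
  refine ⟨hi, ?_⟩
  rw [intervalIntegral.integral_congr_ae (hae.mono fun θ hθ _ => hθ),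
    intervalIntegral.integral_sub i1 i2]
  rw [Real.circleAverage_def, smul_eq_mul] at a1 a2
  simp only [mul_zero, sub_zero, norm_one, Real.log_one] at a1
  have hpi := Real.two_pi_pos
  have b1 : ∫ θ in (0 : ℝ)..(2 * Real.pi),
      Real.log ‖1 - (starRingEnd ℂ) w * circleMap 0 r θ‖ = 0 := by
    rcases mul_eq_zero.1 a1 with h | h
    · exact absurd h (by positivity)
    · exact h
  have b2 : ∫ θ in (0 : ℝ)..(2 * Real.pi), Real.log ‖circleMap 0 r θ - w‖ =
      2 * Real.pi * (Real.log r + Real.posLog (r⁻¹ * ‖0 - w‖)) := by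
    rw [← a2, ← mul_assoc, mul_inv_cancel₀ hpi.ne', one_mul]
  rw [b1, b2]
  have : 0 ≤ Real.posLog (r⁻¹ * ‖0 - w‖) := Real.posLog_nonneg
  nlinarith

attribute [irreducible] greenKernel

/-! ### Green potentials of finite measures. -/

/-- The Green potential of a measure in the disk. -/
noncomputable def greenPotential (μ : Measure ℂ) (z : ℂ) : ℝ := ∫ w, greenKernel z w ∂μ

lemma greenPotential_nonneg (μ : Measure ℂ) (z : ℂ) : 0 ≤ greenPotential μ z :=
  integral_nonneg fun _ => greenKernel_nonneg _ _

lemma measurable_greenPotential (μ : Measure ℂ) [IsFiniteMeasure μ] :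
    Measurable (greenPotential μ) :=
  (measurable_greenKernel.stronglyMeasurable.integral_prod_right).measurable

/-- By symmetry of the kernel, its integral in `z` over the disk is bounded by `greenBound`
uniformly in `w`, and `μ` is finite. -/
lemma integrable_greenKernel_prod {μ : Measure ℂ} [IsFiniteMeasure μ]
    (hμ : ∀ᵐ w ∂μ, w ∈ Metric.ball (0 : ℂ) 1) :
    Integrable (Function.uncurry greenKernel)
      ((volume.restrict (Metric.ball (0 : ℂ) 1)).prod μ) := by
  rw [integrable_prod_iff' measurable_greenKernel.aestronglyMeasurable]
  have hsymm : ∀ w, (fun z => Function.uncurry greenKernel (z, w)) = greenKernel w := fun w =>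
    funext fun z => greenKernel_symm z w
  constructor
  · filter_upwards [hμ] with w hw
    rw [hsymm]
    exact (integrableOn_greenKernel (mem_ball_zero_iff.1 hw)).1
  · have hm : AEStronglyMeasurable (fun w => ∫ z in Metric.ball (0 : ℂ) 1,
        ‖Function.uncurry greenKernel (z, w)‖) μ :=
      (measurable_greenKernel.norm.stronglyMeasurable.integral_prod_left').aestronglyMeasurable
    refine Integrable.of_bound hm greenBound ?_
    filter_upwards [hμ] with w hw
    rw [Real.norm_of_nonneg (integral_nonneg fun _ => norm_nonneg _)]
    have h1 := (integrableOn_greenKernel (mem_ball_zero_iff.1 hw)).2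
    have h2 : √(1 - ‖w‖ ^ 2) ≤ 1 := Real.sqrt_le_one.2 (by nlinarith [sq_nonneg ‖w‖])
    calc ∫ z in Metric.ball (0 : ℂ) 1, ‖Function.uncurry greenKernel (z, w)‖
        = ∫ z in Metric.ball (0 : ℂ) 1, greenKernel w z := by
          refine integral_congr_ae (ae_of_all _ fun z => ?_)
          simp only [Function.uncurry_apply_pair, greenKernel_symm z w,
            Real.norm_of_nonneg (greenKernel_nonneg w z)]
      _ ≤ greenBound := h1.trans (mul_le_of_le_one_left greenBound_nonneg h2)

lemma integrableOn_greenPotential {μ : Measure ℂ} [IsFiniteMeasure μ]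
    (hμ : ∀ᵐ w ∂μ, w ∈ Metric.ball (0 : ℂ) 1) :
    IntegrableOn (greenPotential μ) (Metric.ball 0 1) :=
  (integrable_greenKernel_prod hμ).integral_prod_left

/-- The Green potential of `μ` solves `ΔG = -2πμ` in the sense of distributions. -/
lemma setIntegral_greenPotential_mul_laplacian {μ : Measure ℂ} [IsFiniteMeasure μ]
    (hμ : ∀ᵐ w ∂μ, w ∈ Metric.ball (0 : ℂ) 1) {φ : ℂ → ℝ} (hφ : IsDiskTestFunction φ) :
    ∫ z in Metric.ball (0 : ℂ) 1, greenPotential μ z * Laplacian.laplacian φ z =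
      -(2 * Real.pi * ∫ w, φ w ∂μ) := by
  have hΔc := continuous_laplacian hφ.contDiff_two
  obtain ⟨C, -, hC⟩ := exists_abs_le_of_hasCompactSupport hΔc hφ.hasCompactSupport_laplacian
  have hi : Integrable (Function.uncurry fun z w => greenKernel z w * Laplacian.laplacian φ z)
      ((volume.restrict (Metric.ball (0 : ℂ) 1)).prod μ) :=
    (integrable_greenKernel_prod hμ).mul_bdd (c := C)
      (hΔc.comp continuous_fst).aestronglyMeasurable (ae_of_all _ fun p => hC _)
  have h1 := integral_integral_swap hi
  simp_rw [integral_mul_const] at h1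
  change ∫ z in Metric.ball (0 : ℂ) 1, (∫ w, greenKernel z w ∂μ) * Laplacian.laplacian φ z = _
  rw [h1, ← integral_const_mul, ← integral_neg]
  refine integral_congr_ae ?_
  filter_upwards [hμ] with w hw
  exact setIntegral_greenKernel_mul_laplacian (mem_ball_zero_iff.1 hw) hφ

lemma greenPotential_circle {μ : Measure ℂ} [IsFiniteMeasure μ]
    (hμ : ∀ᵐ w ∂μ, w ∈ Metric.ball (0 : ℂ) 1) {r : ℝ} (hr0 : 0 < r) (hr1 : r < 1) :
    CircleIntegrable (greenPotential μ) 0 r ∧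
    ∫ θ in (0 : ℝ)..(2 * Real.pi), greenPotential μ (circleMap 0 r θ) ≤
      μ.real univ * (2 * Real.pi * -Real.log r) := by
  have hpair : Measurable fun p : ℝ × ℂ => (circleMap 0 r p.1, p.2) :=
    ((continuous_circleMap 0 r).measurable.comp measurable_fst).prodMk measurable_snd
  have hmeas : Measurable (Function.uncurry fun (θ : ℝ) w => greenKernel (circleMap 0 r θ) w) :=
    measurable_greenKernel.comp hpair
  have hi : Integrable (Function.uncurry fun (θ : ℝ) w => greenKernel (circleMap 0 r θ) w)
      ((volume.restrict (Ioc 0 (2 * Real.pi))).prod μ) := by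
    rw [integrable_prod_iff' hmeas.aestronglyMeasurable]
    constructor
    · filter_upwards [hμ] with w hw
      have := (greenKernel_circle (mem_ball_zero_iff.1 hw) hr0 hr1).1
      rwa [CircleIntegrable, intervalIntegrable_iff_integrableOn_Ioc_of_le Real.two_pi_pos.le]
        at this
    · refine Integrable.of_bound
        hmeas.norm.stronglyMeasurable.integral_prod_left'.aestronglyMeasurable
        (2 * Real.pi * -Real.log r) ?_
      filter_upwards [hμ] with w hw
      have := (greenKernel_circle (mem_ball_zero_iff.1 hw) hr0 hr1).2
      rw [intervalIntegral.integral_of_le Real.two_pi_pos.le] at this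
      rw [Real.norm_of_nonneg (integral_nonneg fun _ => norm_nonneg _)]
      simpa only [Function.uncurry_apply_pair, Real.norm_of_nonneg (greenKernel_nonneg _ _)]
  constructor
  · rw [CircleIntegrable, intervalIntegrable_iff_integrableOn_Ioc_of_le Real.two_pi_pos.le]
    exact hi.integral_prod_left
  · rw [intervalIntegral.integral_of_le Real.two_pi_pos.le]
    have h1 := integral_integral_swap hi
    change ∫ θ in Ioc 0 (2 * Real.pi), ∫ w, greenKernel (circleMap 0 r θ) w ∂μ ≤ _
    rw [h1]
    refine (integral_mono_ae (g := fun _ => 2 * Real.pi * -Real.log r) hi.integral_prod_right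
      (integrable_const _) ?_).trans (by simp)
    filter_upwards [hμ] with w hw
    have := (greenKernel_circle (mem_ball_zero_iff.1 hw) hr0 hr1).2
    rwa [intervalIntegral.integral_of_le Real.two_pi_pos.le] at this

/-- The potential is nonnegative, so its pairing with `g` is at most ‖g‖ times its integral over the
circle, which is bounded by the mass times -2π log r. -/
lemma hasWeakBoundaryValues_greenPotential {μ : Measure ℂ} [IsFiniteMeasure μ]
    (hμ : ∀ᵐ w ∂μ, w ∈ Metric.ball (0 : ℂ) 1) :
    HasWeakBoundaryValues (greenPotential μ) fun _ => 0 := by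
  have hev : ∀ᶠ r : ℝ in 𝓝[<] 1, 0 < r ∧ r < 1 :=
    Filter.Eventually.and (mem_nhdsWithin_of_mem_nhds (lt_mem_nhds one_pos)) self_mem_nhdsWithin
  refine ⟨hev.mono fun r hr => (greenPotential_circle hμ hr.1 hr.2).1, fun g => ?_⟩
  simp only [mul_zero, intervalIntegral.integral_zero]
  have hlog : Tendsto (fun r : ℝ => ‖g‖ * (μ.real univ * (2 * Real.pi * -Real.log r)))
      (𝓝[<] 1) (𝓝 0) := by
    have h1 : Tendsto (fun r : ℝ => Real.log r) (𝓝[<] 1) (𝓝 0) := by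
      have := (Real.continuousAt_log one_ne_zero).tendsto
      rw [Real.log_one] at this
      exact this.mono_left nhdsWithin_le_nhds
    simpa using ((h1.neg.const_mul (2 * Real.pi)).const_mul (μ.real univ)).const_mul ‖g‖
  refine squeeze_zero_norm' (hev.mono fun r hr => ?_) hlog
  obtain ⟨h1, h2⟩ := greenPotential_circle hμ hr.1 hr.2
  refine le_trans ?_ (mul_le_mul_of_nonneg_left h2 (norm_nonneg g))
  rw [← intervalIntegral.integral_const_mul]
  refine intervalIntegral.norm_integral_le_of_norm_le Real.two_pi_pos.le
    (ae_of_all _ fun θ _ => ?_) (IntervalIntegrable.const_mul h1 _)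
  rw [norm_mul, Real.norm_of_nonneg (greenPotential_nonneg _ _)]
  exact mul_le_mul_of_nonneg_right (g.norm_coe_le_norm _) (greenPotential_nonneg _ _)

/-- The measure on the disk with density `g`. -/
noncomputable def diskDensity (g : ℂ → ℝ) : Measure ℂ :=
  (volume.restrict (Metric.ball (0 : ℂ) 1)).withDensity fun z => ENNReal.ofReal (g z)

lemma ae_diskDensity_mem (g : ℂ → ℝ) : ∀ᵐ w ∂diskDensity g, w ∈ Metric.ball (0 : ℂ) 1 :=
  (withDensity_absolutelyContinuous _ _).ae_le (ae_restrict_mem Metric.isOpen_ball.measurableSet)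

lemma integral_diskDensity {g : ℂ → ℝ} (hg : Measurable g) (hg0 : ∀ z, 0 ≤ g z) (φ : ℂ → ℝ) :
    ∫ z, φ z ∂diskDensity g = ∫ z in Metric.ball (0 : ℂ) 1, g z * φ z := by
  rw [diskDensity, integral_withDensity_eq_integral_toReal_smul hg.ennreal_ofReal
    (ae_of_all _ fun _ => ENNReal.ofReal_lt_top)]
  simp [ENNReal.toReal_ofReal (hg0 _)]

lemma isFiniteMeasure_diskDensity {g : ℂ → ℝ} {C : ℝ} (hC : ∀ z, g z ≤ C) :
    IsFiniteMeasure (diskDensity g) := by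
  refine isFiniteMeasure_withDensity (ne_of_lt ?_)
  refine (lintegral_mono fun z => ENNReal.ofReal_le_ofReal (hC z)).trans_lt ?_
  rw [lintegral_const, Measure.restrict_apply_univ]
  exact ENNReal.mul_lt_top ENNReal.ofReal_lt_top measure_ball_lt_top

lemma greenPotential_diskDensity_le {g : ℂ → ℝ} (hg : Measurable g) (hg0 : ∀ z, 0 ≤ g z) {C : ℝ}
    (hC : ∀ z, g z ≤ C) {z : ℂ} (hz : ‖z‖ < 1) :
    greenPotential (diskDensity g) z ≤ C * (√(1 - ‖z‖ ^ 2) * greenBound) := by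
  obtain ⟨h1, h2⟩ := integrableOn_greenKernel hz
  rw [greenPotential, integral_diskDensity hg hg0]
  refine le_trans ?_ (mul_le_mul_of_nonneg_left h2 ((hg0 0).trans (hC 0)))
  rw [← integral_const_mul]
  refine integral_mono_of_nonneg (ae_of_all _ fun w => mul_nonneg (hg0 w) (greenKernel_nonneg _ _))
    (h1.const_mul C) (ae_of_all _ fun w => ?_)
  exact mul_le_mul_of_nonneg_right (hC w) (greenKernel_nonneg _ _)

/-! ### The Poisson integral. -/

/-- The Poisson integral of a function on the circle. -/
noncomputable def poissonExtension (h : Circle → ℝ) (z : ℂ) : ℝ :=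
  (Real.circleAverage (fun ζ => herglotzRieszKernel 0 z ζ • ((h (Circle.exp ζ.arg) : ℝ) : ℂ))
    0 1).re

lemma circleMap_zero_one (θ : ℝ) : circleMap 0 1 θ = (Circle.exp θ : ℂ) := by
  simp [circleMap_zero, Circle.coe_exp]

lemma exp_arg_circleMap (θ : ℝ) : Circle.exp (circleMap 0 1 θ).arg = Circle.exp θ := by
  rw [circleMap_zero_one, Circle.exp_arg]

lemma circleIntegrable_exp_arg {h : Circle → ℝ}
    (hh : IntervalIntegrable (fun θ : ℝ => h (Circle.exp θ)) volume 0 (2 * Real.pi)) :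
    CircleIntegrable (fun ζ => h (Circle.exp ζ.arg)) 0 1 := by
  simpa only [CircleIntegrable, exp_arg_circleMap] using hh

lemma poissonKernel_nonneg_of_lt {r θ t : ℝ} (hr0 : 0 ≤ r) (hr1 : r < 1) :
    0 ≤ poissonKernel 0 (circleMap 0 r θ) (circleMap 0 1 t) := by
  rw [poissonKernel_def]
  simp only [sub_zero, norm_circleMap_zero, abs_of_nonneg hr0, abs_one]
  refine div_nonneg ?_ (by positivity)
  nlinarith

/-- The Herglotz-Riesz form exhibits the extension as the real part of an analytic function, hence
harmonic; the Poisson form obtained here serves for estimates. -/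
lemma poissonExtension_eq {h : Circle → ℝ}
    (hh : IntervalIntegrable (fun θ : ℝ => h (Circle.exp θ)) volume 0 (2 * Real.pi)) {z : ℂ}
    (hz : ‖z‖ < 1) :
    poissonExtension h z = (2 * Real.pi)⁻¹ *
      ∫ θ in (0 : ℝ)..(2 * Real.pi), poissonKernel 0 z (circleMap 0 1 θ) * h (Circle.exp θ) := by
  rw [poissonExtension, re_circleAverage_herglotzRieszKernel_smul (circleIntegrable_exp_arg hh)
    (mem_ball_zero_iff.2 hz), ← poissonKernel_eq_re_herglotzRieszKernel, Real.circleAverage_def]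
  simp only [Pi.smul_apply', smul_eq_mul, exp_arg_circleMap]

lemma harmonicAt_poissonExtension {h : Circle → ℝ}
    (hh : IntervalIntegrable (fun θ : ℝ => h (Circle.exp θ)) volume 0 (2 * Real.pi)) {z : ℂ}
    (hz : z ∈ Metric.ball (0 : ℂ) 1) : InnerProductSpace.HarmonicAt (poissonExtension h) z := by
  have hi : CircleIntegrable (fun ζ => ((h (Circle.exp ζ.arg) : ℝ) : ℂ)) 0 1 := by
    have := circleIntegrable_exp_arg hh
    simp only [CircleIntegrable, intervalIntegrable_iff] at this ⊢
    exact Complex.ofRealCLM.integrable_comp this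
  exact AnalyticAt.harmonicAt_re (analyticOnNhd_circleAverage_herglotzRieszKernel_smul hi z hz)

lemma integral_poissonKernel {z : ℂ} (hz : ‖z‖ < 1) :
    ∫ θ in (0 : ℝ)..(2 * Real.pi), poissonKernel 0 z (circleMap 0 1 θ) = 2 * Real.pi := by
  have h := InnerProductSpace.HarmonicOnNhd.circleAverage_poissonKernel_smul (c := 0) (R := 1)
    (f := fun _ : ℂ => (1 : ℝ)) (w := z) (fun _ _ => InnerProductSpace.harmonicAt_const _)
    (mem_ball_zero_iff.2 hz)
  rw [Real.circleAverage_def] at h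
  simp only [Pi.smul_apply', smul_eq_mul, mul_one] at h
  have hpi := Real.two_pi_pos.ne'
  rwa [inv_mul_eq_one₀ hpi, eq_comm] at h

lemma continuous_poissonKernel_circle {z : ℂ} (hz : ‖z‖ < 1) :
    Continuous fun θ : ℝ => poissonKernel 0 z (circleMap 0 1 θ) := by
  simp only [poissonKernel_def]
  refine Continuous.div (by fun_prop) (by fun_prop) fun θ => ?_
  have : circleMap 0 1 θ ≠ z := fun h => by
    have := norm_circleMap_zero 1 θ
    rw [h, abs_one] at this
    linarith
  simpa [sub_eq_zero] using this

lemma exists_circleMap_eq (z : ℂ) : circleMap 0 ‖z‖ z.arg = z := by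
  rw [circleMap_zero, Complex.norm_mul_exp_arg_mul_I]

lemma abs_poissonExtension_le {h : Circle → ℝ}
    (hh : IntervalIntegrable (fun θ : ℝ => h (Circle.exp θ)) volume 0 (2 * Real.pi)) {M : ℝ}
    (hM : ∀ᵐ θ ∂(volume.restrict (Ioc 0 (2 * Real.pi))), |h (Circle.exp θ)| ≤ M) {z : ℂ}
    (hz : ‖z‖ < 1) : |poissonExtension h z| ≤ M := by
  have hpi := Real.two_pi_pos
  have hP : ∀ t, 0 ≤ poissonKernel 0 z (circleMap 0 1 t) := fun t => by
    rw [← exists_circleMap_eq z]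
    exact poissonKernel_nonneg_of_lt (norm_nonneg z) hz
  rw [poissonExtension_eq hh hz, abs_mul, abs_of_pos (inv_pos.2 hpi), inv_mul_le_iff₀ hpi]
  have h1 := intervalIntegral.norm_integral_le_of_norm_le
    (f := fun θ => poissonKernel 0 z (circleMap 0 1 θ) * h (Circle.exp θ))
    (g := fun θ => poissonKernel 0 z (circleMap 0 1 θ) * M) (μ := volume) hpi.le (by
      filter_upwards [(ae_restrict_iff' measurableSet_Ioc).1 hM] with θ hθ hmem
      rw [norm_mul, Real.norm_of_nonneg (hP θ)]
      exact mul_le_mul_of_nonneg_left (hθ hmem) (hP θ))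
    (((continuous_poissonKernel_circle hz).mul continuous_const).intervalIntegrable _ _)
  rwa [intervalIntegral.integral_mul_const, integral_poissonKernel hz] at h1

lemma poissonKernel_circle_symm (r θ t : ℝ) :
    poissonKernel 0 (circleMap 0 r θ) (circleMap 0 1 t) =
      poissonKernel 0 (circleMap 0 r t) (circleMap 0 1 θ) := by
  have h : ∀ a b : ℝ, ‖circleMap 0 1 a - circleMap 0 r b‖ ^ 2 =
      1 + r ^ 2 - 2 * r * (Real.cos a * Real.cos b + Real.sin a * Real.sin b) := fun a b => by
    rw [Complex.sq_norm, Complex.normSq_apply]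
    simp only [circleMap_zero, Complex.sub_re, Complex.sub_im, Complex.mul_re, Complex.mul_im,
      Complex.ofReal_re, Complex.ofReal_im, Complex.exp_ofReal_mul_I_re,
      Complex.exp_ofReal_mul_I_im]
    have h1 := Real.sin_sq_add_cos_sq a
    have h2 := Real.sin_sq_add_cos_sq b
    linear_combination h1 + r ^ 2 * h2
  rw [poissonKernel_def, poissonKernel_def]
  simp only [sub_zero, norm_circleMap_zero, h]
  congr 1
  ring

/-- The Poisson integral of a continuous function has radial limits. -/
lemma tendsto_poisson_radial (g : C(Circle, ℝ)) (t : ℝ) :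
    Tendsto (fun r : ℝ => (2 * Real.pi)⁻¹ * ∫ θ in (0 : ℝ)..(2 * Real.pi),
      poissonKernel 0 (circleMap 0 r t) (circleMap 0 1 θ) * g (Circle.exp θ)) (𝓝[<] 1)
      (𝓝 (g (Circle.exp t))) := by
  have hpi := Real.two_pi_pos
  rw [Metric.tendsto_nhds]
  intro ε hε
  obtain ⟨δ, hδ, hgδ⟩ := Metric.continuousAt_iff.1
    (g.continuous.continuousAt (x := Circle.exp t)) (ε / 2) (by positivity)
  have hev : ∀ᶠ r : ℝ in 𝓝[<] 1, (0 < r ∧ 1 - δ / 2 < r) ∧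
      2 * ‖g‖ * ((1 - r ^ 2) / (δ / 2) ^ 2) < ε / 2 := by
    refine Filter.Eventually.and (Filter.Eventually.and ?_ ?_) ?_
    · exact mem_nhdsWithin_of_mem_nhds (lt_mem_nhds one_pos)
    · exact mem_nhdsWithin_of_mem_nhds (lt_mem_nhds (by linarith))
    · have hc : ContinuousAt (fun r : ℝ => 2 * ‖g‖ * ((1 - r ^ 2) / (δ / 2) ^ 2)) 1 := by fun_prop
      have := hc.tendsto.mono_left (nhdsWithin_le_nhds (s := Iio 1))
      simp only [one_pow, sub_self, zero_div, mul_zero] at this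
      exact this.eventually_lt_const (by positivity)
  filter_upwards [hev, self_mem_nhdsWithin] with r ⟨⟨hr0, hrδ⟩, hrε⟩ hr1
  have hr1 : r < 1 := hr1
  have hz : ‖circleMap 0 r t‖ < 1 := by rwa [norm_circleMap_zero, abs_of_pos hr0]
  have hPc := continuous_poissonKernel_circle hz
  have hgc : Continuous fun θ => g (Circle.exp θ) := g.continuous.comp Circle.exp.continuous
  have hP : ∀ θ, 0 ≤ poissonKernel 0 (circleMap 0 r t) (circleMap 0 1 θ) := fun θ =>
    poissonKernel_nonneg_of_lt hr0.le hr1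
  set P := fun θ => poissonKernel 0 (circleMap 0 r t) (circleMap 0 1 θ) with hPdef
  have e1 : (2 * Real.pi)⁻¹ * (∫ θ in (0 : ℝ)..(2 * Real.pi), P θ * g (Circle.exp θ)) -
      g (Circle.exp t) = (2 * Real.pi)⁻¹ * ∫ θ in (0 : ℝ)..(2 * Real.pi),
        P θ * (g (Circle.exp θ) - g (Circle.exp t)) := by
    have i1 : IntervalIntegrable (fun θ => P θ * g (Circle.exp θ)) volume 0 (2 * Real.pi) :=
      (hPc.mul hgc).intervalIntegrable _ _
    have i2 : IntervalIntegrable (fun θ => P θ * g (Circle.exp t)) volume 0 (2 * Real.pi) :=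
      (hPc.mul continuous_const).intervalIntegrable _ _
    simp only [mul_sub]
    rw [intervalIntegral.integral_sub i1 i2, intervalIntegral.integral_mul_const,
      hPdef, integral_poissonKernel hz, mul_sub, ← mul_assoc (2 * Real.pi)⁻¹ (2 * Real.pi),
      inv_mul_cancel₀ hpi.ne', one_mul]
  rw [Real.dist_eq, e1, abs_mul, abs_of_pos (inv_pos.2 hpi), inv_mul_lt_iff₀ hpi]
  -- Near e^{it}, continuity of `g` gives ε/2. Away from it, r > 1 - δ/2 keeps re^{it} at distance
  -- at least δ/2 from e^{iθ}, so the Poisson kernel is at most (1 - r²)/(δ/2)².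
  have hB : ∀ θ, ‖P θ * (g (Circle.exp θ) - g (Circle.exp t))‖ ≤
      P θ * (ε / 2) + 2 * ‖g‖ * ((1 - r ^ 2) / (δ / 2) ^ 2) := by
    intro θ
    rw [norm_mul, Real.norm_of_nonneg (hP θ)]
    have hc0 : 0 ≤ (1 - r ^ 2) / (δ / 2) ^ 2 := div_nonneg (by nlinarith) (by positivity)
    by_cases hd : dist (Circle.exp θ) (Circle.exp t) < δ
    · have h1 := (hgδ hd).le
      rw [Real.dist_eq] at h1
      have h2 := mul_le_mul_of_nonneg_left h1 (hP θ)
      have h3 : 0 ≤ 2 * ‖g‖ * ((1 - r ^ 2) / (δ / 2) ^ 2) := by positivity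
      exact h2.trans (by linarith)
    · have h1 : ‖g (Circle.exp θ) - g (Circle.exp t)‖ ≤ 2 * ‖g‖ := by
        have a := g.norm_coe_le_norm (Circle.exp θ)
        have b := g.norm_coe_le_norm (Circle.exp t)
        exact (norm_sub_le _ _).trans (by linarith)
      have h2 : P θ ≤ (1 - r ^ 2) / (δ / 2) ^ 2 := by
        simp only [hPdef, poissonKernel_def, sub_zero, norm_circleMap_zero, abs_one, one_pow,
          sq_abs]
        refine div_le_div_of_nonneg_left (by nlinarith) (by positivity) ?_
        refine pow_le_pow_left₀ (by positivity) ?_ 2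
        have h3 : δ ≤ ‖circleMap 0 1 θ - circleMap 0 1 t‖ := by
          rw [circleMap_zero_one, circleMap_zero_one, ← dist_eq_norm]
          exact not_lt.1 hd
        have h4 : ‖circleMap 0 r t - circleMap 0 1 t‖ = 1 - r := by
          have : circleMap 0 r t - circleMap 0 1 t = circleMap 0 (r - 1) t := by
            simp only [circleMap_zero]; push_cast; ring
          rw [this, norm_circleMap_zero, abs_of_neg (by linarith)]
          ring
        have h5 := norm_sub_le_norm_sub_add_norm_sub (circleMap 0 1 θ) (circleMap 0 r t)
          (circleMap 0 1 t)
        linarith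
      calc P θ * ‖g (Circle.exp θ) - g (Circle.exp t)‖
          ≤ (1 - r ^ 2) / (δ / 2) ^ 2 * (2 * ‖g‖) := mul_le_mul h2 h1 (norm_nonneg _) hc0
        _ ≤ _ := by have := mul_nonneg (hP θ) (half_pos hε).le; linarith
  have h6 := intervalIntegral.norm_integral_le_of_norm_le (μ := volume) hpi.le
    (ae_of_all _ fun θ _ => hB θ)
    (((hPc.mul continuous_const).add continuous_const).intervalIntegrable _ _)
  refine lt_of_le_of_lt h6 ?_
  have i3 : IntervalIntegrable (fun θ => P θ * (ε / 2)) volume 0 (2 * Real.pi) :=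
    (hPc.mul continuous_const).intervalIntegrable _ _
  rw [intervalIntegral.integral_add i3 intervalIntegrable_const, intervalIntegral.integral_mul_const, hPdef,
    integral_poissonKernel hz, intervalIntegral.integral_const, smul_eq_mul, sub_zero]
  nlinarith

/-- Duality: by Fubini and the symmetry of the Poisson kernel, pairing `g` with the extension of `h`
equals pairing the extension of `g` with `h`. The extension of the continuous `g` converges
pointwise and is bounded by ‖g‖, so dominated convergence applies. -/
lemma hasWeakBoundaryValues_poissonExtension {h : Circle → ℝ} (hh : MemLinftyCircle h) :
    HasWeakBoundaryValues (poissonExtension h) h := by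
  have hi := hh.intervalIntegrable
  have hpi := Real.two_pi_pos
  obtain ⟨M, hM0, hM⟩ := hh.exists_ae_abs_le
  have hev : ∀ᶠ r : ℝ in 𝓝[<] 1, 0 < r ∧ r < 1 :=
    Filter.Eventually.and (mem_nhdsWithin_of_mem_nhds (lt_mem_nhds one_pos)) self_mem_nhdsWithin
  refine ⟨hev.mono fun r hr => ?_, fun g => ?_⟩
  · refine ContinuousOn.circleIntegrable hr.1.le fun z hz => ?_
    refine (harmonicAt_poissonExtension hi (mem_ball_zero_iff.2 ?_)).1.continuousAt.continuousWithinAt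
    rw [mem_sphere_zero_iff_norm.1 hz]
    exact hr.2
  · have hgc : Continuous fun θ => g (Circle.exp θ) := g.continuous.comp Circle.exp.continuous
    let Q : ℝ → ℝ → ℝ := fun r t => (2 * Real.pi)⁻¹ * ∫ θ in (0 : ℝ)..(2 * Real.pi),
      poissonKernel 0 (circleMap 0 r t) (circleMap 0 1 θ) * g (Circle.exp θ)
    have hswap : ∀ r : ℝ, 0 < r → r < 1 →
        ∫ θ in (0 : ℝ)..(2 * Real.pi), g (Circle.exp θ) * poissonExtension h (circleMap 0 r θ) =
        ∫ t in (0 : ℝ)..(2 * Real.pi), Q r t * h (Circle.exp t) := by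
      intro r hr0 hr1
      have hz : ∀ t, ‖circleMap 0 r t‖ < 1 := fun t => by
        rwa [norm_circleMap_zero, abs_of_pos hr0]
      have hne : ∀ a b, 1 - r ≤ ‖circleMap 0 1 a - circleMap 0 r b‖ := fun a b => by
        have := norm_sub_norm_le (circleMap 0 1 a) (circleMap 0 r b)
        rwa [norm_circleMap_zero, norm_circleMap_zero, abs_of_pos hr0, abs_one] at this
      have hKc : Continuous fun p : ℝ × ℝ =>
          poissonKernel 0 (circleMap 0 r p.1) (circleMap 0 1 p.2) := by
        simp only [poissonKernel_def]
        refine Continuous.div (by fun_prop) (by fun_prop) fun p => ?_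
        have h1 := hne p.2 p.1
        simp only [sub_zero]
        exact pow_ne_zero 2 (by linarith)
      have hKb : ∀ p : ℝ × ℝ, ‖g (Circle.exp p.1) * ((2 * Real.pi)⁻¹ *
          poissonKernel 0 (circleMap 0 r p.1) (circleMap 0 1 p.2))‖ ≤
          ‖g‖ * ((2 * Real.pi)⁻¹ * (1 / (1 - r) ^ 2)) := fun p => by
        rw [norm_mul, norm_mul, Real.norm_of_nonneg (inv_pos.2 hpi).le,
          Real.norm_of_nonneg (poissonKernel_nonneg_of_lt hr0.le hr1)]
        have h1 : poissonKernel 0 (circleMap 0 r p.1) (circleMap 0 1 p.2) ≤ 1 / (1 - r) ^ 2 := by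
          rw [poissonKernel_def]
          simp only [sub_zero, norm_circleMap_zero, abs_one, one_pow, sq_abs]
          have h2 : 0 < 1 - r := by linarith
          exact div_le_div₀ zero_le_one (by nlinarith [sq_nonneg r]) (by positivity)
            (pow_le_pow_left₀ h2.le (hne _ _) 2)
        exact mul_le_mul (g.norm_coe_le_norm _)
          (mul_le_mul_of_nonneg_left h1 (inv_pos.2 hpi).le)
          (mul_nonneg (inv_pos.2 hpi).le (poissonKernel_nonneg_of_lt hr0.le hr1)) (norm_nonneg _)
      have hF : Integrable (Function.uncurry fun θ t : ℝ => g (Circle.exp θ) * ((2 * Real.pi)⁻¹ *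
          poissonKernel 0 (circleMap 0 r θ) (circleMap 0 1 t)) * h (Circle.exp t))
          ((volume.restrict (Ioc 0 (2 * Real.pi))).prod
            (volume.restrict (Ioc 0 (2 * Real.pi)))) := by
        have h1 : IntegrableOn (fun t : ℝ => h (Circle.exp t)) (Ioc 0 (2 * Real.pi)) :=
          (intervalIntegrable_iff_integrableOn_Ioc_of_le hpi.le).1 hi
        exact (Integrable.comp_snd h1 (volume.restrict (Ioc 0 (2 * Real.pi)))).bdd_mul
          (((hgc.comp continuous_fst).mul
            (continuous_const.mul hKc)).aestronglyMeasurable) (ae_of_all _ hKb)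
      have h1 := integral_integral_swap hF
      simp only [intervalIntegral.integral_of_le hpi.le, Q] at *
      refine (integral_congr_ae (ae_of_all _ fun θ => ?_)).trans
        (h1.trans (integral_congr_ae (ae_of_all _ fun t => ?_)))
      · rw [poissonExtension_eq hi (hz θ), intervalIntegral.integral_of_le hpi.le,
          ← integral_const_mul, ← integral_const_mul]
        refine integral_congr_ae (ae_of_all _ fun t => ?_)
        simp only
        ring
      · simp only
        rw [← integral_const_mul, ← integral_mul_const]
        refine integral_congr_ae (ae_of_all _ fun θ => ?_)
        simp only
        rw [poissonKernel_circle_symm r t θ]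
        ring
    have hlim : Tendsto (fun r => ∫ t in (0 : ℝ)..(2 * Real.pi), Q r t * h (Circle.exp t)) (𝓝[<] 1)
        (𝓝 (∫ t in (0 : ℝ)..(2 * Real.pi), g (Circle.exp t) * h (Circle.exp t))) := by
      have hgi := hgc.intervalIntegrable (μ := volume) 0 (2 * Real.pi)
      have hQ : ∀ r, 0 < r → r < 1 → ∀ t, Q r t = poissonExtension (fun x => g x)
          (circleMap 0 r t) := fun r hr0 hr1 t =>
        (poissonExtension_eq hgi (by rwa [norm_circleMap_zero, abs_of_pos hr0])).symm
      refine intervalIntegral.tendsto_integral_filter_of_dominated_convergence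
        (fun t => ‖g‖ * |h (Circle.exp t)|) (hev.mono fun r hr => ?_) (hev.mono fun r hr => ?_)
        (hi.abs.const_mul _) (ae_of_all _ fun t _ => (tendsto_poisson_radial g t).mul_const _)
      · refine AEStronglyMeasurable.mul ?_ hi.def'.aestronglyMeasurable
        have : Continuous (Q r) := by
          rw [funext (hQ r hr.1 hr.2)]
          refine continuous_iff_continuousAt.2 fun t => ContinuousAt.comp
            (g := poissonExtension fun x => g x) ?_ (continuous_circleMap 0 r).continuousAt
          refine (harmonicAt_poissonExtension hgi (mem_ball_zero_iff.2 ?_)).1.continuousAt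
          rw [norm_circleMap_zero, abs_of_pos hr.1]
          exact hr.2
        exact this.aestronglyMeasurable
      · refine ae_of_all _ fun t _ => ?_
        rw [norm_mul, hQ r hr.1 hr.2]
        refine mul_le_mul_of_nonneg_right (abs_poissonExtension_le hgi
          (ae_of_all _ fun θ => g.norm_coe_le_norm _) ?_) (norm_nonneg _)
        rw [norm_circleMap_zero, abs_of_pos hr.1]
        exact hr.2
    exact hlim.congr' (hev.mono fun r hr => (hswap r hr.1 hr.2).symm)

/-! ### The nonlinear equation by the method of continuity. -/

/-- The solution of `Δv = -g` in the disk with zero boundary values. -/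
noncomputable def diskPotential (g : ℂ → ℝ) (z : ℂ) : ℝ :=
  (2 * Real.pi)⁻¹ * greenPotential (diskDensity g) z

lemma diskPotential_nonneg (g : ℂ → ℝ) (z : ℂ) : 0 ≤ diskPotential g z :=
  mul_nonneg (inv_pos.2 Real.two_pi_pos).le (greenPotential_nonneg _ _)

lemma diskPotential_congr {g g' : ℂ → ℝ} (h : g =ᵐ[volume.restrict (Metric.ball (0 : ℂ) 1)] g') :
    diskPotential g = diskPotential g' := by
  have : diskDensity g = diskDensity g' :=
    withDensity_congr_ae (h.mono fun z hz => by simp only [hz])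
  ext z
  rw [diskPotential, diskPotential, this]

lemma measurable_diskPotential {g : ℂ → ℝ} {C : ℝ} (hC : ∀ z, g z ≤ C) :
    Measurable (diskPotential g) := by
  have := isFiniteMeasure_diskDensity hC
  exact (measurable_greenPotential _).const_mul _

lemma locallyIntegrableOn_diskPotential {g : ℂ → ℝ} {C : ℝ} (hC : ∀ z, g z ≤ C) :
    LocallyIntegrableOn (diskPotential g) (Metric.ball 0 1) volume := by
  have := isFiniteMeasure_diskDensity hC
  exact locallyIntegrableOn_const_mul
    (integrableOn_greenPotential (ae_diskDensity_mem g)).locallyIntegrableOn _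

lemma setIntegral_diskPotential_mul_laplacian {g : ℂ → ℝ} (hg : Measurable g) (hg0 : ∀ z, 0 ≤ g z)
    {C : ℝ} (hC : ∀ z, g z ≤ C) {φ : ℂ → ℝ} (hφ : IsDiskTestFunction φ) :
    ∫ z in Metric.ball (0 : ℂ) 1, diskPotential g z * Laplacian.laplacian φ z =
      -∫ z in Metric.ball (0 : ℂ) 1, g z * φ z := by
  have := isFiniteMeasure_diskDensity hC
  simp only [diskPotential, mul_assoc]
  rw [integral_const_mul, setIntegral_greenPotential_mul_laplacian (ae_diskDensity_mem g) hφ,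
    integral_diskDensity hg hg0, mul_neg, ← mul_assoc, inv_mul_cancel₀ Real.two_pi_pos.ne', one_mul]

lemma diskPotential_le {g : ℂ → ℝ} (hg : Measurable g) (hg0 : ∀ z, 0 ≤ g z) {C : ℝ}
    (hC : ∀ z, g z ≤ C) {z : ℂ} (hz : ‖z‖ < 1) :
    diskPotential g z ≤ (2 * Real.pi)⁻¹ * (C * (√(1 - ‖z‖ ^ 2) * greenBound)) :=
  mul_le_mul_of_nonneg_left (greenPotential_diskDensity_le hg hg0 hC hz)
    (inv_pos.2 Real.two_pi_pos).le

lemma HasWeakBoundaryValues.const_mul {u : ℂ → ℝ} {h : Circle → ℝ} (hu : HasWeakBoundaryValues u h)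
    (c : ℝ) : HasWeakBoundaryValues (fun z => c * u z) fun x => c * h x := by
  refine ⟨hu.1.mono fun r hr => IntervalIntegrable.const_mul hr c, fun g => ?_⟩
  simp only [mul_left_comm _ c, intervalIntegral.integral_const_mul]
  exact (hu.2 g).const_mul c

lemma hasWeakBoundaryValues_diskPotential {g : ℂ → ℝ} {C : ℝ} (hC : ∀ z, g z ≤ C) :
    HasWeakBoundaryValues (diskPotential g) fun _ => 0 := by
  have := isFiniteMeasure_diskDensity hC
  have h := (hasWeakBoundaryValues_greenPotential (ae_diskDensity_mem g)).const_mul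
    (2 * Real.pi)⁻¹
  simp only [mul_zero] at h
  exact h

lemma locallyIntegrableOn_of_bounded {g : ℂ → ℝ} (hg : Measurable g) (hg0 : ∀ z, 0 ≤ g z) {C : ℝ}
    (hC : ∀ z, g z ≤ C) : LocallyIntegrableOn g (Metric.ball 0 1) volume :=
  (Measure.integrableOn_of_bounded (M := C) measure_ball_lt_top.ne hg.aestronglyMeasurable
    (ae_of_all _ fun z => by rw [Real.norm_of_nonneg (hg0 z)]; exact hC z)).locallyIntegrableOn

/-- Two potentials differ by at most `κ / 4` if, wherever the first exceeds the second, its density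
exceeds the second one by at most `κ`. -/
lemma diskPotential_sub_le {F₁ F₂ : ℂ → ℝ} {C κ : ℝ} (hκ : 0 ≤ κ)
    (hF₁ : Measurable F₁) (hF₁0 : ∀ z, 0 ≤ F₁ z) (hF₁C : ∀ z, F₁ z ≤ C)
    (hF₂ : Measurable F₂) (hF₂0 : ∀ z, 0 ≤ F₂ z) (hF₂C : ∀ z, F₂ z ≤ C)
    (h : ∀ᵐ z ∂volume.restrict (Metric.ball (0 : ℂ) 1),
      diskPotential F₂ z < diskPotential F₁ z → F₁ z - F₂ z ≤ κ) :
    ∀ᵐ z ∂volume.restrict (Metric.ball (0 : ℂ) 1),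
      diskPotential F₁ z - diskPotential F₂ z ≤ κ / 4 := by
  have l1 := locallyIntegrableOn_diskPotential hF₁C
  have l2 := locallyIntegrableOn_diskPotential hF₂C
  have m1 := locallyIntegrableOn_of_bounded hF₁ hF₁0 hF₁C
  have m2 := locallyIntegrableOn_of_bounded hF₂ hF₂0 hF₂C
  have hsub : IsWeakSubsolution (fun z => diskPotential F₁ z - diskPotential F₂ z)
      (fun z => F₂ z - F₁ z) := by
    intro φ hφ _
    simp only [sub_mul]
    rw [integral_sub (hφ.integrableOn_mul_laplacian l1) (hφ.integrableOn_mul_laplacian l2),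
      integral_sub (hφ.integrableOn_mul m2) (hφ.integrableOn_mul m1),
      setIntegral_diskPotential_mul_laplacian hF₁ hF₁0 hF₁C hφ,
      setIntegral_diskPotential_mul_laplacian hF₂ hF₂0 hF₂C hφ]
    linarith
  -- The barrier (κ/4)(1 - |z|²) has Laplacian -κ, which compensates the excess of the densities; it
  -- is at most κ/4 in the disk.
  have hp := contDiff_const_mul_one_sub_norm_sq (κ / 4)
  have hC0 : 0 ≤ C := (hF₁0 0).trans (hF₁C 0)
  have hle := (hsub.sub_contDiff (l1.sub l2) (m2.sub m1) hp).ae_nonpos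
    ((l1.sub l2).sub (locallyIntegrableOn_of_continuous hp.continuous))
    ((m2.sub m1).sub (locallyIntegrableOn_of_continuous (continuous_laplacian hp))) ?_ ?_
  · filter_upwards [hle] with z hz
    have : 0 ≤ κ / 4 * ‖z‖ ^ 2 := by positivity
    linarith
  · filter_upwards [h, ae_restrict_mem Metric.isOpen_ball.measurableSet] with z hz hzb hpos
    rw [laplacian_const_mul_one_sub_norm_sq]
    have hz1 : ‖z‖ < 1 := mem_ball_zero_iff.1 hzb
    have : 0 ≤ κ / 4 * (1 - ‖z‖ ^ 2) :=
      mul_nonneg (by positivity) (by nlinarith [norm_nonneg z])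
    have := hz (by linarith)
    linarith
  · intro ε hε
    -- Near the circle the first potential is uniformly small, while the second potential and the
    -- barrier enter with a negative sign.
    have hc : ContinuousAt
        (fun r : ℝ => (2 * Real.pi)⁻¹ * (C * (√(1 - r ^ 2) * greenBound))) 1 := by fun_prop
    have hlt : (fun r : ℝ => (2 * Real.pi)⁻¹ * (C * (√(1 - r ^ 2) * greenBound))) 1 < ε := by
      simpa using hε
    obtain ⟨δ, hδ, hd⟩ := Metric.eventually_nhds_iff.1 (hc.eventually_lt_const hlt)
    refine ⟨1 - δ, by linarith, ?_⟩
    filter_upwards [ae_restrict_mem Metric.isOpen_ball.measurableSet] with z hzb hzr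
    have hz1 : ‖z‖ < 1 := mem_ball_zero_iff.1 hzb
    have h1 := hd (y := ‖z‖) (by rw [Real.dist_eq, abs_lt]; constructor <;> linarith)
    have h2 := diskPotential_le hF₁ hF₁0 hF₁C hz1
    have h3 := diskPotential_nonneg F₂ z
    have : 0 ≤ κ / 4 * (1 - ‖z‖ ^ 2) :=
      mul_nonneg (by positivity) (by nlinarith [norm_nonneg z])
    linarith

/-- Solvability of `-Δv = s f(w - v) + g` with zero boundary values, for all bounded `g ≥ 0`. -/
def SolvableAt (f : ℝ → ℝ) (w : ℂ → ℝ) (s : ℝ) : Prop :=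
  ∀ (C : ℝ) (g : ℂ → ℝ), Measurable g → (∀ z, 0 ≤ g z) → (∀ z, g z ≤ C) →
    ∃ v : ℂ → ℝ, Measurable v ∧ v = diskPotential fun z => s * f (w z - v z) + g z

lemma solvableAt_zero (f : ℝ → ℝ) (w : ℂ → ℝ) : SolvableAt f w 0 := fun C g _ _ hC =>
  ⟨diskPotential g, measurable_diskPotential hC, by simp⟩

/-- For fixed `x` the extra term δf(w - x) counts as part of the datum, so solvability at `s` yields
a solution `v x`; a fixed point of x ↦ v x solves the equation at s + δ. This is why solvability is
asked for every bounded datum. -/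
lemma SolvableAt.add {f : ℝ → ℝ} {w : ℂ → ℝ} {s δ A L : ℝ} (h : SolvableAt f w s) (hs : 0 ≤ s)
    (hδ : 0 ≤ δ) (hw : Measurable w) (hfm : Measurable f) (hf0 : ∀ t, 0 ≤ f t)
    (hfA : ∀ t, f t ≤ A) (hmono : Monotone f) (hL : ∀ a b, |f a - f b| ≤ L * |a - b|)
    (hδL : δ * L ≤ 1) : SolvableAt f w (s + δ) := by
  intro C g hg hg0 hgC
  let μ : Measure ℂ := volume.restrict (Metric.ball (0 : ℂ) 1)
  have hμ : IsFiniteMeasure μ := ⟨by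
    rw [Measure.restrict_apply_univ]; exact measure_ball_lt_top⟩
  let G : Lp ℝ ⊤ μ → ℂ → ℝ := fun x z => g z + δ * f (w z - x z)
  have hxm : ∀ x : Lp ℝ ⊤ μ, Measurable x := fun x => (Lp.stronglyMeasurable x).measurable
  have hG : ∀ x, Measurable (G x) := fun x =>
    hg.add ((hfm.comp (hw.sub (hxm x))).const_mul δ)
  have hG0 : ∀ x z, 0 ≤ G x z := fun x z => add_nonneg (hg0 z) (mul_nonneg hδ (hf0 _))
  have hGC : ∀ x z, G x z ≤ C + δ * A := fun x z =>
    add_le_add (hgC z) (mul_le_mul_of_nonneg_left (hfA _) hδ)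
  choose v hvm hv using fun x => h (C + δ * A) (G x) (hG x) (hG0 x) (hGC x)
  let F : Lp ℝ ⊤ μ → ℂ → ℝ := fun x z => s * f (w z - v x z) + G x z
  have hF : ∀ x, Measurable (F x) := fun x =>
    ((hfm.comp (hw.sub (hvm x))).const_mul s).add (hG x)
  have hF0 : ∀ x z, 0 ≤ F x z := fun x z => add_nonneg (mul_nonneg hs (hf0 _)) (hG0 x z)
  have hFC : ∀ x z, F x z ≤ s * A + (C + δ * A) := fun x z =>
    add_le_add (mul_le_mul_of_nonneg_left (hfA _) hs) (hGC x z)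
  have hvF : ∀ x, v x = diskPotential (F x) := hv
  have hmem : ∀ x, MemLp (v x) ⊤ μ := fun x => by
    refine memLp_top_of_bound (hvm x).aestronglyMeasurable
      ((2 * Real.pi)⁻¹ * ((s * A + (C + δ * A)) * greenBound)) ?_
    filter_upwards [ae_restrict_mem Metric.isOpen_ball.measurableSet] with z hz
    have hz1 : ‖z‖ < 1 := mem_ball_zero_iff.1 hz
    have hC0 := (hF0 x 0).trans (hFC x 0)
    rw [hvF, Real.norm_of_nonneg (diskPotential_nonneg _ _)]
    refine (diskPotential_le (hF x) (hF0 x) (hFC x) hz1).trans ?_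
    have : √(1 - ‖z‖ ^ 2) ≤ 1 := Real.sqrt_le_one.2 (by nlinarith [norm_nonneg z])
    have h2 := mul_le_mul_of_nonneg_right this greenBound_nonneg
    rw [one_mul] at h2
    exact mul_le_mul_of_nonneg_left (mul_le_mul_of_nonneg_left h2 hC0)
      (inv_pos.2 Real.two_pi_pos).le
  have hone : ∀ x y : Lp ℝ ⊤ μ, ∀ᵐ z ∂μ, v x z - v y z ≤ ‖x - y‖ / 4 := fun x y => by
    have h1 : ∀ᵐ z ∂μ, ‖x z - y z‖ ≤ ‖x - y‖ := by
      have h2 := ae_le_eLpNormEssSup (f := (x - y : Lp ℝ ⊤ μ)) (μ := μ)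
      filter_upwards [h2, Lp.coeFn_sub x y] with z hz hz'
      rw [Pi.sub_apply] at hz'
      rw [← hz', Lp.norm_def, eLpNorm_exponent_top, ← toReal_enorm]
      refine ENNReal.toReal_mono ?_ hz
      rw [← eLpNorm_exponent_top]
      exact Lp.eLpNorm_ne_top _
    rw [hvF, hvF]
    refine diskPotential_sub_le (norm_nonneg _) (hF x) (hF0 x) (hFC x) (hF y) (hF0 y) (hFC y) ?_
    filter_upwards [h1] with z hz hlt
    rw [← hvF, ← hvF] at hlt
    -- Where v x > v y, monotonicity of `f` gives this term the right sign. Only the δ-term remains,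
    -- and it is controlled by δL ≤ 1, so the contraction ratio does not depend on `s`.
    have h3 : s * f (w z - v x z) ≤ s * f (w z - v y z) :=
      mul_le_mul_of_nonneg_left (hmono (by linarith)) hs
    have h4 : δ * f (w z - x z) - δ * f (w z - y z) ≤ ‖x - y‖ := by
      rw [← mul_sub]
      refine (mul_le_mul_of_nonneg_left ((le_abs_self _).trans (hL _ _)) hδ).trans ?_
      have h5 : |w z - x z - (w z - y z)| = ‖x z - y z‖ := by
        rw [Real.norm_eq_abs, abs_sub_comm]; congr 1; ring
      rw [h5, ← mul_assoc]
      refine (mul_le_mul_of_nonneg_right hδL (norm_nonneg _)).trans ?_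
      rwa [one_mul]
    simp only [F, G]
    linarith
  let S : Lp ℝ ⊤ μ → Lp ℝ ⊤ μ := fun x => (hmem x).toLp
  have hS : ContractingWith (1 / 4) S := by
    refine ⟨by norm_num [← NNReal.coe_lt_coe], LipschitzWith.of_dist_le_mul fun x y => ?_⟩
    rw [dist_eq_norm, dist_eq_norm]
    have h6 := Lp.norm_le_of_ae_bound (f := S x - S y) (C := ‖x - y‖ / 4) (by positivity) (by
      filter_upwards [hone x y, hone y x, (hmem x).coeFn_toLp, (hmem y).coeFn_toLp,
        Lp.coeFn_sub (S x) (S y)] with z h1 h2 h3 h4 h5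
      rw [h5, Pi.sub_apply, Real.norm_eq_abs, abs_le]
      simp only [S]
      rw [h3, h4]
      rw [norm_sub_rev] at h2
      constructor <;> linarith)
    simp only [ENNReal.toReal_top, inv_zero, Real.rpow_zero, one_mul] at h6
    refine h6.trans (le_of_eq ?_)
    push_cast
    ring
  let x := hS.fixedPoint
  have hx : (v x) =ᵐ[μ] x := by
    have h7 := (hmem x).coeFn_toLp
    have h8 : S x = x := hS.fixedPoint_isFixedPt
    change (S x : ℂ → ℝ) =ᵐ[μ] v x at h7
    rw [h8] at h7
    exact h7.symm
  -- The fixed point equals `v x` only almost everywhere, but a potential depends only on the class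
  -- of its density, so the equation holds at every point.
  refine ⟨v x, hvm x, (hvF x).trans (diskPotential_congr ?_)⟩
  filter_upwards [hx] with z hz
  simp only [F, G, ← hz]
  ring

/-- The admissible step length depends only on the Lipschitz constant, so N > L steps of length 1/N
lead from s = 0 to s = 1; there the datum g = 0 is taken. -/
lemma exists_eq_diskPotential {f : ℝ → ℝ} {w : ℂ → ℝ} {A L : ℝ}
    (hw : Measurable w) (hfm : Measurable f) (hf0 : ∀ t, 0 ≤ f t) (hfA : ∀ t, f t ≤ A)
    (hmono : Monotone f) (hL : ∀ a b, |f a - f b| ≤ L * |a - b|) :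
    ∃ v : ℂ → ℝ, Measurable v ∧ v = diskPotential fun z => f (w z - v z) := by
  obtain ⟨N, hN⟩ := exists_nat_gt (max L 0)
  have hN0 : (0 : ℝ) < N := (le_max_right _ _).trans_lt hN
  have h : ∀ n : ℕ, SolvableAt f w (n * (N : ℝ)⁻¹) := fun n => by
    induction n with
    | zero => simpa using solvableAt_zero f w
    | succ n ih =>
      have := ih.add (δ := (N : ℝ)⁻¹) (by positivity) (by positivity) hw hfm hf0 hfA hmono hL
        (by rw [inv_mul_le_one₀ hN0]; exact (le_max_left _ _).trans hN.le)
      convert this using 1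
      push_cast
      ring
  obtain ⟨v, hvm, hv⟩ := h N 0 0 measurable_const (fun _ => le_rfl) fun _ => le_rfl
  refine ⟨v, hvm, hv.trans ?_⟩
  simp [hN0.ne']

/-! ### Truncation of the exponential and the conclusion. -/

/-- The nonlinearity `4 e^{2t}`, made constant above the level `M`. -/
noncomputable def truncatedExp (M t : ℝ) : ℝ := 4 * Real.exp (2 * min t M)

lemma truncatedExp_nonneg (M t : ℝ) : 0 ≤ truncatedExp M t := by
  unfold truncatedExp; positivity

lemma truncatedExp_le (M t : ℝ) : truncatedExp M t ≤ 4 * Real.exp (2 * M) :=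
  mul_le_mul_of_nonneg_left (Real.exp_le_exp.2 (by linarith [min_le_right t M])) (by norm_num)

lemma monotone_truncatedExp (M : ℝ) : Monotone (truncatedExp M) := fun a b hab =>
  mul_le_mul_of_nonneg_left (Real.exp_le_exp.2 (by linarith [min_le_min_right M hab]))
    (by norm_num)

lemma continuous_truncatedExp (M : ℝ) : Continuous (truncatedExp M) := by
  unfold truncatedExp; fun_prop

lemma truncatedExp_of_le {M t : ℝ} (h : t ≤ M) : truncatedExp M t = 4 * Real.exp (2 * t) := by
  rw [truncatedExp, min_eq_left h]

lemma abs_truncatedExp_sub_le (M a b : ℝ) :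
    |truncatedExp M a - truncatedExp M b| ≤ 8 * Real.exp (2 * M) * |a - b| := by
  wlog hab : b ≤ a generalizing a b
  · rw [abs_sub_comm, abs_sub_comm a b]
    exact this b a (le_of_not_ge hab)
  rw [abs_of_nonneg (sub_nonneg.2 (monotone_truncatedExp M hab)), abs_of_nonneg (sub_nonneg.2 hab)]
  have h1 : min a M - min b M ≤ a - b := by
    rcases le_total b M with h | h
    · rw [min_eq_left h]; linarith [min_le_left a M]
    · rw [min_eq_right h]; linarith [min_le_right a M]
  -- The tangent line bound for the exponential gives e^{2a} - e^{2b} ≤ e^{2a}·2(a - b) for the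
  -- truncated values; with the prefactor 4 this is the constant 8.
  have h2 := Real.add_one_le_exp (2 * min b M - 2 * min a M)
  have h3 : Real.exp (2 * min b M) =
      Real.exp (2 * min a M) * Real.exp (2 * min b M - 2 * min a M) := by
    rw [← Real.exp_add]; ring_nf
  have h4 : Real.exp (2 * min a M) - Real.exp (2 * min b M) ≤
      Real.exp (2 * min a M) * (2 * (a - b)) := by
    rw [h3, ← mul_one_sub]
    exact mul_le_mul_of_nonneg_left (by linarith) (Real.exp_pos _).le
  have h5 : Real.exp (2 * min a M) ≤ Real.exp (2 * M) :=
    Real.exp_le_exp.2 (by linarith [min_le_right a M])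
  have h6 := mul_le_mul_of_nonneg_right h5 (show 0 ≤ 2 * (a - b) by linarith)
  unfold truncatedExp
  linarith

lemma continuousOn_poissonExtension {h : Circle → ℝ}
    (hh : IntervalIntegrable (fun θ : ℝ => h (Circle.exp θ)) volume 0 (2 * Real.pi)) :
    ContinuousOn (poissonExtension h) (Metric.ball 0 1) := fun _ hz =>
  (harmonicAt_poissonExtension hh hz).1.continuousAt.continuousWithinAt

/-- The Dirichlet problem is solvable. -/
theorem exists_isGaussDirichletSolution (ν : Measure (Metric.ball (0 : ℂ) 1)) [IsFiniteMeasure ν]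
    {h : Circle → ℝ} (hh : MemLinftyCircle h) : ∃ u : ℂ → ℝ, IsGaussDirichletSolution ν h u := by
  have hi := hh.intervalIntegrable
  obtain ⟨M, hM0, hM⟩ := hh.exists_ae_abs_le
  let B := Metric.ball (0 : ℂ) 1
  have hBm : MeasurableSet B := Metric.isOpen_ball.measurableSet
  let μ : Measure ℂ := ν.map Subtype.val
  have hμ : ∀ᵐ w ∂μ, w ∈ Metric.ball (0 : ℂ) 1 :=
    (ae_map_iff measurable_subtype_coe.aemeasurable hBm).2 (ae_of_all _ fun w => w.2)
  let p := poissonExtension h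
  let G := greenPotential μ
  have hpc : ContinuousOn p B := continuousOn_poissonExtension hi
  have hpl : LocallyIntegrableOn p B volume := hpc.locallyIntegrableOn hBm
  have hGm : Measurable G := measurable_greenPotential μ
  have hGl : LocallyIntegrableOn G B volume := (integrableOn_greenPotential hμ).locallyIntegrableOn
  -- The Poisson integral is known to be continuous only in the disk; cutting it off outside makes
  -- `w` measurable on the whole plane.
  let w : ℂ → ℝ := fun z => B.indicator p z - G z
  have hw : Measurable w := by
    refine Measurable.sub ?_ hGm
    classical
    rw [← Set.piecewise_eq_indicator]
    exact hpc.measurable_piecewise continuousOn_const hBm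
  obtain ⟨v, hvm, hv⟩ := exists_eq_diskPotential hw (continuous_truncatedExp M).measurable
    (truncatedExp_nonneg M) (truncatedExp_le M) (monotone_truncatedExp M)
    (abs_truncatedExp_sub_le M)
  let F : ℂ → ℝ := fun z => truncatedExp M (w z - v z)
  have hF : Measurable F := (continuous_truncatedExp M).measurable.comp (hw.sub hvm)
  have hF0 : ∀ z, 0 ≤ F z := fun z => truncatedExp_nonneg _ _
  have hFC : ∀ z, F z ≤ 4 * Real.exp (2 * M) := fun z => truncatedExp_le _ _
  have hv : v = diskPotential F := hv
  have hvl : LocallyIntegrableOn v B volume := hv ▸ locallyIntegrableOn_diskPotential hFC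
  -- The truncation is inactive: the Poisson integral is at most `M` and both potentials are
  -- nonnegative, so the solution stays below `M`.
  have hFu : ∀ z ∈ B, F z = 4 * Real.exp (2 * (p z - G z - v z)) := fun z hz => by
    have h1 := (abs_le.1 (abs_poissonExtension_le hi hM (mem_ball_zero_iff.1 hz))).2
    have h2 : 0 ≤ G z := greenPotential_nonneg μ z
    have h3 : 0 ≤ v z := hv ▸ diskPotential_nonneg F z
    have h4 : w z = p z - G z := by simp only [w, indicator_of_mem hz]
    simp only [F, h4]
    exact truncatedExp_of_le (by simp only [p]; linarith)
  refine ⟨fun z => p z - G z - v z, ⟨(hpl.sub hGl).sub hvl, ?_, fun φ hφ => ?_⟩, ?_⟩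
  · have h1 : IntegrableOn F B := Measure.integrableOn_of_bounded (M := 4 * Real.exp (2 * M))
      measure_ball_lt_top.ne hF.aestronglyMeasurable
      (ae_of_all _ fun z => by rw [Real.norm_of_nonneg (hF0 z)]; exact hFC z)
    refine IntegrableOn.locallyIntegrableOn
      (IntegrableOn.congr_fun (h1.const_mul (4 : ℝ)⁻¹) (fun z hz => ?_) hBm)
    simp only [hFu z hz]
    ring
  · have hp0 : ∫ z in B, p z * Laplacian.laplacian φ z = 0 := by
      rw [hφ.setIntegral_mul_laplacian fun z hz => (harmonicAt_poissonExtension hi hz).1]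
      refine setIntegral_eq_zero_of_forall_eq_zero fun z hz => ?_
      rw [(harmonicAt_poissonExtension hi hz).2.self_of_nhds, Pi.zero_apply, zero_mul]
    have hμφ : ∫ z, φ z ∂μ = ∫ z : B, φ z ∂ν :=
      integral_map measurable_subtype_coe.aemeasurable hφ.1.continuous.aestronglyMeasurable
    have hFφ : ∫ z in B, F z * φ z =
        ∫ z in B, 4 * Real.exp (2 * (p z - G z - v z)) * φ z :=
      setIntegral_congr_fun hBm fun z hz => by simp only [hFu z hz]
    have hGφ : ∫ z in B, G z * Laplacian.laplacian φ z = _ :=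
      setIntegral_greenPotential_mul_laplacian hμ hφ
    have hvφ : ∫ z in B, v z * Laplacian.laplacian φ z = -∫ z in B, F z * φ z := by
      rw [hv]; exact setIntegral_diskPotential_mul_laplacian hF hF0 hFC hφ
    have i12 : IntegrableOn (fun z => p z * Laplacian.laplacian φ z -
        G z * Laplacian.laplacian φ z) B :=
      (hφ.integrableOn_mul_laplacian hpl).sub (hφ.integrableOn_mul_laplacian hGl)
    simp only [sub_mul]
    change ∫ z in B, (p z * Laplacian.laplacian φ z - G z * Laplacian.laplacian φ z -
      v z * Laplacian.laplacian φ z) = (∫ z in B, 4 * Real.exp (2 * (p z - G z - v z)) * φ z) +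
        2 * Real.pi * ∫ z : B, φ z ∂ν
    rw [integral_sub i12 (hφ.integrableOn_mul_laplacian hvl),
      integral_sub (hφ.integrableOn_mul_laplacian hpl) (hφ.integrableOn_mul_laplacian hGl),
      hp0, hGφ, hvφ, hμφ, hFφ]
    ring
  · have h0 : IntervalIntegrable (fun _ : ℝ => (0 : ℝ)) volume 0 (2 * Real.pi) :=
      intervalIntegrable_const
    have h1 := ((hasWeakBoundaryValues_poissonExtension hh).sub
      (hasWeakBoundaryValues_greenPotential hμ) hi h0).sub
      (hasWeakBoundaryValues_diskPotential hFC) (hi.sub h0) h0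
    simp only [sub_zero, ← hv] at h1
    exact h1

theorem theorem2p2 :
    -- existence and uniqueness (as an element of `L^1_loc` of the disk)
    (∀ (ν : Measure (Metric.ball (0 : ℂ) 1)) (h : Circle → ℝ),
      IsFiniteMeasure ν → MemLinftyCircle h →
        (∃ u : ℂ → ℝ, IsGaussDirichletSolution ν h u) ∧
        ∀ u v : ℂ → ℝ, IsGaussDirichletSolution ν h u → IsGaussDirichletSolution ν h v →
          u =ᵐ[volume.restrict (Metric.ball (0 : ℂ) 1)] v) ∧
    -- monotonicity
    (∀ (ν₁ ν₂ : Measure (Metric.ball (0 : ℂ) 1)) (h₁ h₂ : Circle → ℝ) (u₁ u₂ : ℂ → ℝ),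
      IsFiniteMeasure ν₁ → IsFiniteMeasure ν₂ → MemLinftyCircle h₁ → MemLinftyCircle h₂ →
        IsGaussDirichletSolution ν₁ h₁ u₁ → IsGaussDirichletSolution ν₂ h₂ u₂ →
        (∀ᵐ θ ∂(volume.restrict (Ioc 0 (2 * Real.pi))),
          h₁ (Circle.exp θ) ≤ h₂ (Circle.exp θ)) →
        ν₂ ≤ ν₁ →
          u₁ ≤ᵐ[volume.restrict (Metric.ball (0 : ℂ) 1)] u₂) := by

  refine ⟨fun ν h hν hh => ⟨exists_isGaussDirichletSolution ν hh, fun u v hu hv => ?_⟩,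
    fun ν₁ ν₂ h₁ h₂ u₁ u₂ _ _ hh₁ hh₂ hu₁ hu₂ hh hν => hu₁.ae_le_of_le hh₁ hh₂ hu₂ hh hν⟩
  exact Filter.EventuallyLE.antisymm
    (hu.ae_le_of_le hh hh hv (ae_of_all _ fun _ => le_rfl) le_rfl)
    (hv.ae_le_of_le hh hh hu (ae_of_all _ fun _ => le_rfl) le_rfl)
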